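/- All graphs are finite and simple, and $k$ ranges over the non-negative integers. A vertex set is connected if it induces a non-empty connected subgraph. A *strict bramble* of a graph $G$ is a collection of connected vertex sets of $G$, every two of which intersect; its *order* is the minimum size of a vertex set that meets all its members; the *strict bramble number* $\mathsf{sbn}(G)$ is the maximum order of a strict bramble of $G$. Let $\mathcal G_k$ be the class of graphs with $\mathsf{sbn}(G)\le k$. A graph $G\in\mathcal G_k$ is *edge-maximal* if adding any missing edge to $G$ yields a graph that is not in $\mathcal G_k$. A *minimal separator* of $G$ is a set $S$ that, for some vertices $x,y\notin S$, is inclusion-minimal among the vertex sets $S'$ avoiding $x$ and $y$ such that $x,y$ lie in different components of $G-S'$; its *connectivity-degree* is the number of components of $G-S$. Maximal cliques are identified with their vertex sets. A maximal clique is *external* if it contains at most one minimal separator. For a minimal separator $S$, let $\mathcal K_G(S)$ be the set of external maximal cliques that contain $S$; $S$ is *external* if $\mathcal K_G(S)\ne\emptyset$ and *internal* otherwise. A graph $G$ is a *$k$-domino-tree* if it is a complete graph on at most $k$ vertices, or it satisfies: (i) $G$ is chordal; (ii) every minimal separator of $G$ has size $k$; (iii) every maximal clique has size in $[k+1,2k]$;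 (iv) every maximal clique contains at most two minimal separators; (v) every maximal clique that contains exactly two minimal separators $S,S'$ is equal to $S\cup S'$; (vi) no internal minimal separator of connectivity-degree two is contained in the union of two other minimal separators; (vii) for every external minimal separator $S$ of connectivity-degree two, the union of the maximal cliques that contain $S$ has more than $2k$ vertices; (viii) for every external minimal separator $S$ and all distinct $K,K'\in\mathcal K_G(S)$, $|K\setminus S|+|K'\setminus S|>k$. **Theorem.** 1. Let $G\in\mathcal G_k$. Then $G$ is edge-maximal if and only if $G$ is a $k$-domino-tree. 2. Let $k\ge 1$ and let $G\in\mathcal G_k$ be a graph with $n\ge k$ vertices. Then $$|E(G)|\le \frac{3k-1}{2}\,n-k^2-\frac k2\,(n \bmod k)+\frac12\,(n\bmod k)^2 .$$ 3. This bound is tight: for all $n\ge k\ge 1$ there is an edge-maximal graph of $\mathcal G_k$ with $n$ vertices that attains equality. 4. For all $k\ge 1$ and $n\ge 3k$ there are edge-maximal graphs $G,G'$ of $\mathcal G_k$, both with $n$ vertices, such that $$|E(G)|-|E(G')|\ge \frac{k-1}{2}\,n-\frac k2\,(n\bmod k)+\frac12\,(n\bmod k)^2-3\binom k2 .$$ In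 particular, edge-maximal graphs with the same number of vertices can have different numbers of edges: this happens for $k=2$, $n=8$. -/

import Mathlib

namespace StrictBramble

variable {V : Type*}

/-- A set of vertices is connected if it induces a connected (in particular non-empty) subgraph. -/
def IsConnectedSet (G : SimpleGraph V) (A : Set V) : Prop :=
  (G.induce A).Connected

/-- A strict bramble: a collection of pairwise intersecting connected vertex sets. -/
def IsStrictBramble (G : SimpleGraph V) (B : Set (Set V)) : Prop :=
  (∀ A ∈ B, IsConnectedSet G A) ∧ ∀ A ∈ B, ∀ A' ∈ B, (A ∩ A').Nonempty

/-- `X` covers `B` if it meets every member of `B`. -/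
def Covers (X : Set V) (B : Set (Set V)) : Prop :=
  ∀ A ∈ B, (A ∩ X).Nonempty

/-- The order of a collection of vertex sets: the minimum size of a cover. -/
noncomputable def order (B : Set (Set V)) : ℕ :=
  sInf {n | ∃ X : Set V, Covers X B ∧ X.ncard = n}

/-- The strict bramble number: the maximum order of a strict bramble. -/
noncomputable def sbn (G : SimpleGraph V) : ℕ :=
  sSup {n | ∃ B : Set (Set V), IsStrictBramble G B ∧ order B = n}

/-- `G` is an edge-maximal member of the class of graphs of strict bramble number at most `k`:
it belongs to the class, and the addition of any missing edge leads out of the class. -/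
def IsEdgeMaximal (G : SimpleGraph V) (k : ℕ) : Prop :=
  sbn G ≤ k ∧ ∀ x y : V, x ≠ y → ¬ G.Adj x y → k < sbn (G ⊔ SimpleGraph.edge x y)

/-- The number of edges. -/
noncomputable def numEdges (G : SimpleGraph V) : ℕ :=
  G.edgeSet.ncard

/-- Every induced cycle is a triangle. -/
def IsChordal (G : SimpleGraph V) : Prop :=
  ∀ n : ℕ, 4 ≤ n → IsEmpty (SimpleGraph.cycleGraph n ↪g G)

/-- `x` and `y` lie in different connected components of `G - S`. -/
def IsSeparator (G : SimpleGraph V) (x y : V) (S : Set V) : Prop :=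
  ∃ (hx : x ∈ Sᶜ) (hy : y ∈ Sᶜ), ¬ (G.induce Sᶜ).Reachable ⟨x, hx⟩ ⟨y, hy⟩

/-- `S` is an inclusion-minimal `(x, y)`-separator for some vertices `x`, `y`. -/
def IsMinSeparator (G : SimpleGraph V) (S : Set V) : Prop :=
  ∃ x y : V, Minimal (IsSeparator G x y) S

/-- The connectivity-degree of `S`: the number of connected components of `G - S`. -/
noncomputable def cdeg (G : SimpleGraph V) (S : Set V) : ℕ :=
  Nat.card (G.induce Sᶜ).ConnectedComponent

/-- A maximal clique, given by its vertex set. -/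
def IsMaxClique (G : SimpleGraph V) (K : Set V) : Prop :=
  Maximal G.IsClique K

/-- The minimal separators of `G` that are contained in `K`. -/
def minSeparatorsIn (G : SimpleGraph V) (K : Set V) : Set (Set V) :=
  {S | IsMinSeparator G S ∧ S ⊆ K}

/-- A maximal clique is external if it contains at most one minimal separator. -/
def IsExternalClique (G : SimpleGraph V) (K : Set V) : Prop :=
  IsMaxClique G K ∧ (minSeparatorsIn G K).ncard ≤ 1

/-- The external family of `S`: all external maximal cliques that contain `S`. -/
def externalFamily (G : SimpleGraph V) (S : Set V) : Set (Set V) :=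
  {K | IsExternalClique G K ∧ S ⊆ K}

/-- The valiancy of a member `K` of the external family of `S`: the number of vertices of `K`
outside `S`. -/
noncomputable def valiancy (S K : Set V) : ℕ :=
  (K \ S).ncard

/-- A minimal separator is external if its external family is non-empty. -/
def IsExternalSeparator (G : SimpleGraph V) (S : Set V) : Prop :=
  IsMinSeparator G S ∧ (externalFamily G S).Nonempty

/-- A minimal separator is internal if its external family is empty. -/
def IsInternalSeparator (G : SimpleGraph V) (S : Set V) : Prop :=
  IsMinSeparator G S ∧ externalFamily G S = ∅

/-- The eight defining properties of a `k`-domino-tree that is not a small complete graph. -/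
structure IsProperDominoTree (G : SimpleGraph V) (k : ℕ) : Prop where
  chordal : IsChordal G
  separator_size : ∀ S, IsMinSeparator G S → S.ncard = k
  clique_size : ∀ K, IsMaxClique G K → K.ncard ∈ Set.Icc (k + 1) (2 * k)
  at_most_two : ∀ K, IsMaxClique G K → (minSeparatorsIn G K).ncard ≤ 2
  eq_union : ∀ K, IsMaxClique G K → ∀ S S', S ≠ S' → minSeparatorsIn G K = {S, S'} →
    K = S ∪ S'
  internal_two : ∀ S, IsInternalSeparator G S → cdeg G S = 2 →
    ∀ T T', IsMinSeparator G T → IsMinSeparator G T' → T ≠ S → T' ≠ S → T ≠ T' → ¬ S ⊆ T ∪ T'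
  external_two : ∀ S, IsExternalSeparator G S → cdeg G S = 2 →
    2 * k < (⋃₀ {K | IsMaxClique G K ∧ S ⊆ K}).ncard
  external_family : ∀ S, IsExternalSeparator G S →
    ∀ K ∈ externalFamily G S, ∀ K' ∈ externalFamily G S, K ≠ K' →
      k < valiancy S K + valiancy S K'

/-- `G` is a `k`-domino-tree: a complete graph on at most `k` vertices, or a graph with the eight
properties above. -/
def IsDominoTree (G : SimpleGraph V) (k : ℕ) : Prop :=
  (G = ⊤ ∧ Nat.card V ≤ k) ∨ IsProperDominoTree G k

/-- The value `(3k - 1)/2 * n - k² - k/2 * (n mod k) + (n mod k)²/2`. -/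
def edgeBound (n k : ℕ) : ℚ :=
  (3 * (k : ℚ) - 1) / 2 * n - (k : ℚ) ^ 2 - (k : ℚ) / 2 * ((n % k : ℕ) : ℚ)
    + 1 / 2 * ((n % k : ℕ) : ℚ) ^ 2

/-- The value `(k - 1)/2 * n - k/2 * (n mod k) + (n mod k)²/2 - 3 * (k choose 2)`. -/
def gapBound (n k : ℕ) : ℚ :=
  ((k : ℚ) - 1) / 2 * n - (k : ℚ) / 2 * ((n % k : ℕ) : ℚ)
    + 1 / 2 * ((n % k : ℕ) : ℚ) ^ 2 - 3 * (k.choose 2 : ℚ)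

end StrictBramble

/-! Everything rests on a duality: the strict bramble number is at most `k` exactly when there is a
lenient tree-decomposition with bags of size at most `k`, where an edge may span two adjacent bags
(`exists_LTD_of_sbn_le`, `LTD.sbn_le`). On at least `k` vertices the bags can be padded to size
exactly `k`, and the union of any two adjacent bags can be made complete without leaving the class
(`exists_CDec_of_sbn_le`). Such a completion is chordal and stays connected when fewer than `k`
vertices are deleted, and counting its edges along the tree gives the upper bound
(`CDec.ncard_edgesIn_le`).

An edge-maximal graph is its own completion, and any two of its non-adjacent vertices are separated
by at most `k` vertices, so all its minimal separators have size exactly `k`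
(`IsEdgeMaximal.isUniform`). In a chordal graph of this kind, the maximal cliques containing a
minimal separator `S` correspond to the components of `G - S`: each consists of `S` and the core of
a component, that is, its vertices complete to `S`.

Domino-trees are edge-maximal because a new edge between two components of `G - S` gives a haven:
`S` is sent to the union of these two components, and any other `k`-set `X` to the component of `G -
X` that contains `S \ X` (`IsUniform.lt_sbn_sup_edge`). The domino conditions make these sets
intersect pairwise.

Conversely, let the cores of two components of `G - S` be joined in an edge-maximal graph. A strict
bramble of order more than `k` arises, and each of its members that avoids `S` meets both cores
(`IsEdgeMaximal.exists_bramble`). If a domino condition failed, there would be two sets of at most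
`k` vertices such that members avoiding them are forced to be disjoint.

The bound is attained by `k` universal vertices together with disjoint cliques of size `k`. The
sparse edge-maximal graphs are interval graphs built on the `k`-th power of a path. -/

namespace StrictBramble

/-! ### Connected vertex sets and components of vertex-deleted subgraphs -/

section Connectivity

variable {V : Type*} {G H : SimpleGraph V} {A A' J X Y S : Set V} {u v w x y : V}

theorem IsConnectedSet.nonempty (hA : IsConnectedSet G A) : A.Nonempty :=
  Set.nonempty_coe_sort.1 (SimpleGraph.Connected.nonempty hA)

/-- A set closed under adjacency inside a connected set that it meets contains it. -/
theorem IsConnectedSet.subset_of_closed (hA : IsConnectedSet G A) (hx : x ∈ A) (hxJ : x ∈ J)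
    (hJ : ∀ u ∈ A, u ∈ J → ∀ w ∈ A, G.Adj u w → w ∈ J) : A ⊆ J := by
  intro y hy
  have key : ∀ a b : A, (G.induce A).Walk a b → (a : V) ∈ J → (b : V) ∈ J := by
    intro a b p
    induction p with
    | nil => exact id
    | cons h _ ih => exact fun ha => ih (hJ _ (Subtype.prop _) ha _ (Subtype.prop _) h)
  obtain ⟨p⟩ := SimpleGraph.Connected.preconnected hA ⟨x, hx⟩ ⟨y, hy⟩
  exact key _ _ p hxJ

/-- Together with `IsConnectedSet.subset_of_closed` this replaces walks by closure under adjacency,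
the form in which connectedness is handled almost everywhere below. -/
theorem isConnectedSet_of (hx : x ∈ A)
    (h : ∀ J ⊆ A, x ∈ J → (∀ u ∈ J, ∀ w ∈ A, G.Adj u w → w ∈ J) → A ⊆ J) :
    IsConnectedSet G A := by
  have key := h {y | ∃ hy : y ∈ A, (G.induce A).Reachable ⟨x, hx⟩ ⟨y, hy⟩}
    (fun y hy => hy.1) ⟨hx, SimpleGraph.Reachable.refl _⟩ (by
      rintro u ⟨hu, hxu⟩ w hw huw
      refine ⟨hw, hxu.trans (SimpleGraph.Adj.reachable ?_)⟩
      exact huw)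
  have : Nonempty A := ⟨⟨x, hx⟩⟩
  refine SimpleGraph.Connected.mk ?_
  rintro ⟨a, ha⟩ ⟨b, hb⟩
  exact (key ha).2.symm.trans (key hb).2

theorem isConnectedSet_singleton (G : SimpleGraph V) (v : V) : IsConnectedSet G {v} :=
  isConnectedSet_of (x := v) rfl fun J _ hv _ => by simpa using hv

theorem IsConnectedSet.mono_graph (hA : IsConnectedSet G A) (h : G ≤ H) : IsConnectedSet H A := by
  obtain ⟨x, hx⟩ := hA.nonempty
  exact isConnectedSet_of hx fun J _ hxJ hJ =>
    hA.subset_of_closed hx hxJ fun u _ huJ w hw huw => hJ u huJ w hw (h huw)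

/-- A union of connected sets through a common vertex is connected. -/
theorem isConnectedSet_sUnion {F : Set (Set V)} (hF : F.Nonempty)
    (h : ∀ A ∈ F, IsConnectedSet G A ∧ x ∈ A) : IsConnectedSet G (⋃₀ F) := by
  obtain ⟨A₀, hA₀⟩ := hF
  refine isConnectedSet_of (x := x) ⟨A₀, hA₀, (h A₀ hA₀).2⟩ fun J _ hxJ hJ => ?_
  rintro y ⟨A, hA, hy⟩
  exact (h A hA).1.subset_of_closed (h A hA).2 hxJ
    (fun u _ huJ w hw huw => hJ u huJ w ⟨A, hA, hw⟩ huw) hy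

theorem IsConnectedSet.union (hA : IsConnectedSet G A) (hA' : IsConnectedSet G A')
    (h : (A ∩ A').Nonempty) : IsConnectedSet G (A ∪ A') := by
  obtain ⟨x, hx, hx'⟩ := h
  have := isConnectedSet_sUnion (G := G) (F := {A, A'}) (x := x) ⟨A, by simp⟩ (by
    rintro B (rfl | rfl)
    · exact ⟨hA, hx⟩
    · exact ⟨hA', hx'⟩)
  rwa [Set.sUnion_pair] at this

theorem isConnectedSet_pair (h : G.Adj x y) : IsConnectedSet G {x, y} :=
  isConnectedSet_of (x := x) (by simp) fun J _ hx hJ => by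
    rintro z (rfl | rfl)
    · exact hx
    · exact hJ x hx _ (by simp) h

theorem IsConnectedSet.union_of_adj (hA : IsConnectedSet G A) (hA' : IsConnectedSet G A')
    (hx : x ∈ A) (hy : y ∈ A') (h : G.Adj x y) : IsConnectedSet G (A ∪ A') := by
  have h1 := hA.union (isConnectedSet_pair h) ⟨x, hx, by simp⟩
  have h2 := h1.union hA' ⟨y, by simp, hy⟩
  convert h2 using 1
  ext z
  simp only [Set.mem_union, Set.mem_insert_iff, Set.mem_singleton_iff]
  constructor
  · tauto
  · rintro ((h | rfl | rfl) | h) <;> tauto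

theorem IsConnectedSet.insert_of_adj (hA : IsConnectedSet G A) (hx : x ∈ A) (h : G.Adj x y) :
    IsConnectedSet G (insert y A) := by
  have := hA.union_of_adj (isConnectedSet_singleton G y) hx rfl h
  rwa [Set.union_singleton] at this

/-- Attaching to a connected set vertices each of which has a neighbour in it. -/
theorem IsConnectedSet.union_of_forall_adj (hA : IsConnectedSet G A)
    (h : ∀ y ∈ A', y ∉ A → ∃ x ∈ A, G.Adj x y) : IsConnectedSet G (A ∪ A') := by
  obtain ⟨x, hx⟩ := hA.nonempty
  refine isConnectedSet_of (x := x) (Or.inl hx) fun J _ hxJ hJ => ?_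
  have hAJ : A ⊆ J := hA.subset_of_closed hx hxJ fun u _ huJ w hw => hJ u huJ w (Or.inl hw)
  rintro y (hy | hy)
  · exact hAJ hy
  · by_cases hyA : y ∈ A
    · exact hAJ hyA
    · obtain ⟨z, hz, hzy⟩ := h y hy hyA
      exact hJ z (hAJ hz) y (Or.inr hy) hzy

theorem isConnectedSet_of_isClique (hA : G.IsClique A) (hne : A.Nonempty) :
    IsConnectedSet G A := by
  obtain ⟨x, hx⟩ := hne
  refine isConnectedSet_of hx fun J _ hxJ hJ y hy => ?_
  by_cases h : x = y
  · exact h ▸ hxJ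
  · exact hJ x hxJ y hy (hA hx hy h)

/-- A connected set that meets `J` and is not contained in it has an edge leaving `J`. -/
theorem IsConnectedSet.exists_adj (hA : IsConnectedSet G A) (hx : x ∈ A) (hxJ : x ∈ J)
    (hy : y ∈ A) (hyJ : y ∉ J) : ∃ u ∈ A, u ∈ J ∧ ∃ w ∈ A, w ∉ J ∧ G.Adj u w := by
  by_contra! hcon
  exact hyJ (hA.subset_of_closed hx hxJ (fun u hu huJ w hw huw => by
    by_contra hwJ
    exact hcon u hu huJ w hw hwJ huw) hy)

/-- The component of `v` in `G - X`: empty if `v ∈ X`. -/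
def comp (G : SimpleGraph V) (X : Set V) (v : V) : Set V :=
  ⋃₀ {A | IsConnectedSet G A ∧ Disjoint A X ∧ v ∈ A}

theorem mem_comp_self (hv : v ∉ X) : v ∈ comp G X v :=
  ⟨{v}, ⟨isConnectedSet_singleton G v, by simpa using hv, rfl⟩, rfl⟩

theorem IsConnectedSet.subset_comp (hA : IsConnectedSet G A) (hX : Disjoint A X) (hv : v ∈ A) :
    A ⊆ comp G X v := fun _ hw => ⟨A, ⟨hA, hX, hv⟩, hw⟩

theorem disjoint_comp (G : SimpleGraph V) (X : Set V) (v : V) : Disjoint (comp G X v) X := by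
  rw [comp, Set.disjoint_sUnion_left]
  exact fun A hA => hA.2.1

theorem notMem_of_mem_comp (h : w ∈ comp G X v) : w ∉ X :=
  Set.disjoint_left.1 (disjoint_comp G X v) h

theorem isConnectedSet_comp (hv : v ∉ X) : IsConnectedSet G (comp G X v) :=
  isConnectedSet_sUnion ⟨{v}, isConnectedSet_singleton G v, by simpa using hv, rfl⟩
    fun _ hA => ⟨hA.1, hA.2.2⟩

theorem notMem_of_mem_comp' (h : w ∈ comp G X v) : v ∉ X := by
  obtain ⟨A, ⟨_, h2, h3⟩, _⟩ := h
  exact Set.disjoint_left.1 h2 h3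

theorem comp_symm (h : w ∈ comp G X v) : v ∈ comp G X w := by
  obtain ⟨A, ⟨h1, h2, h3⟩, h4⟩ := h
  exact ⟨A, ⟨h1, h2, h4⟩, h3⟩

theorem comp_eq (h : w ∈ comp G X v) : comp G X w = comp G X v := by
  have hv := notMem_of_mem_comp' h
  apply Set.Subset.antisymm
  · have hw := notMem_of_mem_comp h
    exact (isConnectedSet_comp hw).subset_comp (disjoint_comp _ _ _) (comp_symm h)
  · exact (isConnectedSet_comp hv).subset_comp (disjoint_comp _ _ _) h

theorem mem_comp_of_adj (hu : u ∈ comp G X v) (hw : w ∉ X) (h : G.Adj u w) :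
    w ∈ comp G X v := by
  have hv := notMem_of_mem_comp' hu
  refine ((isConnectedSet_comp hv).insert_of_adj hu h).subset_comp ?_
    (Set.mem_insert_of_mem _ (mem_comp_self hv)) (Set.mem_insert _ _)
  rw [Set.disjoint_insert_left]
  exact ⟨hw, disjoint_comp _ _ _⟩

theorem IsConnectedSet.subset_comp_of_mem (hA : IsConnectedSet G A) (hX : Disjoint A X)
    (hw : w ∈ A) (hwv : w ∈ comp G X v) : A ⊆ comp G X v :=
  comp_eq hwv ▸ hA.subset_comp hX hw

theorem comp_disjoint (h : v ∉ comp G X u) : Disjoint (comp G X u) (comp G X v) := by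
  rw [Set.disjoint_left]
  intro w hu hv
  apply h
  rw [← comp_eq hu, comp_eq hv]
  exact mem_comp_self (notMem_of_mem_comp' hv)

/-- Bridge from walks in the induced subgraph to components as vertex sets; later arguments about
separators reason with `comp`. -/
theorem isSeparator_iff : IsSeparator G x y S ↔ x ∉ S ∧ y ∉ S ∧ y ∉ comp G S x := by
  have key : ∀ (hx : x ∈ Sᶜ) (hy : y ∈ Sᶜ),
      (G.induce Sᶜ).Reachable ⟨x, hx⟩ ⟨y, hy⟩ ↔ y ∈ comp G S x := by
    intro hx hy
    constructor
    · rintro ⟨p⟩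
      have : ∀ a b : (Sᶜ : Set V), (G.induce Sᶜ).Walk a b → (a : V) ∈ comp G S x →
          (b : V) ∈ comp G S x := by
        intro a b p
        induction p with
        | nil => exact id
        | @cons _ c _ h _ ih => exact fun ha => ih (mem_comp_of_adj ha c.2 h)
      exact this _ _ p (mem_comp_self hx)
    · intro h
      have := (isConnectedSet_comp (G := G) hx).subset_of_closed
        (J := {z | ∃ hz : z ∈ Sᶜ, (G.induce Sᶜ).Reachable ⟨x, hx⟩ ⟨z, hz⟩})
        (mem_comp_self hx) ⟨hx, SimpleGraph.Reachable.refl _⟩ (by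
          rintro u hu ⟨hu', hxu⟩ w hw huw
          refine ⟨notMem_of_mem_comp hw, hxu.trans (SimpleGraph.Adj.reachable ?_)⟩
          exact huw) h
      exact this.2
  constructor
  · rintro ⟨hx, hy, h⟩
    exact ⟨hx, hy, fun hc => h ((key hx hy).2 hc)⟩
  · rintro ⟨hx, hy, h⟩
    exact ⟨hx, hy, fun hc => h ((key hx hy).1 hc)⟩

/-- The connectivity-degree counts the components of `G - S` as vertex sets. -/
theorem cdeg_eq_ncard : cdeg G S = {C | ∃ v, v ∉ S ∧ C = comp G S v}.ncard := by
  have key : ∀ x y : (Sᶜ : Set V), (G.induce Sᶜ).Reachable x y ↔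
      comp G S x = comp G S y := by
    intro x y
    have h := isSeparator_iff (G := G) (x := (x : V)) (y := y) (S := S)
    constructor
    · intro hxy
      by_contra hne
      obtain ⟨_, _, h'⟩ := h.2 ⟨x.2, y.2, fun hc => hne (comp_eq hc).symm⟩
      exact h' hxy
    · intro hxy
      by_contra hne
      exact (h.1 ⟨x.2, y.2, hne⟩).2.2 (hxy ▸ mem_comp_self y.2)
  rw [cdeg, ← Nat.card_coe_set_eq]
  refine Nat.card_congr (Equiv.ofBijective (fun c => ⟨c.lift (fun v : (Sᶜ : Set V) => comp G S (v : V))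
    (fun (v w : (Sᶜ : Set V)) p _ => (key v w).1 ⟨p⟩), ?_⟩) ⟨?_, ?_⟩)
  · induction c using SimpleGraph.ConnectedComponent.ind with
    | h v => exact ⟨v, v.2, rfl⟩
  · intro c d
    induction c using SimpleGraph.ConnectedComponent.ind with
    | h v =>
    induction d using SimpleGraph.ConnectedComponent.ind with
    | h w =>
    intro h
    exact SimpleGraph.ConnectedComponent.eq.2 ((key v w).2 (Subtype.mk.inj h))
  · rintro ⟨C, v, hv, rfl⟩
    exact ⟨(G.induce Sᶜ).connectedComponentMk ⟨v, hv⟩, rfl⟩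

end Connectivity

/-! ### Covers, orders and havens -/

section Order

variable {V : Type*} {G H : SimpleGraph V} {B : Set (Set V)} {k : ℕ}

theorem order_le_of_covers {X : Set V} (h : Covers X B) : order B ≤ X.ncard :=
  Nat.sInf_le ⟨X, h, rfl⟩

theorem covers_univ (hB : IsStrictBramble G B) : Covers Set.univ B := fun A hA => by
  simpa using (hB.1 A hA).nonempty

theorem exists_superset_ncard_eq {X : Set V} {k : ℕ} (h : X.ncard ≤ k) (hk : k ≤ Nat.card V) :
    ∃ Y, X ⊆ Y ∧ Y.ncard = k := by
  obtain ⟨Y, h1, _, h2⟩ := Set.exists_subsuperset_card_eq (Set.subset_univ X) h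
    (by rwa [Set.ncard_univ])
  exact ⟨Y, h1, h2⟩

theorem exists_disjoint_of_not_covers {X : Set V} (h : ¬ Covers X B) : ∃ A ∈ B, Disjoint A X := by
  simpa [Covers, Set.not_nonempty_iff_eq_empty, ← Set.disjoint_iff_inter_eq_empty] using h

theorem exists_covers_order (hB : IsStrictBramble G B) :
    ∃ X, Covers X B ∧ X.ncard = order B :=
  Nat.sInf_mem (s := {n | ∃ X : Set V, Covers X B ∧ X.ncard = n}) ⟨_, _, covers_univ hB, rfl⟩

theorem order_le_sbn (hB : IsStrictBramble G B) : order B ≤ sbn G := by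
  -- The whole vertex set covers every strict bramble, so the orders are bounded.
  refine le_csSup ⟨Nat.card V, ?_⟩ ⟨B, hB, rfl⟩
  rintro _ ⟨B', hB', rfl⟩
  rw [← Set.ncard_univ]
  exact order_le_of_covers (covers_univ hB')

theorem sbn_le_iff : sbn G ≤ k ↔ ∀ B, IsStrictBramble G B → ∃ X, Covers X B ∧ X.ncard ≤ k := by
  constructor
  · intro h B hB
    obtain ⟨X, hX, hc⟩ := exists_covers_order hB
    exact ⟨X, hX, hc.trans_le ((order_le_sbn hB).trans h)⟩
  · intro h
    -- The empty collection is a strict bramble, so the set of orders is non-empty.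
    refine csSup_le ⟨_, ∅, ⟨by simp, by simp⟩, rfl⟩ ?_
    rintro _ ⟨B, hB, rfl⟩
    obtain ⟨X, hX, hc⟩ := h B hB
    exact (order_le_of_covers hX).trans hc

theorem lt_sbn_iff : k < sbn G ↔ ∃ B, IsStrictBramble G B ∧ ∀ X, X.ncard ≤ k → ¬ Covers X B := by
  rw [← not_le, sbn_le_iff]
  push Not
  refine exists_congr fun B => and_congr_right fun _ => forall_congr' fun X => ?_
  constructor
  · intro h h1 h2
    exact absurd h1 (not_le.2 (h h2))
  · intro h h2
    by_contra h1
    exact h (not_lt.1 h1) h2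

theorem sbn_mono (h : G ≤ H) : sbn G ≤ sbn H := by
  rw [sbn_le_iff]
  intro B hB
  exact sbn_le_iff.1 le_rfl B ⟨fun A hA => (hB.1 A hA).mono_graph h, hB.2⟩

/-- A pairwise intersecting choice of connected sets avoiding the `k`-sets gives a strict bramble
of order more than `k`. -/
theorem lt_sbn_of_haven (hk : k ≤ Nat.card V) (β : Set V → Set V)
    (h1 : ∀ X, X.ncard = k → IsConnectedSet G (β X)) (h2 : ∀ X, X.ncard = k → Disjoint (β X) X)
    (h3 : ∀ X Y, X.ncard = k → Y.ncard = k → (β X ∩ β Y).Nonempty) : k < sbn G := by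
  refine lt_sbn_iff.2 ⟨β '' {X | X.ncard = k}, ⟨?_, ?_⟩, ?_⟩
  · rintro _ ⟨X, hX, rfl⟩
    exact h1 X hX
  · rintro _ ⟨X, hX, rfl⟩ _ ⟨Y, hY, rfl⟩
    exact h3 X Y hX hY
  · intro X hX hcov
    obtain ⟨Y, hXY, hY⟩ := exists_superset_ncard_eq hX hk
    obtain ⟨z, hz, hz'⟩ := hcov _ ⟨Y, hY, rfl⟩
    exact Set.disjoint_left.1 (h2 Y hY) hz (hXY hz')

theorem sbn_le_card (G : SimpleGraph V) : sbn G ≤ Nat.card V :=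
  sbn_le_iff.2 fun _ hB => ⟨Set.univ, covers_univ hB, (Set.ncard_univ V).le⟩

end Order

/-! ### Duality between strict brambles and lenient tree-decompositions -/

section Duality

variable {V : Type*} {G : SimpleGraph V} {𝓑 𝓑' : Set (Set V)} {U U' R R' Q X C Z : Set V}
  {B : Set (Set V)} {k : ℕ}

/-- Lenient tree-decompositions of the subgraph induced by `U`, rooted at a bag `R` and with `𝓑` as
set of bags: every edge lies in the union of two bags that are equal or adjacent in the tree. -/
inductive LTD (G : SimpleGraph V) : Set (Set V) → Set V → Set V → Prop
  | single (R : Set V) : LTD G {R} R R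
  | join {𝓑 𝓑' : Set (Set V)} {U U' R R' : Set V} (h : LTD G 𝓑 U R) (h' : LTD G 𝓑' U' R')
      (hi : U ∩ U' ⊆ R ∩ R')
      (ha : ∀ u ∈ U, u ∉ U' → ∀ v ∈ U', v ∉ U → G.Adj u v → u ∈ R ∧ v ∈ R') :
      LTD G (𝓑 ∪ 𝓑') (U ∪ U') R

theorem LTD.root_mem (h : LTD G 𝓑 U R) : R ∈ 𝓑 := by
  induction h with
  | single R => rfl
  | join _ _ _ _ ih _ => exact Or.inl ih

theorem LTD.bag_subset (h : LTD G 𝓑 U R) : ∀ Q ∈ 𝓑, Q ⊆ U := by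
  induction h with
  | single R => rintro Q rfl; rfl
  | join _ _ _ _ ih ih' =>
    rintro Q (hQ | hQ)
    · exact (ih Q hQ).trans Set.subset_union_left
    · exact (ih' Q hQ).trans Set.subset_union_right

/-- Joining a second decomposition to an arbitrary bag of the first one. -/
theorem LTD.attach (h : LTD G 𝓑 U Q) (hR : R ∈ 𝓑) (h' : LTD G 𝓑' U' R')
    (hi : U ∩ U' ⊆ R ∩ R')
    (ha : ∀ u ∈ U, u ∉ U' → ∀ v ∈ U', v ∉ U → G.Adj u v → u ∈ R ∧ v ∈ R') :
    LTD G (𝓑 ∪ 𝓑') (U ∪ U') Q := by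
  induction h with
  | single S =>
    obtain rfl : R = S := hR
    exact LTD.join (LTD.single R) h' hi ha
  | @join 𝓑₁ 𝓑₂ U₁ U₂ Q₁ R₂ h₁ h₂ hi₁₂ ha₁₂ ih₁ ih₂ =>
    rcases hR with hR | hR
    · have hRU := h₁.bag_subset R hR
      have key := LTD.join (ih₁ hR (fun x hx => hi ⟨Or.inl hx.1, hx.2⟩) ?_) h₂ ?_ ?_
      · convert key using 1
        · rw [Set.union_right_comm]
        · rw [Set.union_right_comm]
      · intro u hu hu' v hv hv' huv
        refine ha u (Or.inl hu) hu' v hv ?_ huv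
        rintro (h | h)
        · exact hv' h
        · exact hv' (hRU (hi ⟨Or.inr h, hv⟩).1)
      · rintro x ⟨hx | hx, hx2⟩
        · exact hi₁₂ ⟨hx, hx2⟩
        · exact hi₁₂ ⟨hRU (hi ⟨Or.inr hx2, hx⟩).1, hx2⟩
      · intro u hu hu2 v hv hv1 huv
        by_cases hu1 : u ∈ U₁
        · exact ha₁₂ u hu1 hu2 v hv (fun h => hv1 (Or.inl h)) huv
        · have hu' : u ∈ U' := hu.resolve_left hu1
          exact absurd (hRU (ha v (Or.inr hv) (fun h => hv1 (Or.inr h)) u hu'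
            (fun h => h.elim hu1 hu2) huv.symm).1) (fun h => hv1 (Or.inl h))
    · have hRU := h₂.bag_subset R hR
      have key := LTD.join h₁ (ih₂ hR (fun x hx => hi ⟨Or.inr hx.1, hx.2⟩) ?_) ?_ ?_
      · convert key using 1
        · rw [Set.union_assoc]
        · rw [Set.union_assoc]
      · intro u hu hu' v hv hv' huv
        refine ha u (Or.inr hu) hu' v hv ?_ huv
        rintro (h | h)
        · exact hv' (hRU (hi ⟨Or.inl h, hv⟩).1)
        · exact hv' h
      · rintro x ⟨hx1, hx | hx⟩
        · exact hi₁₂ ⟨hx1, hx⟩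
        · exact hi₁₂ ⟨hx1, hRU (hi ⟨Or.inl hx1, hx⟩).1⟩
      · intro u hu hu2 v hv hv1 huv
        by_cases hv2 : v ∈ U₂
        · exact ha₁₂ u hu (fun h => hu2 (Or.inl h)) v hv2 hv1 huv
        · have hv' : v ∈ U' := hv.resolve_left hv2
          exact absurd (hRU (ha u (Or.inl hu) (fun h => hu2 (Or.inr h)) v hv'
            (fun h => h.elim hv1 hv2) huv).1) (fun h => hu2 (Or.inl h))

/-- The underlying tree has no preferred root, since a join can be read from either side. The
duality proof has to root at a bag that covers the bramble. -/
theorem LTD.reroot (h : LTD G 𝓑 U R) (hQ : Q ∈ 𝓑) : LTD G 𝓑 U Q := by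
  induction h with
  | single S =>
    obtain rfl : Q = S := hQ
    exact LTD.single Q
  | @join 𝓑₁ 𝓑₂ U₁ U₂ Q₁ R₂ h₁ h₂ hi ha ih₁ ih₂ =>
    rcases hQ with hQ | hQ
    · exact (ih₁ hQ).attach h₁.root_mem h₂ hi ha
    · rw [Set.union_comm 𝓑₁, Set.union_comm U₁]
      refine (ih₂ hQ).attach h₂.root_mem h₁ (fun x hx => (hi hx.symm).symm) ?_
      intro u hu hu' v hv hv' huv
      exact (ha v hv hv' u hu hu' huv.symm).symm

/-- Gluing decompositions of `X ∪ C`, for components `C` of `G - X`, along the common root `X`. -/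
theorem LTD.glue (P : Set V → Prop) (hX : P X) (F : Set (Set V)) (hF : F.Finite)
    (hF1 : ∀ C ∈ F, ∃ v, v ∉ X ∧ C = comp G X v)
    (hF2 : ∀ C ∈ F, ∃ 𝓑, LTD G 𝓑 (X ∪ C) X ∧ ∀ Q ∈ 𝓑, P Q) :
    ∃ 𝓑, LTD G 𝓑 (X ∪ ⋃₀ F) X ∧ ∀ Q ∈ 𝓑, P Q := by
  induction F, hF using Set.Finite.induction_on with
  | empty =>
    refine ⟨{X}, ?_, ?_⟩
    · simpa using LTD.single X
    · rintro Q rfl; exact hX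
  | @insert C F hC _ ih =>
    obtain ⟨𝓑₁, h₁, hP₁⟩ := ih (fun D hD => hF1 D (Or.inr hD)) (fun D hD => hF2 D (Or.inr hD))
    obtain ⟨𝓑₂, h₂, hP₂⟩ := hF2 C (Or.inl rfl)
    have hdisj : ∀ D ∈ F, ∀ z ∈ D, z ∉ C := by
      intro D hD z hzD hzC
      obtain ⟨v, hv, rfl⟩ := hF1 C (Or.inl rfl)
      obtain ⟨w, hw, rfl⟩ := hF1 D (Or.inr hD)
      rw [← comp_eq hzC, comp_eq hzD] at hC
      exact hC hD
    refine ⟨𝓑₁ ∪ 𝓑₂, ?_, fun Q hQ => hQ.elim (hP₁ Q) (hP₂ Q)⟩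
    convert LTD.join h₁ h₂ ?_ ?_ using 1
    · ext x
      simp only [Set.sUnion_insert, Set.mem_union]
      tauto
    · rintro x ⟨hx | ⟨D, hD, hx⟩, hx' | hx'⟩
      · exact ⟨hx, hx⟩
      · exact ⟨hx, hx⟩
      · exact ⟨hx', hx'⟩
      · exact absurd hx' (hdisj D hD x hx)
    · intro u hu hu' v hv hv' huv
      exfalso
      have huX : u ∉ X := fun h => hu' (Or.inl h)
      have hvX : v ∉ X := fun h => hv' (Or.inl h)
      obtain ⟨D, hD, huD⟩ := hu.resolve_left huX
      obtain ⟨w, hw, rfl⟩ := hF1 D (Or.inr hD)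
      exact hv' (Or.inr ⟨_, hD, mem_comp_of_adj huD hvX huv⟩)

/-- Closedness means that the root bag cuts the rest of its part off from the outside. It passes to
both sides of a join, the right part being cut off by its own root. -/
theorem closed_of_join (hR : R ⊆ U) (hi : U ∩ U' ⊆ R ∩ R')
    (ha : ∀ u ∈ U, u ∉ U' → ∀ v ∈ U', v ∉ U → G.Adj u v → u ∈ R ∧ v ∈ R')
    (h : ∀ u ∈ U ∪ U', u ∉ R → ∀ w, G.Adj u w → w ∈ U ∪ U') :
    (∀ u ∈ U, u ∉ R → ∀ w, G.Adj u w → w ∈ U) ∧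
      ∀ u ∈ U', u ∉ R' → ∀ w, G.Adj u w → w ∈ U' := by
  constructor
  · intro u hu hu' w huw
    by_contra hw
    have hw2 : w ∈ U' := (h u (Or.inl hu) hu' w huw).resolve_left hw
    have hu2 : u ∉ U' := fun h => hu' (hi ⟨hu, h⟩).1
    exact hu' (ha u hu hu2 w hw2 hw huw).1
  · intro u hu hu' w huw
    by_contra hw
    have hu1 : u ∉ U := fun h => hu' (hi ⟨h, hu⟩).2
    have hw1 : w ∈ U := (h u (Or.inr hu) (fun h => hu1 (hR h)) w huw).resolve_right hw
    exact hu' (ha w hw1 hw u hu hu1 huw.symm).2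

/-- Restricting a decomposition to `X ∪ C`, where each bag `Q` also receives the members of `X` that
occur below it. -/
theorem LTD.restrict (hXC : Disjoint C X)
    (h : LTD G 𝓑 U R) : ∀ Ut, U ⊆ Ut → (∀ u ∈ Ut, u ∉ R → ∀ w, G.Adj u w → w ∈ Ut) →
    (∀ u ∈ U, u ∉ R → ∀ w, G.Adj u w → w ∈ U) → Z ∩ Ut ⊆ R →
    ∃ 𝓑', LTD G 𝓑' (U ∩ C ∪ X ∩ Ut) (R ∩ C ∪ X ∩ Ut) ∧ ∀ W ∈ 𝓑', ∃ Q ∈ 𝓑, ∃ Uq,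
      Q ⊆ Uq ∧ W = Q ∩ C ∪ X ∩ Uq ∧ (∀ u ∈ Uq, u ∉ Q → ∀ w, G.Adj u w → w ∈ Uq) ∧ Z ∩ Uq ⊆ Q := by
  induction h with
  | single R =>
    intro Ut hU h1 _ h3
    refine ⟨{R ∩ C ∪ X ∩ Ut}, LTD.single _, ?_⟩
    rintro W rfl
    exact ⟨R, rfl, Ut, hU, rfl, h1, h3⟩
  | @join 𝓑₁ 𝓑₂ U₁ U₂ R₁ R₂ h₁ h₂ hi ha ih₁ ih₂ =>
    intro Ut hU h1 h2 h3
    have hR₁ := h₁.bag_subset _ h₁.root_mem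
    have hR₂ := h₂.bag_subset _ h₂.root_mem
    obtain ⟨hc1, hc2⟩ := closed_of_join hR₁ hi ha h2
    -- `Ut` stands for the vertices at or below the current root in the full tree. The left part
    -- keeps this root and hence `Ut`; the right part starts afresh with `U₂`.
    obtain ⟨𝓑₁', H₁, HQ₁⟩ := ih₁ Ut (Set.subset_union_left.trans hU) h1 hc1 h3
    obtain ⟨𝓑₂', H₂, HQ₂⟩ := ih₂ U₂ subset_rfl hc2 hc2 (by
      rintro z ⟨hz, hz2⟩
      exact (hi ⟨hR₁ (h3 ⟨hz, hU (Or.inr hz2)⟩), hz2⟩).2)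
    refine ⟨𝓑₁' ∪ 𝓑₂', ?_, ?_⟩
    · have key := LTD.join H₁ H₂ ?_ ?_
      · convert key using 1
        ext x
        have := @hU x
        simp only [Set.mem_union, Set.mem_inter_iff] at this ⊢
        tauto
      · rintro x ⟨hx | hx, hx' | hx'⟩
        · exact ⟨Or.inl ⟨(hi ⟨hx.1, hx'.1⟩).1, hx.2⟩, Or.inl ⟨(hi ⟨hx.1, hx'.1⟩).2, hx.2⟩⟩
        · exact ⟨Or.inr ⟨hx'.1, hU (Or.inr hx'.2)⟩, Or.inr hx'⟩
        · exact absurd hx.1 (Set.disjoint_left.1 hXC hx'.2)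
        · exact ⟨Or.inr hx, Or.inr hx'⟩
      · intro u hu hu' v hv hv' huv
        have hvX : v ∉ X := fun h => hv' (Or.inr ⟨h, by
          rcases hv with hv | hv
          · exact hU (Or.inr hv.1)
          · exact hU (Or.inr hv.2)⟩)
        obtain ⟨hv2, hvC⟩ : v ∈ U₂ ∧ v ∈ C := hv.resolve_right fun h => hvX h.1
        have hv1 : v ∉ U₁ := fun h => hv' (Or.inl ⟨h, hvC⟩)
        have hu2 : u ∉ U₂ := by
          intro h
          rcases hu with hu | hu
          · exact hu' (Or.inl ⟨h, hu.2⟩)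
          · exact hu' (Or.inr ⟨hu.1, h⟩)
        have hvR : v ∈ R₂ := by
          by_contra hvR
          exact hu2 (hc2 v hv2 hvR u huv.symm)
        refine ⟨?_, Or.inl ⟨hvR, hvC⟩⟩
        rcases hu with hu | hu
        · exact Or.inl ⟨(ha u hu.1 hu2 v hv2 hv1 huv).1, hu.2⟩
        · exact Or.inr hu
    · rintro W (hW | hW)
      · obtain ⟨Q, hQ, h⟩ := HQ₁ W hW
        exact ⟨Q, Or.inl hQ, h⟩
      · obtain ⟨Q, hQ, h⟩ := HQ₂ W hW
        exact ⟨Q, Or.inr hQ, h⟩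

variable [Finite V]

/-- The step of the duality theorem that handles one component of the complement of a cover. -/
theorem exists_LTD_comp (hB : IsStrictBramble G B) (hX : Covers X B) (hXk : X.ncard ≤ k)
    (hmin : ∀ Y, Covers Y B → X.ncard ≤ Y.ncard) {v : V} (hv : v ∉ X)
    (ih : IsStrictBramble G (insert (comp G X v) B) →
      ∃ 𝓑 R, LTD G 𝓑 Set.univ R ∧ ∀ Q ∈ 𝓑, k < Q.ncard → ¬ Covers Q (insert (comp G X v) B)) :
    (∃ 𝓑 R, LTD G 𝓑 Set.univ R ∧ ∀ Q ∈ 𝓑, k < Q.ncard → ¬ Covers Q B) ∨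
      ∃ 𝓑, LTD G 𝓑 (X ∪ comp G X v) X ∧ ∀ Q ∈ 𝓑, k < Q.ncard → ¬ Covers Q B := by
  set C := comp G X v with hC
  have hCX : Disjoint C X := disjoint_comp G X v
  by_cases hdis : ∃ A ∈ B, Disjoint A C
  · obtain ⟨A, hA, hAC⟩ := hdis
    -- A member that misses `C` makes `C` an admissible bag, however large it is.
    refine Or.inr ⟨{X} ∪ {C}, LTD.join (LTD.single X) (LTD.single C) ?_ ?_, ?_⟩
    · exact subset_rfl
    · exact fun u hu _ w hw _ _ => ⟨hu, hw⟩
    · rintro Q (rfl | rfl) hQ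
      · exact absurd hXk (not_le.2 hQ)
      · intro hcov
        obtain ⟨z, hz, hz'⟩ := hcov A hA
        exact Set.disjoint_left.1 hAC hz hz'
  push Not at hdis
  have hdis' : ∀ A ∈ B, (A ∩ C).Nonempty := fun A hA => Set.not_disjoint_iff_nonempty_inter.1
    (hdis A hA)
  have hCc : IsConnectedSet G C := isConnectedSet_comp hv
  have hB' : IsStrictBramble G (insert C B) := by
    refine ⟨?_, ?_⟩
    · rintro A (rfl | hA)
      · exact hCc
      · exact hB.1 A hA
    · rintro A (rfl | hA) A' (rfl | hA')
      · rw [Set.inter_self]; exact hCc.nonempty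
      · rw [Set.inter_comm]; exact hdis' A' hA'
      · exact hdis' A hA
      · exact hB.2 A hA A' hA'
  obtain ⟨𝓑, R, hL, hadm⟩ := ih hB'
  by_cases hgood : ∀ Q ∈ 𝓑, k < Q.ncard → ¬ Covers Q B
  · exact Or.inl ⟨𝓑, R, hL, hgood⟩
  push Not at hgood
  obtain ⟨Z, hZ, hZk, hZB⟩ := hgood
  -- The bad bag `Z` covers `B` but not `B` with `C` added, so it misses `C`. Restricted to `X ∪ C`,
  -- the decomposition rooted at `Z` therefore has root `X`.
  have hZC : Disjoint Z C := by
    by_contra hcon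
    refine hadm Z hZ hZk ?_
    rintro A (rfl | hA)
    · rw [Set.inter_comm]; exact Set.not_disjoint_iff_nonempty_inter.1 hcon
    · exact hZB A hA
  have hCn : ∀ u ∈ C, ∀ w, G.Adj u w → w ∈ X ∪ C := by
    intro u hu w huw
    by_cases hw : w ∈ X
    · exact Or.inl hw
    · exact Or.inr (mem_comp_of_adj hu hw huw)
  obtain ⟨𝓑', hL', hbags⟩ := (hL.reroot hZ).restrict (Z := Z) hCX Set.univ subset_rfl
    (fun _ _ _ _ _ => trivial) (fun _ _ _ _ _ => trivial) Set.inter_subset_left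
  refine Or.inr ⟨𝓑', ?_, ?_⟩
  · convert hL' using 1
    · rw [Set.univ_inter, Set.inter_univ, Set.union_comm]
    · rw [hZC.inter_eq, Set.empty_union, Set.inter_univ]
  intro W hW hWk hcov
  obtain ⟨Q, hQ, Uq, hQU, rfl, hcl, hZU⟩ := hbags W hW
  -- Restriction does not enlarge bags: the part of `Q` that is dropped and the part of `X` that is
  -- not added together still cover `B`, hence have at least `X.ncard` vertices by the choice of
  -- `X`.
  have hcard : (Q ∩ C ∪ X ∩ Uq).ncard ≤ Q.ncard := by
    have h1 : Covers ((Q \ C) ∪ (X \ Uq)) B := by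
      intro A hA
      by_contra hcon
      rw [Set.not_nonempty_iff_eq_empty, ← Set.disjoint_iff_inter_eq_empty,
        Set.disjoint_union_right] at hcon
      have hQA : ∀ a ∈ A, a ∈ Q → a ∈ C := fun a ha haQ => by
        by_contra haC
        exact Set.disjoint_left.1 hcon.1 ha ⟨haQ, haC⟩
      have hXA : ∀ a ∈ A, a ∈ X → a ∈ Uq := fun a ha haX => by
        by_contra haU
        exact Set.disjoint_left.1 hcon.2 ha ⟨haX, haU⟩
      have hXI : ∀ a ∈ A, a ∈ X → a ∈ C ∪ Uq \ Q := fun a ha haX =>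
        Or.inr ⟨hXA a ha haX, fun h => Set.disjoint_left.1 hCX (hQA a ha h) haX⟩
      obtain ⟨x, hxA, hxX⟩ := hX A hA
      obtain ⟨z, hzA, hzZ⟩ := hZB A hA
      -- A member missing that set starts in `X`, stays in `C ∪ Uq \ Q` and never reaches `Z`, which
      -- it must meet.
      have := (hB.1 A hA).subset_of_closed (J := C ∪ Uq \ Q) hxA (hXI x hxA hxX) (by
        rintro u hu (huC | ⟨huU, huQ⟩) w hw huw
        · rcases hCn u huC w huw with h | h
          · exact hXI w hw h
          · exact Or.inl h
        · by_cases hwQ : w ∈ Q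
          · exact Or.inl (hQA w hw hwQ)
          · exact Or.inr ⟨hcl u huU huQ w huw, hwQ⟩) hzA
      rcases this with h | h
      · exact Set.disjoint_left.1 hZC hzZ h
      · exact h.2 (hZU ⟨hzZ, h.1⟩)
    have h2 := hmin _ h1
    have h3 := Set.ncard_union_le (Q \ C) (X \ Uq)
    have h4 := Set.ncard_union_le (Q ∩ C) (X ∩ Uq)
    have h5 := Set.ncard_inter_add_ncard_sdiff_eq_ncard Q C
    have h6 := Set.ncard_inter_add_ncard_sdiff_eq_ncard X Uq
    omega
  obtain ⟨A, hA, hAQ⟩ := exists_disjoint_of_not_covers (hadm Q hQ (hWk.trans_le hcard))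
  rcases hA with rfl | hA
  · rw [hAQ.symm.inter_eq, Set.empty_union] at hWk
    exact absurd ((Set.ncard_le_ncard Set.inter_subset_left).trans hXk) (not_le.2 hWk)
  · obtain ⟨w, hwA, hw | hw⟩ := hcov A hA
    · exact Set.disjoint_left.1 hAQ hwA hw.1
    · obtain ⟨z, hzA, hzZ⟩ := hZB A hA
      have := (hB.1 A hA).subset_of_closed (J := Uq) hwA hw.2 (fun u hu huU w' _ huw =>
        hcl u huU (Set.disjoint_left.1 hAQ hu) w' huw) hzA
      exact Set.disjoint_left.1 hAQ hzA (hZU ⟨hzZ, this⟩)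

/-- For every strict bramble there is a lenient tree-decomposition none of whose large bags
covers it. -/
theorem exists_LTD_of_isStrictBramble (hG : sbn G ≤ k) (hB : IsStrictBramble G B) :
    ∃ 𝓑 R, LTD G 𝓑 Set.univ R ∧ ∀ Q ∈ 𝓑, k < Q.ncard → ¬ Covers Q B := by
  -- The bramble grows in each step: an added component avoids the cover `X`, so it is a new member.
  induction hn : Nat.card (Set V) - B.ncard using Nat.strong_induction_on generalizing B with
  | _ n ih =>
  subst hn
  obtain ⟨X, hX, hXo⟩ := exists_covers_order hB
  have hXk : X.ncard ≤ k := hXo.trans_le ((order_le_sbn hB).trans hG)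
  have hmin : ∀ Y, Covers Y B → X.ncard ≤ Y.ncard := fun Y hY => hXo ▸ order_le_of_covers hY
  by_contra hcon
  have hcomp : ∀ v, v ∉ X →
      ∃ 𝓑, LTD G 𝓑 (X ∪ comp G X v) X ∧ ∀ Q ∈ 𝓑, k < Q.ncard → ¬ Covers Q B := by
    intro v hv
    refine (exists_LTD_comp hB hX hXk hmin hv fun hB' => ?_).resolve_left hcon
    refine ih _ ?_ hB' rfl
    have hnot : comp G X v ∉ B := fun h => by
      obtain ⟨z, hz, hz'⟩ := hX _ h
      exact notMem_of_mem_comp hz hz'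
    have h1 := Set.ncard_insert_of_notMem hnot
    have h2 := Set.ncard_le_card (insert (comp G X v) B)
    omega
  obtain ⟨𝓑, hL, hadm⟩ := LTD.glue (G := G) (X := X) (fun Q => k < Q.ncard → ¬ Covers Q B)
    (fun h => absurd hXk (not_le.2 h)) {C | ∃ v, v ∉ X ∧ C = comp G X v} (Set.toFinite _)
    (fun C hC => hC) (by
      rintro C ⟨v, hv, rfl⟩
      exact hcomp v hv)
  refine hcon ⟨𝓑, X, ?_, hadm⟩
  convert hL using 1
  symm
  rw [Set.eq_univ_iff_forall]
  intro x
  by_cases hx : x ∈ X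
  · exact Or.inl hx
  · exact Or.inr ⟨_, ⟨x, hx, rfl⟩, mem_comp_self hx⟩

/-- The duality theorem, hard direction. -/
theorem exists_LTD_of_sbn_le (hG : sbn G ≤ k) :
    ∃ 𝓑 R, LTD G 𝓑 Set.univ R ∧ ∀ Q ∈ 𝓑, Q.ncard ≤ k := by
  obtain ⟨𝓑, R, h, hQ⟩ := exists_LTD_of_isStrictBramble (B := ∅) hG ⟨by simp, by simp⟩
  refine ⟨𝓑, R, h, fun Q hQ' => ?_⟩
  by_contra hcon
  exact hQ Q hQ' (not_le.1 hcon) (by simp [Covers])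

omit [Finite V] in
-- Chase the member down the tree. By induction it is not inside the first part, hence it avoids
-- that part altogether. A member missed by the bag `R₂` meets it, and is then itself trapped
-- strictly below `R₂`.
theorem LTD.not_subset_diff (hB : IsStrictBramble G B) (h : LTD G 𝓑 U R)
    (hcov : ∀ Q ∈ 𝓑, ¬ Covers Q B) (hcl : ∀ u ∈ U, u ∉ R → ∀ w, G.Adj u w → w ∈ U) :
    ∀ E ∈ B, ¬ E ⊆ U \ R := by
  induction h with
  | single R =>
    intro E hE hsub
    obtain ⟨x, hx⟩ := (hB.1 E hE).nonempty
    exact (hsub hx).2 (hsub hx).1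
  | @join 𝓑₁ 𝓑₂ U₁ U₂ R₁ R₂ h₁ h₂ hi ha ih₁ ih₂ =>
    obtain ⟨hc1, hc2⟩ := closed_of_join (h₁.bag_subset _ h₁.root_mem) hi ha hcl
    have IH₁ := ih₁ (fun Q hQ => hcov Q (Or.inl hQ)) hc1
    have IH₂ := ih₂ (fun Q hQ => hcov Q (Or.inr hQ)) hc2
    intro E hE hsub
    obtain ⟨x, hxE, hxU⟩ : ∃ x ∈ E, x ∉ U₁ := by
      by_contra! hcon
      exact IH₁ E hE fun x hx => ⟨hcon x hx, (hsub hx).2⟩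
    have hE1 : ∀ u ∈ E, u ∉ U₁ := by
      refine (hB.1 E hE).subset_of_closed (J := {u | u ∉ U₁}) hxE hxU ?_
      intro u _ hu w hw huw hw1
      exact hu (hc1 w hw1 (hsub hw).2 u huw.symm)
    obtain ⟨F, hF, hFR⟩ := exists_disjoint_of_not_covers (hcov R₂ (Or.inr h₂.root_mem))
    obtain ⟨f, hfE, hfF⟩ := hB.2 E hE F hF
    have hf2 : f ∈ U₂ := (hsub hfE).1.resolve_left (hE1 f hfE)
    refine IH₂ F hF fun z hz => ⟨?_, Set.disjoint_left.1 hFR hz⟩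
    exact (hB.1 F hF).subset_of_closed hfF hf2 (fun u hu hu2 w _ huw =>
      hc2 u hu2 (Set.disjoint_left.1 hFR hu) w huw) hz

omit [Finite V] in
/-- The duality theorem, easy direction. -/
theorem LTD.sbn_le (h : LTD G 𝓑 Set.univ R) (hk : ∀ Q ∈ 𝓑, Q.ncard ≤ k) : sbn G ≤ k := by
  rw [sbn_le_iff]
  intro B hB
  by_contra! hcon
  have hcov : ∀ Q ∈ 𝓑, ¬ Covers Q B := fun Q hQ hc => absurd (hk Q hQ) (not_le.2 (hcon Q hc))
  obtain ⟨E, hE, hER⟩ := exists_disjoint_of_not_covers (hcov R h.root_mem)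
  exact h.not_subset_diff hB hcov (fun _ _ _ _ _ => trivial) E hE
    fun x hx => ⟨trivial, Set.disjoint_left.1 hER hx⟩

end Duality

/-! ### Completed decompositions, chordality and connectivity -/

section Completion

variable {V : Type*} {G H : SimpleGraph V} {𝓑 : Set (Set V)} {U U' U₁ U₂ R R' R₁ R₂ Q X K S : Set V}
  {k : ℕ}

/-- A lenient tree-decomposition with all bags of size `k` in which the union of any two adjacent
bags is a clique. -/
inductive CDec (G : SimpleGraph V) (k : ℕ) : Set V → Set V → Prop
  | single (R : Set V) (hk : R.ncard = k) (hc : G.IsClique R) : CDec G k R R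
  | join {U U' R R' : Set V} (h : CDec G k U R) (h' : CDec G k U' R') (hi : U ∩ U' ⊆ R ∩ R')
      (ha : ∀ u ∈ U, u ∉ U' → ∀ v ∈ U', v ∉ U → G.Adj u v → u ∈ R ∧ v ∈ R')
      (hc : G.IsClique (R ∪ R')) : CDec G k (U ∪ U') R

theorem CDec.root_subset (h : CDec G k U R) : R ⊆ U := by
  induction h with
  | single => rfl
  | join _ _ _ _ _ ih _ => exact ih.trans Set.subset_union_left

theorem CDec.root_ncard (h : CDec G k U R) : R.ncard = k := by
  induction h with
  | single _ hk _ => exact hk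
  | join _ _ _ _ _ ih _ => exact ih

theorem CDec.root_isClique (h : CDec G k U R) : G.IsClique R := by
  induction h with
  | single _ _ hc => exact hc
  | join _ _ _ _ _ ih _ => exact ih

theorem CDec.congr (h : CDec G k U R) (hGH : ∀ u ∈ U, ∀ v ∈ U, G.Adj u v ↔ H.Adj u v) :
    CDec H k U R := by
  induction h with
  | single R hk hc =>
    exact CDec.single R hk fun u hu v hv huv => (hGH u hu v hv).1 (hc hu hv huv)
  | @join U U' R R' h h' hi ha hc ih ih' =>
    refine CDec.join (ih fun u hu v hv => hGH u (Or.inl hu) v (Or.inl hv))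
      (ih' fun u hu v hv => hGH u (Or.inr hu) v (Or.inr hv)) hi ?_ ?_
    · intro u hu hu' v hv hv' huv
      exact ha u hu hu' v hv hv' ((hGH u (Or.inl hu) v (Or.inr hv)).2 huv)
    · have hsub := Set.union_subset_union h.root_subset h'.root_subset
      intro u hu v hv huv
      exact (hGH u (hsub hu) v (hsub hv)).1 (hc hu hv huv)

theorem CDec.exists_LTD (h : CDec G k U R) : ∃ 𝓑, LTD G 𝓑 U R ∧ ∀ Q ∈ 𝓑, Q.ncard ≤ k := by
  induction h with
  | single R hk hc =>
    refine ⟨_, LTD.single R, ?_⟩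
    rintro Q rfl
    exact hk.le
  | join _ _ hi ha _ ih ih' =>
    obtain ⟨𝓑, h, h1⟩ := ih
    obtain ⟨𝓑', h', h1'⟩ := ih'
    exact ⟨_, LTD.join h h' hi ha, fun Q hQ => hQ.elim (h1 Q) (h1' Q)⟩

theorem CDec.sbn_le (h : CDec G k Set.univ R) : sbn G ≤ k := by
  obtain ⟨𝓑, h, h1⟩ := h.exists_LTD
  exact h.sbn_le h1

/-- Joining two completed decompositions. -/
theorem CDec.exists_join {E₁ E₂ : SimpleGraph V} (h₁ : CDec E₁ k U₁ R₁) (h₂ : CDec E₂ k U₂ R₂)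
    (hG₁ : ∀ u ∈ U₁, ∀ v ∈ U₁, G.Adj u v → E₁.Adj u v)
    (hG₂ : ∀ u ∈ U₂, ∀ v ∈ U₂, G.Adj u v → E₂.Adj u v) (hi : U₁ ∩ U₂ ⊆ R₁ ∩ R₂)
    (ha : ∀ u ∈ U₁, u ∉ U₂ → ∀ v ∈ U₂, v ∉ U₁ → G.Adj u v → u ∈ R₁ ∧ v ∈ R₂) :
    ∃ E, CDec E k (U₁ ∪ U₂) R₁ ∧ ∀ u ∈ U₁ ∪ U₂, ∀ v ∈ U₁ ∪ U₂, G.Adj u v → E.Adj u v := by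
  have hR₁ := h₁.root_subset
  have hR₂ := h₂.root_subset
  -- Each side keeps its completion and the union of the roots becomes a clique. The common vertices
  -- lie in both roots, which are cliques already, so neither side gains an edge.
  let E : SimpleGraph V :=
    { Adj := fun u v => (u ∈ U₁ ∧ v ∈ U₁ ∧ E₁.Adj u v) ∨ (u ∈ U₂ ∧ v ∈ U₂ ∧ E₂.Adj u v) ∨
        (u ≠ v ∧ u ∈ R₁ ∪ R₂ ∧ v ∈ R₁ ∪ R₂)
      symm := ⟨by
        rintro u v (⟨h1, h2, h3⟩ | ⟨h1, h2, h3⟩ | ⟨h1, h2, h3⟩)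
        · exact Or.inl ⟨h2, h1, h3.symm⟩
        · exact Or.inr (Or.inl ⟨h2, h1, h3.symm⟩)
        · exact Or.inr (Or.inr ⟨h1.symm, h3, h2⟩)⟩
      loopless := ⟨by
        rintro u (⟨_, _, h3⟩ | ⟨_, _, h3⟩ | ⟨h1, _, _⟩)
        · exact h3.ne rfl
        · exact h3.ne rfl
        · exact h1 rfl⟩ }
  have hE₁ : ∀ u ∈ U₁, ∀ v ∈ U₁, E₁.Adj u v ↔ E.Adj u v := by
    intro u hu v hv
    refine ⟨fun h => Or.inl ⟨hu, hv, h⟩, ?_⟩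
    rintro (h | ⟨hu', hv', h⟩ | ⟨h, hu', hv'⟩)
    · exact h.2.2
    · exact h₁.root_isClique (hi ⟨hu, hu'⟩).1 (hi ⟨hv, hv'⟩).1 h.ne
    · exact h₁.root_isClique (hu'.elim id fun h => (hi ⟨hu, hR₂ h⟩).1)
        (hv'.elim id fun h => (hi ⟨hv, hR₂ h⟩).1) h
  have hE₂ : ∀ u ∈ U₂, ∀ v ∈ U₂, E₂.Adj u v ↔ E.Adj u v := by
    intro u hu v hv
    refine ⟨fun h => Or.inr (Or.inl ⟨hu, hv, h⟩), ?_⟩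
    rintro (⟨hu', hv', h⟩ | h | ⟨h, hu', hv'⟩)
    · exact h₂.root_isClique (hi ⟨hu', hu⟩).2 (hi ⟨hv', hv⟩).2 h.ne
    · exact h.2.2
    · exact h₂.root_isClique (hu'.elim (fun h => (hi ⟨hR₁ h, hu⟩).2) id)
        (hv'.elim (fun h => (hi ⟨hR₁ h, hv⟩).2) id) h
  refine ⟨E, CDec.join (h₁.congr hE₁) (h₂.congr hE₂) hi ?_ ?_, ?_⟩
  · rintro u hu hu' v hv hv' (h | h | ⟨_, h1, h2⟩)
    · exact absurd h.2.1 hv'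
    · exact absurd h.1 hu'
    · exact ⟨h1.resolve_right fun h => hu' (hR₂ h), h2.resolve_left fun h => hv' (hR₁ h)⟩
  · exact fun u hu v hv huv => Or.inr (Or.inr ⟨huv, hu, hv⟩)
  · intro u hu v hv huv
    by_cases h1 : u ∈ U₁ ∧ v ∈ U₁
    · exact Or.inl ⟨h1.1, h1.2, hG₁ u h1.1 v h1.2 huv⟩
    by_cases h2 : u ∈ U₂ ∧ v ∈ U₂
    · exact Or.inr (Or.inl ⟨h2.1, h2.2, hG₂ u h2.1 v h2.2 huv⟩)
    refine Or.inr (Or.inr ⟨huv.ne, ?_⟩)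
    rcases hu with hu | hu
    · have hv1 : v ∉ U₁ := fun h => h1 ⟨hu, h⟩
      have hv2 : v ∈ U₂ := hv.resolve_left hv1
      have := ha u hu (fun h => h2 ⟨h, hv2⟩) v hv2 hv1 huv
      exact ⟨Or.inl this.1, Or.inr this.2⟩
    · have hv2 : v ∉ U₂ := fun h => h2 ⟨hu, h⟩
      have hv1 : v ∈ U₁ := hv.resolve_right hv2
      have := ha v hv1 hv2 u hu (fun h => h1 ⟨h, hv1⟩) huv.symm
      exact ⟨Or.inr this.2, Or.inl this.1⟩

theorem CDec.single_top (hQ : Q.ncard = k) : CDec (⊤ : SimpleGraph V) k Q Q :=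
  CDec.single Q hQ fun _ _ _ _ h => h

variable [Finite V]

/-- Bags can be enlarged to have exactly `k` vertices. -/
theorem LTD.exists_CDec (h : LTD G 𝓑 U R) (hk : ∀ Q ∈ 𝓑, Q.ncard ≤ k) (hU : k ≤ U.ncard) :
    ∃ E Rp, CDec E k U Rp ∧ R ⊆ Rp ∧ ∀ u ∈ U, ∀ v ∈ U, G.Adj u v → E.Adj u v := by
  have htop : ∀ Q : Set V, ∀ u ∈ Q, ∀ v ∈ Q, G.Adj u v → (⊤ : SimpleGraph V).Adj u v :=
    fun _ _ _ _ _ h => h.ne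
  induction h with
  | single R =>
    exact ⟨⊤, R, CDec.single_top (le_antisymm (hk R rfl) hU), subset_rfl, htop R⟩
  | @join 𝓑 𝓑' U U' R R' h h' hi ha ih ih' =>
    have IH := ih fun Q hQ => hk Q (Or.inl hQ)
    have IH' := ih' fun Q hQ => hk Q (Or.inr hQ)
    have hR : R ⊆ U := h.bag_subset _ h.root_mem
    have hR' : R' ⊆ U' := h'.bag_subset _ h'.root_mem
    rcases le_or_gt k U.ncard with hkU | hkU <;> rcases le_or_gt k U'.ncard with hkU' | hkU'
    · obtain ⟨E, Rp, hE, hRp, hG⟩ := IH hkU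
      obtain ⟨E', Rp', hE', hRp', hG'⟩ := IH' hkU'
      obtain ⟨F, hF, hFG⟩ := hE.exists_join hE' hG hG'
        (hi.trans (Set.inter_subset_inter hRp hRp')) (fun u hu hu' v hv hv' huv => by
          have := ha u hu hu' v hv hv' huv
          exact ⟨hRp this.1, hRp' this.2⟩)
      exact ⟨F, Rp, hF, hRp, hFG⟩
    -- A part with fewer than `k` vertices is filled up from the other root and becomes a single
    -- bag.
    · obtain ⟨E, Rp, hE, hRp, hG⟩ := IH hkU
      obtain ⟨Q, hQ1, hQ2, hQ3⟩ := Set.exists_subsuperset_card_eq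
        (Set.subset_union_left : U' ⊆ U' ∪ Rp) hkU'.le
        (by rw [← hE.root_ncard]; exact Set.ncard_le_ncard Set.subset_union_right)
      obtain ⟨F, hF, hFG⟩ := hE.exists_join (CDec.single_top hQ3) hG (htop Q) (by
          rintro x ⟨hx, hxQ⟩
          refine ⟨(hQ2 hxQ).elim (fun h => hRp (hi ⟨hx, h⟩).1) id, hxQ⟩)
        (fun u hu hu' v hv hv' huv => ⟨hRp (ha u hu (fun h => hu' (hQ1 h)) v
          ((hQ2 hv).resolve_right fun h => hv' (hE.root_subset h)) hv' huv).1, hv⟩)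
      have hUQ : U ∪ Q = U ∪ U' := by
        apply Set.Subset.antisymm
        · refine Set.union_subset Set.subset_union_left (hQ2.trans ?_)
          exact Set.union_subset Set.subset_union_right
            (hE.root_subset.trans Set.subset_union_left)
        · exact Set.union_subset_union_right _ hQ1
      rw [hUQ] at hF hFG
      exact ⟨F, Rp, hF, hRp, hFG⟩
    · obtain ⟨E', Rp', hE', hRp', hG'⟩ := IH' hkU'
      obtain ⟨Q, hQ1, hQ2, hQ3⟩ := Set.exists_subsuperset_card_eq
        (Set.subset_union_left : U ⊆ U ∪ Rp') hkU.le
        (by rw [← hE'.root_ncard]; exact Set.ncard_le_ncard Set.subset_union_right)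
      obtain ⟨F, hF, hFG⟩ := (CDec.single_top hQ3).exists_join hE' (htop Q) hG' (by
          rintro x ⟨hxQ, hx⟩
          refine ⟨hxQ, (hQ2 hxQ).elim (fun h => hRp' (hi ⟨h, hx⟩).2) id⟩)
        (fun u hu hu' v hv hv' huv => ⟨hu, hRp' (ha u
          ((hQ2 hu).resolve_right fun h => hu' (hE'.root_subset h)) hu' v hv
          (fun h => hv' (hQ1 h)) huv).2⟩)
      have hUQ : Q ∪ U' = U ∪ U' := by
        apply Set.Subset.antisymm
        · refine Set.union_subset (hQ2.trans ?_) Set.subset_union_right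
          exact Set.union_subset Set.subset_union_left
            (hE'.root_subset.trans Set.subset_union_right)
        · exact Set.union_subset_union_left _ hQ1
      rw [hUQ] at hF hFG
      exact ⟨F, Q, hF, hR.trans hQ1, hFG⟩
    -- Both parts are small: two bags of size `k` exhaust the union.
    · obtain ⟨Q, hQ1, hQ2, hQ3⟩ := Set.exists_subsuperset_card_eq
        (Set.subset_union_left : U ⊆ U ∪ U') hkU.le hU
      obtain ⟨Q', hQ1', hQ2', hQ3'⟩ := Set.exists_subsuperset_card_eq
        (Set.sdiff_subset : (U ∪ U') \ Q ⊆ U ∪ U') (n := k) (by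
          refine le_trans (Set.ncard_le_ncard ?_) hkU'.le
          rintro x ⟨hx | hx, hxQ⟩
          · exact absurd (hQ1 hx) hxQ
          · exact hx) hU
      obtain ⟨F, hF, hFG⟩ := (CDec.single_top hQ3).exists_join (CDec.single_top hQ3') (htop Q)
        (htop Q') subset_rfl (fun u hu _ v hv _ _ => ⟨hu, hv⟩)
      have hUQ : Q ∪ Q' = U ∪ U' := by
        apply Set.Subset.antisymm
        · exact Set.union_subset hQ2 hQ2'
        · intro x hx
          by_cases hxQ : x ∈ Q
          · exact Or.inl hxQ
          · exact Or.inr (hQ1' ⟨hx, hxQ⟩)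
      rw [hUQ] at hF hFG
      exact ⟨F, Q, hF, hR.trans hQ1, hFG⟩

theorem exists_CDec_of_sbn_le (hG : sbn G ≤ k) (hk : k ≤ Nat.card V) :
    ∃ E R, CDec E k Set.univ R ∧ G ≤ E := by
  obtain ⟨𝓑, R, h, hQ⟩ := exists_LTD_of_sbn_le hG
  obtain ⟨E, Rp, hE, _, hGE⟩ := h.exists_CDec hQ (by rwa [Set.ncard_univ])
  exact ⟨E, Rp, hE, fun u v huv => hGE u trivial v trivial huv⟩

omit [Finite V] in
theorem IsEdgeMaximal.eq_of_le (hG : IsEdgeMaximal G k) (h : G ≤ H) (hH : sbn H ≤ k) : G = H := by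
  refine le_antisymm h fun x y hxy => ?_
  by_contra hn
  refine absurd (hG.2 x y hxy.ne hn) (not_lt.2 (le_trans (sbn_mono ?_) hH))
  exact sup_le h ((SimpleGraph.edge_le_iff H).2 (Or.inr hxy))

/-- The completion is a supergraph in the same class, so by maximality it is the graph itself. -/
theorem IsEdgeMaximal.exists_CDec (hG : IsEdgeMaximal G k) (hk : k ≤ Nat.card V) :
    ∃ R, CDec G k Set.univ R := by
  obtain ⟨E, R, hE, hGE⟩ := exists_CDec_of_sbn_le hG.1 hk
  rw [hG.eq_of_le hGE hE.sbn_le]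
  exact ⟨R, hE⟩

omit [Finite V] in
-- Descend into a part as long as `W` leaves its root there: a vertex of the part outside the root
-- has no neighbours beyond the part. Once `W` is confined to two adjacent bags, it is a clique.
theorem CDec.exists_simplicial (h : CDec G k U R) : ∀ W ⊆ U, ¬ W ⊆ R → ∃ v ∈ W, v ∉ R ∧
    ∀ a ∈ W, ∀ b ∈ W, a ≠ b → G.Adj v a → G.Adj v b → G.Adj a b := by
  induction h with
  | single R _ _ => exact fun W h h' => absurd h h'
  | @join U U' R R' h h' hi ha hc ih ih' =>
    have hR := h.root_subset
    have hR' := h'.root_subset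
    intro W hW hWR
    by_cases h1 : W ∩ U' ⊆ R'
    · by_cases h2 : W ∩ U ⊆ R
      · obtain ⟨v, hv, hvR⟩ := Set.not_subset.1 hWR
        have hcl : W ⊆ R ∪ R' := fun x hx => (hW hx).imp (fun h => h2 ⟨hx, h⟩) fun h => h1 ⟨hx, h⟩
        exact ⟨v, hv, hvR, fun a ha b hb hab _ _ => hc (hcl ha) (hcl hb) hab⟩
      · obtain ⟨v, hv, hvR, hs⟩ := ih _ Set.inter_subset_right h2
        have hn : ∀ a ∈ W, G.Adj v a → a ∈ W ∩ U := by
          intro a haW hva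
          refine ⟨haW, ?_⟩
          by_contra haU
          have haU' : a ∈ U' := (hW haW).resolve_left haU
          exact hvR (ha v hv.2 (fun h => hvR (hi ⟨hv.2, h⟩).1) a haU' haU hva).1
        exact ⟨v, hv.1, hvR, fun a ha b hb hab hva hvb =>
          hs a (hn a ha hva) b (hn b hb hvb) hab hva hvb⟩
    · obtain ⟨v, hv, hvR, hs⟩ := ih' _ Set.inter_subset_right h1
      have hvU : v ∉ U := fun h => hvR (hi ⟨h, hv.2⟩).2
      have hn : ∀ a ∈ W, G.Adj v a → a ∈ W ∩ U' := by
        intro a haW hva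
        refine ⟨haW, ?_⟩
        by_contra haU'
        have haU : a ∈ U := (hW haW).resolve_right haU'
        exact hvR (ha a haU haU' v hv.2 hvU hva.symm).2
      exact ⟨v, hv.1, fun h => hvU (hR h), fun a ha b hb hab hva hvb =>
        hs a (hn a ha hva) b (hn b hb hvb) hab hva hvb⟩

open scoped Fin.CommRing in
omit [Finite V] in
/-- Graphs all of whose non-empty induced subgraphs have a simplicial vertex are chordal. -/
theorem isChordal_of_exists_simplicial (h : ∀ W : Set V, W.Finite → W.Nonempty → ∃ v ∈ W,
    ∀ a ∈ W, ∀ b ∈ W, a ≠ b → G.Adj v a → G.Adj v b → G.Adj a b) : IsChordal G := by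
  intro n hn
  refine ⟨fun f => ?_⟩
  obtain ⟨m, rfl⟩ := Nat.exists_eq_add_of_le' (show 2 ≤ n by omega)
  obtain ⟨_, ⟨i, rfl⟩, hs⟩ := h (Set.range f) (Set.finite_range f) ⟨f 0, 0, rfl⟩
  have h1 : (SimpleGraph.cycleGraph (m + 2)).Adj i (i + 1) := by
    rw [SimpleGraph.cycleGraph_adj]; right; simp
  have h2 : (SimpleGraph.cycleGraph (m + 2)).Adj i (i - 1) := by
    rw [SimpleGraph.cycleGraph_adj]; left; simp
  -- As the length is at least 4, the neighbours `i + 1` and `i - 1` differ because `2 ≠ 0`, and are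
  -- non-adjacent because `1 ≠ 0` and `3 ≠ 0`.
  have hne1 : (1 : Fin (m + 2)) ≠ 0 := by simp
  have hne2 : (2 : Fin (m + 2)) ≠ 0 := by
    have : (2 : Fin (m + 2)) = Fin.ofNat (m + 2) 2 := rfl
    rw [Ne, Fin.ext_iff, this, Fin.val_ofNat, Fin.val_zero, Nat.mod_eq_of_lt (by omega)]; norm_num
  have hne3 : (3 : Fin (m + 2)) ≠ 0 := by
    have : (3 : Fin (m + 2)) = Fin.ofNat (m + 2) 3 := rfl
    rw [Ne, Fin.ext_iff, this, Fin.val_ofNat, Fin.val_zero, Nat.mod_eq_of_lt (by omega)]; norm_num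
  have hd : i + 1 ≠ i - 1 := by
    intro hc
    apply hne2
    have : (i + 1) - (i - 1) = 0 := sub_eq_zero.2 hc
    rw [← this]; ring
  have h3 := hs _ ⟨i + 1, rfl⟩ _ ⟨i - 1, rfl⟩ (fun hc => hd (f.injective hc))
    (f.map_rel_iff.2 h1) (f.map_rel_iff.2 h2)
  have h4 := f.map_rel_iff.1 h3
  rw [SimpleGraph.cycleGraph_adj] at h4
  rcases h4 with h4 | h4
  · apply hne1
    have : (i + 1) - (i - 1) - 1 = 0 := sub_eq_zero.2 h4
    rw [← this]; ring
  · apply hne3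
    have : (i - 1) - (i + 1) - 1 = 0 := sub_eq_zero.2 h4
    rw [← neg_eq_zero, ← this]; ring

omit [Finite V] in
theorem CDec.isChordal (h : CDec G k Set.univ R) : IsChordal G := by
  refine isChordal_of_exists_simplicial fun W _ hne => ?_
  by_cases hWR : W ⊆ R
  · obtain ⟨v, hv⟩ := hne
    exact ⟨v, hv, fun a ha b hb hab _ _ => h.root_isClique (hWR ha) (hWR hb) hab⟩
  · obtain ⟨v, hv, _, hs⟩ := h.exists_simplicial W (Set.subset_univ W) hWR
    exact ⟨v, hv, hs⟩

/-- The subgraph induced by `U` stays connected when fewer than `k` vertices are removed. -/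
def IsKConnectedOn (G : SimpleGraph V) (k : ℕ) (U : Set V) : Prop :=
  ∀ X : Set V, X.ncard < k → IsConnectedSet G (U \ X)

theorem exists_mem_notMem_of_ncard_lt (h : X.ncard < R.ncard) : ∃ x ∈ R, x ∉ X := by
  by_contra! hcon
  exact absurd (Set.ncard_le_ncard (show R ⊆ X from hcon)) (not_le.2 h)

/-- Fewer than `k` deletions leave a survivor in each root, and the two survivors are equal or
adjacent. -/
theorem IsKConnectedOn.union (h₁ : IsKConnectedOn G k U₁) (h₂ : IsKConnectedOn G k U₂)
    (hR₁ : R₁ ⊆ U₁) (hR₂ : R₂ ⊆ U₂) (hk₁ : R₁.ncard = k) (hk₂ : R₂.ncard = k)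
    (hc : G.IsClique (R₁ ∪ R₂)) : IsKConnectedOn G k (U₁ ∪ U₂) := by
  intro X hX
  obtain ⟨x, hx, hxX⟩ := exists_mem_notMem_of_ncard_lt (hX.trans_eq hk₁.symm)
  obtain ⟨y, hy, hyX⟩ := exists_mem_notMem_of_ncard_lt (hX.trans_eq hk₂.symm)
  rw [Set.union_sdiff_distrib]
  by_cases hxy : x = y
  · exact (h₁ X hX).union (h₂ X hX) ⟨x, ⟨hR₁ hx, hxX⟩, ⟨hxy ▸ hR₂ hy, hxX⟩⟩
  · exact (h₁ X hX).union_of_adj (h₂ X hX) ⟨hR₁ hx, hxX⟩ ⟨hR₂ hy, hyX⟩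
      (hc (Or.inl hx) (Or.inr hy) hxy)

theorem CDec.isKConnectedOn (h : CDec G k U R) : IsKConnectedOn G k U := by
  induction h with
  | single R hk hc =>
    intro X hX
    obtain ⟨x, hx, hxX⟩ := exists_mem_notMem_of_ncard_lt (hX.trans_eq hk.symm)
    exact isConnectedSet_of_isClique (hc.subset Set.sdiff_subset) ⟨x, hx, hxX⟩
  | join h h' hi ha hc ih ih' =>
    exact ih.union ih' h.root_subset h'.root_subset h.root_ncard h'.root_ncard hc

/-- Two `k`-connected parts of `U` that are joined along the clique `R₁ ∪ R₂`. -/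
structure IsSplit (G : SimpleGraph V) (k : ℕ) (U U₁ R₁ U₂ R₂ : Set V) : Prop where
  eq : U = U₁ ∪ U₂
  sub₁ : R₁ ⊆ U₁
  sub₂ : R₂ ⊆ U₂
  card₁ : R₁.ncard = k
  card₂ : R₂.ncard = k
  conn₁ : IsKConnectedOn G k U₁
  conn₂ : IsKConnectedOn G k U₂
  inter : U₁ ∩ U₂ ⊆ R₁ ∩ R₂
  clique : G.IsClique (R₁ ∪ R₂)
  adj : ∀ u ∈ U₁, u ∉ U₂ → ∀ v ∈ U₂, v ∉ U₁ → G.Adj u v → u ∈ R₁ ∧ v ∈ R₂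

omit [Finite V] in
theorem IsSplit.symm (h : IsSplit G k U U₁ R₁ U₂ R₂) : IsSplit G k U U₂ R₂ U₁ R₁ where
  eq := h.eq.trans (Set.union_comm _ _)
  sub₁ := h.sub₂
  sub₂ := h.sub₁
  card₁ := h.card₂
  card₂ := h.card₁
  conn₁ := h.conn₂
  conn₂ := h.conn₁
  inter := fun _ hx => (h.inter hx.symm).symm
  clique := by rw [Set.union_comm]; exact h.clique
  adj := fun u hu hu' v hv hv' huv => (h.adj v hv hv' u hu hu' huv.symm).symm

/-- A side can absorb whatever is attached to one of its `k`-sets, so a split found deep in the tree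
becomes a split of the whole graph. -/
theorem IsSplit.extend (h : IsSplit G k U U₁ R₁ U₂ R₂) (hQ : Q ⊆ U₁) (hQk : Q.ncard = k)
    (hR' : R' ⊆ U') (hRk' : R'.ncard = k) (hc' : IsKConnectedOn G k U') (hi : U ∩ U' ⊆ Q ∩ R')
    (hc : G.IsClique (Q ∪ R'))
    (ha : ∀ u ∈ U, u ∉ U' → ∀ v ∈ U', v ∉ U → G.Adj u v → u ∈ Q ∧ v ∈ R') :
    IsSplit G k (U ∪ U') (U₁ ∪ U') R₁ U₂ R₂ where
  eq := by rw [h.eq, Set.union_right_comm]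
  sub₁ := h.sub₁.trans Set.subset_union_left
  sub₂ := h.sub₂
  card₁ := h.card₁
  card₂ := h.card₂
  conn₁ := h.conn₁.union hc' hQ hR' hQk hRk' hc
  conn₂ := h.conn₂
  inter := by
    rintro x ⟨hx | hx, hx2⟩
    · exact h.inter ⟨hx, hx2⟩
    · exact h.inter ⟨hQ (hi ⟨by rw [h.eq]; exact Or.inr hx2, hx⟩).1, hx2⟩
  clique := h.clique
  adj := by
    intro u hu hu2 v hv hv1 huv
    by_cases hu1 : u ∈ U₁
    · exact h.adj u hu1 hu2 v hv (fun h => hv1 (Or.inl h)) huv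
    · have hu' : u ∈ U' := hu.resolve_left hu1
      have := ha v (by rw [h.eq]; exact Or.inr hv) (fun h => hv1 (Or.inr h)) u hu'
        (by rw [h.eq]; exact fun h => h.elim hu1 hu2) huv.symm
      exact absurd (Or.inl (hQ this.1)) hv1

/-- A clique contained in neither part of a join lies in the two joined bags. Otherwise recurse into
the part that contains it and let one side of the split found there absorb the other part. -/
theorem CDec.exists_split (h : CDec G k U R) (hK : G.IsClique K) (hKU : K ⊆ U) :
    U = R ∨ ∃ U₁ R₁ U₂ R₂, IsSplit G k U U₁ R₁ U₂ R₂ ∧ K ⊆ R₁ ∪ R₂ ∧ R ⊆ U₁ := by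
  induction h with
  | single R _ _ => exact Or.inl rfl
  | @join U U' R R' h h' hi ha hc ih ih' =>
    right
    have hR := h.root_subset
    have hR' := h'.root_subset
    have htop : IsSplit G k (U ∪ U') U R U' R' :=
      ⟨rfl, hR, hR', h.root_ncard, h'.root_ncard, h.isKConnectedOn, h'.isKConnectedOn, hi, hc, ha⟩
    by_cases hKR : K ⊆ R ∪ R'
    · exact ⟨U, R, U', R', htop, hKR, hR⟩
    by_cases hK1 : K ⊆ U
    · rcases ih hK1 with rfl | ⟨U₁, R₁, U₂, R₂, hs, hKs, hRs⟩
      · exact absurd (hK1.trans Set.subset_union_left) hKR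
      · exact ⟨_, _, _, _, hs.extend hRs h.root_ncard hR' h'.root_ncard h'.isKConnectedOn hi hc ha,
          hKs, hRs.trans Set.subset_union_left⟩
    by_cases hK2 : K ⊆ U'
    · rcases ih' hK2 with rfl | ⟨U₁, R₁, U₂, R₂, hs, hKs, hRs⟩
      · exact absurd (hK2.trans Set.subset_union_right) hKR
      · refine ⟨U₁ ∪ U, R₁, U₂, R₂, ?_, hKs, hR.trans Set.subset_union_right⟩
        rw [Set.union_comm U]
        exact hs.extend hRs h'.root_ncard hR h.root_ncard h.isKConnectedOn
          (fun x hx => (hi hx.symm).symm) (by rw [Set.union_comm]; exact hc)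
          (fun u hu hu' v hv hv' huv => (ha v hv hv' u hu hu' huv.symm).symm)
    · exfalso
      obtain ⟨x, hx, hxU⟩ := Set.not_subset.1 hK1
      obtain ⟨y, hy, hyU⟩ := Set.not_subset.1 hK2
      have hx' : x ∈ U' := (hKU hx).resolve_left hxU
      have hy' : y ∈ U := (hKU hy).resolve_right hyU
      refine hKR fun z hz => ?_
      by_cases hzU : z ∈ U
      · by_cases hzU' : z ∈ U'
        · exact Or.inl (hi ⟨hzU, hzU'⟩).1
        · exact Or.inl (ha z hzU hzU' x hx' hxU (hK hz hx fun h => hxU (h ▸ hzU))).1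
      · exact Or.inr (ha y hy' hyU z ((hKU hz).resolve_left hzU) hzU
          (hK hy hz fun h => hzU (h ▸ hy'))).2

/-- A separating `k`-set inside the joining clique is one of the two joined bags. -/
theorem IsSplit.eq_or_eq (h : IsSplit G k Set.univ U₁ R₁ U₂ R₂) (hS : S.ncard = k)
    (hSK : S ⊆ R₁ ∪ R₂) (hsep : ¬ IsConnectedSet G (Set.univ \ S)) : S = R₁ ∨ S = R₂ := by
  have key : ∀ {U₁ R₁ U₂ R₂ : Set V}, IsSplit G k Set.univ U₁ R₁ U₂ R₂ → S ⊆ R₁ ∪ R₂ → S ⊆ U₁ →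
      S = R₁ := by
    intro U₁ R₁ U₂ R₂ h hSK hSU
    refine Set.eq_of_subset_of_ncard_le (fun x hx => (hSK hx).elim id fun hx2 => ?_)
      (by rw [h.card₁, hS])
    exact (h.inter ⟨hSU hx, h.sub₂ hx2⟩).1
  by_cases h1 : S ⊆ U₁
  · exact Or.inl (key h hSK h1)
  by_cases h2 : S ⊆ U₂
  · exact Or.inr (key h.symm (by rwa [Set.union_comm]) h2)
  -- `S` meets each side in fewer than `k` vertices, so both sides stay connected, and surviving
  -- vertices of the two bags keep them joined.
  exfalso
  apply hsep
  have hlt : ∀ {U : Set V}, ¬ S ⊆ U → (S ∩ U).ncard < k := by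
    intro U hSU
    rw [← hS]
    refine Set.ncard_lt_ncard ⟨Set.inter_subset_left, fun hc => hSU fun x hx => (hc hx).2⟩
  have c1 := h.conn₁ _ (hlt h1)
  have c2 := h.conn₂ _ (hlt h2)
  rw [Set.sdiff_inter_self_eq_sdiff] at c1 c2
  have hne : ∀ {U R : Set V}, R ⊆ U → R.ncard = k → ¬ S ⊆ U → ∃ x ∈ R, x ∉ S := by
    intro U R hRU hRk hSU
    by_contra! hcon
    have := Set.eq_of_subset_of_ncard_le (show R ⊆ S from hcon) (by rw [hRk, hS])
    exact hSU (this ▸ hRU)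
  obtain ⟨x, hx, hxS⟩ := hne h.sub₁ h.card₁ h1
  obtain ⟨y, hy, hyS⟩ := hne h.sub₂ h.card₂ h2
  rw [h.eq, Set.union_sdiff_distrib]
  by_cases hxy : x = y
  · exact c1.union c2 ⟨x, ⟨h.sub₁ hx, hxS⟩, ⟨hxy ▸ h.sub₂ hy, hxS⟩⟩
  · exact c1.union_of_adj c2 ⟨h.sub₁ hx, hxS⟩ ⟨h.sub₂ hy, hyS⟩
      (h.clique (Or.inl hx) (Or.inr hy) hxy)

end Completion

/-! ### The upper bound on the number of edges -/

section EdgeBound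

variable {V : Type*} {G : SimpleGraph V} {U R Q : Set V} {k : ℕ}

/-- The maximum number of pairs covered by disjoint blocks of at most `k` of `m` points. -/
def blockPairs (k m : ℕ) : ℕ := m / k * k.choose 2 + (m % k).choose 2

theorem choose_two_add (a b : ℕ) : (a + b).choose 2 = a.choose 2 + b.choose 2 + a * b := by
  induction b with
  | zero => simp
  | succ b ih =>
    rw [← add_assoc, Nat.choose_succ_succ' _ 1, ih, Nat.choose_succ_succ' b 1]
    simp only [Nat.choose_one_right]
    ring

theorem blockPairs_of_le {r : ℕ} (hk : 1 ≤ k) (hr : r ≤ k) : blockPairs k r = r.choose 2 := by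
  rcases hr.lt_or_eq with h | rfl
  · simp [blockPairs, Nat.div_eq_of_lt h, Nat.mod_eq_of_lt h]
  · simp [blockPairs, Nat.div_self hk]

/-- Only the two incomplete blocks, of sizes `s` and `t`, matter. If `s + t ≥ k`, regrouping them
into a full block and one of size `s + t - k` loses no pairs, by convexity of `choose 2`. -/
theorem blockPairs_add_le (hk : 1 ≤ k) (a b : ℕ) :
    blockPairs k a + blockPairs k b ≤ blockPairs k (a + b) := by
  have ha := Nat.mod_lt a hk
  have hb := Nat.mod_lt b hk
  unfold blockPairs
  rw [Nat.add_div hk, Nat.add_mod]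
  set s := a % k
  set t := b % k
  split_ifs with h
  · have h1 : (s + t) % k = s + t - k := by
      rw [Nat.mod_eq_sub_mod h, Nat.mod_eq_of_lt (by omega)]
    obtain ⟨c, hc⟩ := Nat.exists_eq_add_of_le h
    obtain ⟨i, hi⟩ := Nat.exists_eq_add_of_lt ha
    obtain ⟨j, hj⟩ := Nat.exists_eq_add_of_lt hb
    have hs : s = c + (j + 1) := by omega
    have ht : t = c + (i + 1) := by omega
    have hkk : k = c + (j + 1) + (i + 1) := by omega
    have h2 : s + t - k = c := by omega
    rw [h1, h2, hs, ht]
    have e1 := choose_two_add (c + (j + 1)) (i + 1)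
    have e2 := choose_two_add c (i + 1)
    rw [← hkk] at e1
    have e3 : c * (i + 1) ≤ (c + (j + 1)) * (i + 1) := Nat.mul_le_mul_right _ (by omega)
    have e4 : (a / k + b / k + 1) * k.choose 2
      = a / k * k.choose 2 + b / k * k.choose 2 + k.choose 2 := by ring
    rw [e4]
    omega
  · rw [Nat.mod_eq_of_lt (by omega : s + t < k), choose_two_add, add_zero, add_mul]
    omega

/-- The edges of `G` inside `U`. -/
def edgesIn (G : SimpleGraph V) (U : Set V) : Set (Sym2 V) := {e ∈ G.edgeSet | ∀ x ∈ e, x ∈ U}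

theorem mk_mem_edgesIn {u v : V} : s(u, v) ∈ edgesIn G U ↔ G.Adj u v ∧ u ∈ U ∧ v ∈ U := by
  simp [edgesIn, Sym2.mem_iff]

variable [Finite V]

theorem ncard_edgesIn_of_isClique (hQ : G.IsClique Q) :
    (edgesIn G Q).ncard = Q.ncard.choose 2 := by
  classical
  have hfin := Q.toFinite
  rw [Set.ncard_eq_toFinset_card Q, ← Sym2.card_image_offDiag, ← Set.ncard_coe_finset]
  congr 1
  ext e
  induction e using Sym2.ind with
  | _ u v =>
  rw [mk_mem_edgesIn]
  simp only [Finset.coe_image, Set.mem_image, Finset.mem_coe, Finset.mem_offDiag,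
    Set.Finite.mem_toFinset, Prod.exists]
  constructor
  · rintro ⟨h, hu, hv⟩
    exact ⟨u, v, ⟨hu, hv, h.ne⟩, rfl⟩
  · rintro ⟨a, b, ⟨ha, hb, hab⟩, h⟩
    have := hQ ha hb hab
    rcases Sym2.eq_iff.1 h with ⟨rfl, rfl⟩ | ⟨rfl, rfl⟩
    · exact ⟨this, ha, hb⟩
    · exact ⟨this.symm, hb, ha⟩

/-- Let `i` be the size of `R ∩ R'` and `r = k - i`. A join adds at most `r * r` edges and
identifies `i.choose 2`, while the vertex count beyond `k` grows by `r`. The balance to be paid is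
exactly `r.choose 2`, which superadditivity of `blockPairs` provides. -/
theorem CDec.ncard_edgesIn_le (hk : 1 ≤ k) (h : CDec G k U R) :
    (edgesIn G U).ncard ≤ k.choose 2 + k * (U.ncard - k) + blockPairs k (U.ncard - k) := by
  induction h with
  | single R hRk hc =>
    rw [ncard_edgesIn_of_isClique hc, hRk]
    omega
  | @join U U' R R' h h' hi ha hc ih ih' =>
    have hR := h.root_subset
    have hR' := h'.root_subset
    have hII : U ∩ U' = R ∩ R' := hi.antisymm (Set.inter_subset_inter hR hR')
    have hsub : edgesIn G (U ∪ U') ⊆ (edgesIn G U ∪ edgesIn G U') ∪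
        (fun p : V × V => s(p.1, p.2)) '' ((R \ R') ×ˢ (R' \ R)) := by
      intro e he
      induction e using Sym2.ind with
      | _ u v =>
      rw [mk_mem_edgesIn] at he
      obtain ⟨huv, hu, hv⟩ := he
      by_cases h1 : u ∈ U ∧ v ∈ U
      · exact Or.inl (Or.inl (mk_mem_edgesIn.2 ⟨huv, h1⟩))
      by_cases h2 : u ∈ U' ∧ v ∈ U'
      · exact Or.inl (Or.inr (mk_mem_edgesIn.2 ⟨huv, h2⟩))
      right
      rcases hu with hu | hu
      · have hv1 : v ∉ U := fun h => h1 ⟨hu, h⟩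
        have hv2 := hv.resolve_left hv1
        have hu2 : u ∉ U' := fun h => h2 ⟨h, hv2⟩
        have := ha u hu hu2 v hv2 hv1 huv
        exact ⟨(u, v), ⟨⟨this.1, fun h => hu2 (hR' h)⟩, ⟨this.2, fun h => hv1 (hR h)⟩⟩, rfl⟩
      · have hv2 : v ∉ U' := fun h => h2 ⟨hu, h⟩
        have hv1 := hv.resolve_right hv2
        have hu1 : u ∉ U := fun h => h1 ⟨h, hv1⟩
        have := ha v hv1 hv2 u hu hu1 huv.symm
        exact ⟨(v, u), ⟨⟨this.1, fun h => hv2 (hR' h)⟩, ⟨this.2, fun h => hu1 (hR h)⟩⟩,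
          Sym2.eq_swap⟩
    have hinter : edgesIn G U ∩ edgesIn G U' = edgesIn G (R ∩ R') := by
      rw [← hII]
      ext e
      simp only [edgesIn, Set.mem_inter_iff, Set.mem_ofPred_eq]
      constructor
      · rintro ⟨⟨h1, h2⟩, _, h3⟩
        exact ⟨h1, fun x hx => ⟨h2 x hx, h3 x hx⟩⟩
      · rintro ⟨h1, h2⟩
        exact ⟨⟨h1, fun x hx => (h2 x hx).1⟩, h1, fun x hx => (h2 x hx).2⟩
    have hQ : G.IsClique (R ∩ R') := h.root_isClique.subset Set.inter_subset_left
    have c1 := Set.ncard_union_add_ncard_inter (edgesIn G U) (edgesIn G U')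
    rw [hinter, ncard_edgesIn_of_isClique hQ] at c1
    have c2 := (Set.ncard_le_ncard hsub).trans (Set.ncard_union_le _ _)
    have c3 : ((fun p : V × V => s(p.1, p.2)) '' ((R \ R') ×ˢ (R' \ R))).ncard ≤
        (R \ R').ncard * (R' \ R).ncard := by
      rw [← Set.ncard_prod]
      exact Set.ncard_image_le
    have d1 := Set.ncard_inter_add_ncard_sdiff_eq_ncard R R'
    have d2 := Set.ncard_inter_add_ncard_sdiff_eq_ncard R' R
    have d3 := Set.ncard_union_add_ncard_inter U U'
    rw [hII] at d3
    rw [Set.inter_comm R' R, h'.root_ncard] at d2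
    rw [h.root_ncard] at d1
    have d4 := Set.ncard_le_ncard hR
    have d5 := Set.ncard_le_ncard hR'
    rw [h.root_ncard] at d4
    rw [h'.root_ncard] at d5
    obtain ⟨a, ha⟩ := Nat.exists_eq_add_of_le d4
    obtain ⟨b, hb⟩ := Nat.exists_eq_add_of_le d5
    set r := (R \ R').ncard with hr
    have hr' : (R' \ R).ncard = r := by omega
    set i := (R ∩ R').ncard with hi'
    have hkir : k = i + r := d1.symm
    have e1 : U.ncard - k = a := by omega
    have e2 : U'.ncard - k = b := by omega
    have e3 : (U ∪ U').ncard - k = a + b + r := by omega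
    rw [e1] at ih
    rw [e2] at ih'
    rw [e3]
    rw [hr'] at c3
    have f1 := blockPairs_add_le hk (a + b) r
    have f2 := blockPairs_add_le hk a b
    rw [blockPairs_of_le hk (by omega : r ≤ k)] at f1
    have f3 := choose_two_add i r
    rw [← hkir] at f3
    have f4 : r * r = 2 * r.choose 2 + r := by
      have := Nat.triangle_succ r
      rw [Nat.choose_two_right]
      have h2 : 2 ∣ r * (r - 1) := (Nat.even_mul_pred_self r).two_dvd
      rw [Nat.mul_div_cancel' h2]
      cases r with
      | zero => rfl
      | succ r => simp; ring
    have f5 : k * (a + b + r) = k * a + k * b + (i * r + r * r) := by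
      rw [mul_add, mul_add, ← add_mul, ← hkir]
    omega

/-- The closed form of the bound. -/
theorem edgeBound_eq {n : ℕ} (hn : k ≤ n) :
    edgeBound n k = ((k.choose 2 + k * (n - k) + blockPairs k (n - k) : ℕ) : ℚ) := by
  obtain ⟨m, rfl⟩ := Nat.exists_eq_add_of_le hn
  have h1 : k + m - k = m := by omega
  have h2 : (k + m) % k = m % k := by simp
  have h3 := Nat.div_add_mod m k
  rw [h1, edgeBound, h2, blockPairs]
  push_cast
  rw [Nat.cast_choose_two, Nat.cast_choose_two]
  set q := m / k
  set s := m % k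
  have h4 : (m : ℚ) = k * q + s := by exact_mod_cast h3.symm
  rw [h4]
  ring

theorem numEdges_le_edgeBound (hG : sbn G ≤ k) (hk : 1 ≤ k) (hn : k ≤ Nat.card V) :
    (numEdges G : ℚ) ≤ edgeBound (Nat.card V) k := by
  obtain ⟨E, R, hE, hGE⟩ := exists_CDec_of_sbn_le hG hn
  rw [edgeBound_eq hn]
  norm_cast
  have h1 := hE.ncard_edgesIn_le hk
  rw [Set.ncard_univ] at h1
  refine le_trans (Set.ncard_le_ncard ?_) h1
  intro e he
  exact ⟨SimpleGraph.edgeSet_mono hGE he, fun _ _ => trivial⟩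

/-- Graphs of strict bramble number at most `k` that attain the bound are edge-maximal. -/
theorem isEdgeMaximal_of_edgeBound_le (hG : sbn G ≤ k) (hk : 1 ≤ k) (hn : k ≤ Nat.card V)
    (h : edgeBound (Nat.card V) k ≤ numEdges G) : IsEdgeMaximal G k := by
  refine ⟨hG, fun x y hxy hadj => ?_⟩
  by_contra hcon
  have h1 := (numEdges_le_edgeBound (not_lt.1 hcon) hk hn).trans h
  norm_cast at h1
  refine absurd (Set.ncard_lt_ncard ⟨?_, ?_⟩) (not_lt.2 h1)
  · exact SimpleGraph.edgeSet_mono le_sup_left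
  · intro hsub
    refine hadj (hsub (show s(x, y) ∈ _ from ?_))
    rw [SimpleGraph.mem_edgeSet, SimpleGraph.sup_adj, SimpleGraph.edge_adj]
    exact Or.inr ⟨Or.inl ⟨rfl, rfl⟩, hxy⟩

end EdgeBound

/-! ### Minimal separators of chordal graphs -/

section Chordal

variable {V : Type*} {G : SimpleGraph V} {S X Q D A : Set V} {x y a b s : V}

/-- If `s` had no neighbour in the component of `x`, putting it back would not enlarge this
component, and `S \ {s}` would still separate. -/
theorem exists_adj_of_minimal (h : Minimal (IsSeparator G x y) S) (hs : s ∈ S) :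
    ∃ u ∈ comp G S x, G.Adj u s := by
  have h1 := isSeparator_iff.1 h.1
  by_contra! hcon
  have hx : x ∉ S \ {s} := fun hx => h1.1 hx.1
  have h2 : y ∈ comp G (S \ {s}) x := by
    by_contra hy
    have := h.2 (isSeparator_iff.2 ⟨hx, fun hy => h1.2.1 hy.1, hy⟩) Set.sdiff_subset hs
    exact this.2 rfl
  refine h1.2.2 ((isConnectedSet_comp hx).subset_of_closed (mem_comp_self hx)
    (mem_comp_self h1.1) ?_ h2)
  intro u _ hu' w hw huw
  refine mem_comp_of_adj hu' (fun hwS => notMem_of_mem_comp hw ⟨hwS, ?_⟩) huw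
  rintro rfl
  exact hcon u hu' huw

theorem isSeparator_comm : IsSeparator G x y S ↔ IsSeparator G y x S := by
  rw [isSeparator_iff, isSeparator_iff]
  exact ⟨fun h => ⟨h.2.1, h.1, fun hc => h.2.2 (comp_symm hc)⟩,
    fun h => ⟨h.2.1, h.1, fun hc => h.2.2 (comp_symm hc)⟩⟩

theorem minimal_isSeparator_comm (h : Minimal (IsSeparator G x y) S) :
    Minimal (IsSeparator G y x) S :=
  ⟨isSeparator_comm.1 h.1, fun _ hS' hle => h.2 (isSeparator_comm.1 hS') hle⟩

/-- A separator all of whose vertices have neighbours in the components of both `x` and `y` is a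
minimal separator. -/
theorem minimal_isSeparator_of_full (h : IsSeparator G x y S)
    (hx : ∀ s ∈ S, ∃ u ∈ comp G S x, G.Adj u s) (hy : ∀ s ∈ S, ∃ u ∈ comp G S y, G.Adj u s) :
    Minimal (IsSeparator G x y) S := by
  have h1 := isSeparator_iff.1 h
  refine ⟨h, fun S' hS' hle s hs => ?_⟩
  by_contra hsS'
  obtain ⟨u, hu, hus⟩ := hx s hs
  obtain ⟨w, hw, hws⟩ := hy s hs
  have hc := ((isConnectedSet_comp h1.1).insert_of_adj hu hus).union_of_adj
    (isConnectedSet_comp h1.2.1) (Set.mem_insert s _) hw hws.symm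
  have hS'' := isSeparator_iff.1 hS'
  refine hS''.2.2 (hc.subset_comp ?_ (Or.inl (Or.inr (mem_comp_self h1.1)))
    (Or.inr (mem_comp_self h1.2.1)))
  rw [Set.disjoint_union_left, Set.disjoint_insert_left]
  exact ⟨⟨hsS', (disjoint_comp G S x).mono_right hle⟩, (disjoint_comp G S y).mono_right hle⟩

theorem exists_minimal_isSeparator [Finite V] (h : IsSeparator G x y X) :
    ∃ S ⊆ X, Minimal (IsSeparator G x y) S :=
  exists_minimal_le_of_wellFoundedLT _ X h

/-- Two vertices of a connected set are joined by an induced path inside it. -/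
theorem IsConnectedSet.exists_induced_path (hA : IsConnectedSet G A) (ha : a ∈ A) (hb : b ∈ A) :
    ∃ (m : ℕ) (p : ℕ → V), p 0 = a ∧ p m = b ∧ (∀ i, p i ∈ A) ∧
      ∀ i j, i < j → j ≤ m → p i ≠ p j ∧ (G.Adj (p i) (p j) ↔ j = i + 1) := by
  have hA' : (G.induce A).Connected := hA
  -- On a shortest walk the distance from `a` equals the position, which rules out repetitions and
  -- chords.
  obtain ⟨w, hw⟩ := hA'.exists_walk_length_eq_dist ⟨a, ha⟩ ⟨b, hb⟩
  have hd : ∀ i ≤ w.length, (G.induce A).dist ⟨a, ha⟩ (w.getVert i) = i := by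
    intro i hi
    have h1 := (G.induce A).dist_le (w.take i)
    have h2 := (G.induce A).dist_le (w.drop i)
    have h3 := hA'.dist_triangle (u := ⟨a, ha⟩) (v := w.getVert i) (w := ⟨b, hb⟩)
    rw [SimpleGraph.Walk.take_length] at h1
    rw [SimpleGraph.Walk.drop_length] at h2
    omega
  refine ⟨w.length, fun i => w.getVert i, ?_, ?_, fun i => Subtype.prop _, ?_⟩
  · simp
  · simp
  · intro i j hij hj
    have h1 := hd i (by omega)
    have h2 := hd j hj
    refine ⟨fun hc => ?_, fun hadj => ?_, ?_⟩
    · rw [Subtype.ext hc] at h1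
      omega
    · have hadj' : (G.induce A).Adj (w.getVert i) (w.getVert j) := hadj
      have h3 := hA'.dist_triangle (u := ⟨a, ha⟩) (v := w.getVert i) (w := w.getVert j)
      rw [SimpleGraph.dist_eq_one_iff_adj.2 hadj'] at h3
      omega
    · rintro rfl
      exact w.adj_getVert_succ (by omega)

theorem IsChordal.false_of_cycle (hc : IsChordal G) {n : ℕ} (hn : 4 ≤ n) (f : ℕ → V)
    (hf : ∀ i j, i < j → j < n →
      f i ≠ f j ∧ (G.Adj (f i) (f j) ↔ j = i + 1 ∨ (i = 0 ∧ j + 1 = n))) : False := by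
  have hcyc : ∀ i j : Fin n, i < j →
      ((SimpleGraph.cycleGraph n).Adj i j ↔ (j : ℕ) = i + 1 ∨ ((i : ℕ) = 0 ∧ (j : ℕ) + 1 = n)) := by
    intro i j hij
    rw [SimpleGraph.cycleGraph_adj', Fin.coe_sub_iff_lt.2 hij, Fin.coe_sub_iff_le.2 hij.le]
    have := j.2
    have := i.2
    have : (i : ℕ) < j := hij
    omega
  refine (hc n hn).elim ⟨⟨fun i => f i, ?_⟩, ?_⟩
  · intro i j hij
    by_contra hne
    rcases lt_or_gt_of_ne hne with h | h
    · exact (hf i j h j.2).1 hij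
    · exact (hf j i h i.2).1 hij.symm
  · intro i j
    rcases lt_trichotomy i j with h | rfl | h
    · rw [hcyc i j h]
      exact (hf i j h j.2).2
    · simp
    · rw [SimpleGraph.adj_comm, (SimpleGraph.cycleGraph n).adj_comm, hcyc j i h]
      exact (hf j i h i.2).2

/-- Dirac: minimal separators of chordal graphs are cliques. -/
theorem IsChordal.isClique_of_isMinSeparator (hc : IsChordal G) (hS : IsMinSeparator G S) :
    G.IsClique S := by
  obtain ⟨x, y, hmin⟩ := hS
  intro a ha b hb hab
  by_contra hadj
  have hsep := isSeparator_iff.1 hmin.1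
  have key : ∀ z, z ∉ S → (∀ s ∈ S, ∃ u ∈ comp G S z, G.Adj u s) →
      ∃ (m : ℕ) (p : ℕ → V), 2 ≤ m ∧ p 0 = a ∧ p m = b ∧ (∀ i, 0 < i → i < m → p i ∈ comp G S z) ∧
      ∀ i j, i < j → j ≤ m → p i ≠ p j ∧ (G.Adj (p i) (p j) ↔ j = i + 1) := by
    intro z hz hfull
    obtain ⟨u, hu, hua⟩ := hfull a ha
    obtain ⟨w, hw, hwb⟩ := hfull b hb
    obtain ⟨m, p, h0, hm, hp, hind⟩ := (((isConnectedSet_comp hz).insert_of_adj hu hua).insert_of_adj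
      (Or.inr hw) hwb).exists_induced_path (a := a) (b := b) (by simp) (by simp)
    refine ⟨m, p, ?_, h0, hm, ?_, hind⟩
    · by_contra hlt
      interval_cases m
      · exact hab (h0.symm.trans hm)
      · have := (hind 0 1 (by omega) le_rfl).2.2 rfl
        rw [h0, hm] at this
        exact hadj this
    · intro i hi him
      rcases hp i with h | h | h
      · exact absurd (h.trans hm.symm) (hind i m him le_rfl).1
      · exact absurd (h0.trans h.symm) (hind 0 i hi him.le).1
      · exact h
  obtain ⟨m, p, hm2, hp0, hpm, hpi, hp⟩ := key x hsep.1 fun s hs => exists_adj_of_minimal hmin hs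
  obtain ⟨l, q, hl2, hq0, hql, hqi, hq⟩ := key y hsep.2.1 fun s hs =>
    exists_adj_of_minimal (minimal_isSeparator_comm hmin) hs
  have hpq : ∀ i j, 0 < i → i < m → 0 < j → j < l → p i ≠ q j ∧ ¬ G.Adj (p i) (q j) := by
    intro i j hi him hj hjl
    have h1 := hpi i hi him
    have h2 := hqi j hj hjl
    have h3 : q j ∉ comp G S x := Set.disjoint_right.1 (comp_disjoint hsep.2.2) h2
    exact ⟨fun h => h3 (h ▸ h1), fun h => h3 (mem_comp_of_adj h1 (notMem_of_mem_comp h2) h)⟩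
  -- Follow `p` from `a` to `b` through the component of `x`, then `q` backwards through that of
  -- `y`: an induced cycle of length `m + l ≥ 4`.
  refine hc.false_of_cycle (n := m + l) (by omega)
    (fun i => if i ≤ m then p i else q (m + l - i)) ?_
  intro i j hij hj
  by_cases hjm : j ≤ m
  · simp only [if_pos hjm, if_pos (hij.le.trans hjm)]
    refine ⟨(hp i j hij hjm).1, (hp i j hij hjm).2.trans ?_⟩
    omega
  by_cases him : i ≤ m
  · simp only [if_pos him, if_neg hjm]
    rcases Nat.eq_zero_or_pos i with rfl | hi0
    · have := hq 0 (m + l - j) (by omega) (by omega)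
      rw [hp0, ← hq0]
      refine ⟨this.1, this.2.trans ?_⟩
      omega
    rcases him.lt_or_eq with him' | rfl
    · have := hpq i (m + l - j) hi0 him' (by omega) (by omega)
      refine ⟨this.1, iff_of_false this.2 ?_⟩
      omega
    · have := hq (i + l - j) l (by omega) le_rfl
      rw [hpm, ← hql]
      refine ⟨this.1.symm, (G.adj_comm _ _).trans (this.2.trans ?_)⟩
      omega
  · simp only [if_neg him, if_neg hjm]
    have := hq (m + l - j) (m + l - i) (by omega) (by omega)
    refine ⟨this.1.symm, (G.adj_comm _ _).trans (this.2.trans ?_)⟩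
    omega

/-- In a chordal graph, a connected set in which all vertices of a clique `Q` have neighbours
contains a vertex complete to `Q`. -/
theorem IsChordal.exists_complete [Finite V] (hc : IsChordal G) (hQ : G.IsClique Q)
    (hD : IsConnectedSet G D) (hDQ : Disjoint D Q) (hfull : ∀ q ∈ Q, ∃ u ∈ D, G.Adj u q) :
    ∃ v ∈ D, ∀ q ∈ Q, G.Adj v q := by
  -- Let `v` have the most neighbours in `Q`, and suppose that it misses `s`. The neighbours of `s`
  -- next to the component of `v` in `G - N(s)` form a minimal separator of `v` and `s`, hence a
  -- clique. One of them lies in `D`; it sees `s` and everything in `Q` that `v` sees, against the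
  -- choice of `v`.
  obtain ⟨v, hv, hmax⟩ := Set.exists_max_image D (fun v => {q | q ∈ Q ∧ G.Adj v q}.ncard)
    D.toFinite hD.nonempty
  refine ⟨v, hv, ?_⟩
  by_contra! hcon
  obtain ⟨s, hs, hvs⟩ := hcon
  have hsD : s ∉ D := Set.disjoint_right.1 hDQ hs
  set N := {w | G.Adj s w} with hN
  have hvN : v ∉ N := fun h => hvs (SimpleGraph.Adj.symm h)
  set D' := comp G N v with hD'
  have hD'c : IsConnectedSet G D' := isConnectedSet_comp hvN
  have hvD' : v ∈ D' := mem_comp_self hvN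
  have hsD' : s ∉ D' := by
    intro hsD'
    obtain ⟨u, _, rfl, w, hw, _, huw⟩ := hD'c.exists_adj (J := {s}) hsD' rfl hvD'
      (fun h => hsD ((show v = s from h) ▸ hv))
    exact notMem_of_mem_comp hw huw
  set Z := {z | z ∈ N ∧ ∃ u ∈ D', G.Adj u z} with hZ
  have hvZ : v ∉ Z := fun h => hvN h.1
  have hsZ : s ∉ Z := fun h => G.irrefl h.1
  have hD'Z : D' ⊆ comp G Z v := hD'c.subset_comp
    (Set.disjoint_left.2 fun z hz hz' => notMem_of_mem_comp hz hz'.1) hvD'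
  have hclos : comp G Z v ⊆ D' := by
    refine (isConnectedSet_comp hvZ).subset_of_closed (mem_comp_self hvZ) hvD' ?_
    intro u _ hu w hw huw
    refine mem_comp_of_adj hu (fun hwN => notMem_of_mem_comp hw ⟨hwN, u, hu, huw⟩) huw
  have hZsep : IsSeparator G v s Z := isSeparator_iff.2 ⟨hvZ, hsZ, fun h => hsD' (hclos h)⟩
  have hZc : G.IsClique Z := hc.isClique_of_isMinSeparator ⟨v, s, minimal_isSeparator_of_full hZsep
    (fun z hz => by
      obtain ⟨u, hu, huz⟩ := hz.2
      exact ⟨u, hD'Z hu, huz⟩)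
    (fun z hz => ⟨s, mem_comp_self hsZ, hz.1⟩)⟩
  obtain ⟨d, hd, hds⟩ := hfull s hs
  obtain ⟨u, _, huD', z, hz, hzD', huz⟩ := (hD.insert_of_adj hd hds).exists_adj (J := D')
    (Or.inr hv) hvD' (Or.inl rfl) hsD'
  have hzN : z ∈ N := by
    by_contra hzN
    exact hzD' (mem_comp_of_adj huD' hzN huz)
  have hzZ : z ∈ Z := ⟨hzN, u, huD', huz⟩
  have hzD : z ∈ D := hz.resolve_left fun h => hsZ (h ▸ hzZ)
  refine absurd (hmax z hzD) (not_le.2 (Set.ncard_lt_ncard ⟨?_, fun hsub => ?_⟩))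
  · rintro q ⟨hq, hvq⟩
    have hqs : s ≠ q := fun h => hvs (h ▸ hvq)
    refine ⟨hq, hZc hzZ ⟨hQ hs hq hqs, v, hvD', hvq⟩ ?_⟩
    rintro rfl
    exact Set.disjoint_left.1 hDQ hzD hq
  · exact hvs (hsub ⟨hs, SimpleGraph.Adj.symm hzN⟩).2

end Chordal

/-! ### Chordal graphs whose minimal separators all have size `k` -/

section Structure

variable {V : Type*} {G : SimpleGraph V} {S T T' X K Q D A : Set V} {x y v w s t : V} {k : ℕ}

/-- The vertices of the component of `v` in `G - S` that are complete to `S`. -/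
def core (G : SimpleGraph V) (S : Set V) (v : V) : Set V :=
  {a | a ∈ comp G S v ∧ ∀ s ∈ S, G.Adj a s}

/-- The vertices of `K` with a neighbour in the component of `v` in `G - K`. -/
def attachment (G : SimpleGraph V) (K : Set V) (v : V) : Set V :=
  {z | z ∈ K ∧ ∃ u ∈ comp G K v, G.Adj u z}

theorem core_subset_comp : core G S v ⊆ comp G S v := fun _ h => h.1

theorem disjoint_core : Disjoint (core G S v) S := (disjoint_comp G S v).mono_left core_subset_comp

theorem core_eq (h : w ∈ comp G S v) : core G S w = core G S v := by
  simp only [core, comp_eq h]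

theorem comp_subset_comp_of_attachment_subset (hX : attachment G K v ⊆ X) (hv : v ∉ X)
    (hvK : v ∉ K) : comp G X v ⊆ comp G K v := by
  refine (isConnectedSet_comp hv).subset_of_closed (mem_comp_self hv) (mem_comp_self hvK) ?_
  intro u _ hu w hw huw
  exact mem_comp_of_adj hu (fun hwK => notMem_of_mem_comp hw (hX ⟨hwK, u, hu, huw⟩)) huw

theorem cdeg_eq_two_iff (hv : v ∉ S) (hw : w ∉ S) (hvw : w ∉ comp G S v) :
    cdeg G S = 2 ↔ ∀ z, z ∉ S → z ∈ comp G S v ∨ z ∈ comp G S w := by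
  have hne : comp G S v ≠ comp G S w := fun h => hvw (h ▸ mem_comp_self hw)
  rw [cdeg_eq_ncard]
  constructor
  · intro h z hz
    have h1 : ({comp G S v, comp G S w} : Set (Set V)) = {C | ∃ v, v ∉ S ∧ C = comp G S v} := by
      refine Set.eq_of_subset_of_ncard_le ?_ (by rw [h, Set.ncard_pair hne])
        (Set.finite_of_ncard_ne_zero (by omega))
      rintro C (rfl | rfl)
      · exact ⟨v, hv, rfl⟩
      · exact ⟨w, hw, rfl⟩
    have h2 : comp G S z ∈ ({comp G S v, comp G S w} : Set (Set V)) := h1 ▸ ⟨z, hz, rfl⟩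
    rcases h2 with h2 | h2
    · exact Or.inl (h2 ▸ mem_comp_self hz)
    · exact Or.inr ((show _ = _ from h2) ▸ mem_comp_self hz)
  · intro h
    rw [← Set.ncard_pair hne]
    congr 1
    ext C
    constructor
    · rintro ⟨z, hz, rfl⟩
      exact (h z hz).imp comp_eq comp_eq
    · rintro (rfl | rfl)
      · exact ⟨v, hv, rfl⟩
      · exact ⟨w, hw, rfl⟩

theorem exists_notMem_comp (hS : IsMinSeparator G S) (v : V) :
    ∃ w, w ∉ S ∧ w ∉ comp G S v := by
  obtain ⟨x, y, h⟩ := hS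
  have h1 := isSeparator_iff.1 h.1
  by_cases hx : x ∈ comp G S v
  · refine ⟨y, h1.2.1, fun hy => h1.2.2 ?_⟩
    rwa [comp_eq hx]
  · exact ⟨x, h1.1, hx⟩

/-- A clique meets at most one component of `G - S`. -/
theorem disjoint_comp_of_isClique (hT : G.IsClique T) (ht : t ∈ T) (htv : t ∈ comp G S v)
    (hw : w ∉ comp G S v) : Disjoint (comp G S w) T := by
  rw [Set.disjoint_right]
  intro z hz hzw
  have hzv : z ∉ comp G S v := Set.disjoint_right.1 (comp_disjoint hw) hzw
  have hne : t ≠ z := fun h => hzv (h ▸ htv)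
  exact hzv (mem_comp_of_adj htv (notMem_of_mem_comp hzw) (hT ht hz hne))

theorem IsMaxClique.mem_of_complete (hK : IsMaxClique G K) (h : ∀ z ∈ K, z ≠ v → G.Adj v z) :
    v ∈ K := by
  have : G.IsClique (insert v K) := by
    refine SimpleGraph.isClique_insert.2 ⟨hK.1, fun z hz hvz => h z hz hvz.symm⟩
  exact hK.2 this (Set.subset_insert v K) (Set.mem_insert v K)

theorem exists_minSeparator_of_not_external (hK : IsMaxClique G K)
    (hn : ¬ IsExternalClique G K) (S : Set V) : ∃ S', IsMinSeparator G S' ∧ S' ⊆ K ∧ S' ≠ S := by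
  have h : 1 < (minSeparatorsIn G K).ncard := not_le.1 fun h => hn ⟨hK, h⟩
  obtain ⟨S', hS', hne⟩ := Set.exists_ne_of_one_lt_ncard h S
  exact ⟨S', hS'.1, hS'.2, hne⟩

theorem diff_subset_comp (hK : G.IsClique K) (hs : s ∈ K) (hsT : s ∉ T) : K \ T ⊆ comp G T s :=
  (isConnectedSet_of_isClique (hK.subset Set.sdiff_subset) ⟨s, hs, hsT⟩).subset_comp
    Set.disjoint_sdiff_left ⟨hs, hsT⟩

variable [Finite V]

theorem exists_minimal_isSeparator_of_not_adj (hxy : x ≠ y) (hadj : ¬ G.Adj x y) :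
    ∃ S, Minimal (IsSeparator G x y) S := by
  have hx : x ∉ ({x, y}ᶜ : Set V) := by simp
  have hsep : IsSeparator G x y ({x, y}ᶜ) := by
    refine isSeparator_iff.2 ⟨hx, by simp, fun hy => ?_⟩
    obtain ⟨u, _, rfl, w, hw, hwx, huw⟩ := (isConnectedSet_comp (G := G) hx).exists_adj (J := {x})
      (mem_comp_self hx) rfl hy (fun h => hxy h.symm)
    have : w = y := by
      have := notMem_of_mem_comp hw
      simp only [Set.mem_compl_iff, not_not] at this
      exact this.resolve_left hwx
    exact hadj (this ▸ huw)
  obtain ⟨S, _, hS⟩ := exists_minimal_isSeparator hsep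
  exact ⟨S, hS⟩

/-- If non-adjacent vertices are separated by sets of size at most `k`, then so are all minimal
separators of a chordal graph. -/
theorem ncard_minSeparator_le (hc : IsChordal G)
    (h : ∀ x y, x ≠ y → ¬ G.Adj x y → ∃ X : Set V, X.ncard ≤ k ∧ IsSeparator G x y X)
    (hS : IsMinSeparator G S) : S.ncard ≤ k := by
  have hScl := hc.isClique_of_isMinSeparator hS
  obtain ⟨x, y, hmin⟩ := hS
  have hsep := isSeparator_iff.1 hmin.1
  obtain ⟨a, ha, haS⟩ := hc.exists_complete hScl (isConnectedSet_comp hsep.1) (disjoint_comp _ _ _)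
    fun s hs => exists_adj_of_minimal hmin hs
  obtain ⟨b, hb, hbS⟩ := hc.exists_complete hScl (isConnectedSet_comp hsep.2.1)
    (disjoint_comp _ _ _) fun s hs => exists_adj_of_minimal (minimal_isSeparator_comm hmin) hs
  have hba : b ∉ comp G S a := by
    rw [comp_eq ha]
    exact Set.disjoint_right.1 (comp_disjoint hsep.2.2) hb
  obtain ⟨X, hX, hXs⟩ := h a b (fun h => hba (h ▸ mem_comp_self (notMem_of_mem_comp ha)))
    (fun h => hba (mem_comp_of_adj (mem_comp_self (notMem_of_mem_comp ha))
      (notMem_of_mem_comp hb) h))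
  -- All of `S` consists of common neighbours of `a` and `b`, which every separator of the two
  -- contains.
  refine le_trans (Set.ncard_le_ncard fun s hs => ?_) hX
  have hX' := isSeparator_iff.1 hXs
  by_contra hsX
  exact hX'.2.2 (mem_comp_of_adj (mem_comp_of_adj (mem_comp_self hX'.1) hsX (haS s hs)) hX'.2.1
    (hbS s hs).symm)

/-- Chordal graphs all of whose minimal separators have size `k`. -/
structure IsUniform (G : SimpleGraph V) (k : ℕ) : Prop where
  chordal : IsChordal G
  ncard_eq : ∀ S, IsMinSeparator G S → S.ncard = k

namespace IsUniform

omit [Finite V] in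
theorem isClique (hG : IsUniform G k) (hS : IsMinSeparator G S) : G.IsClique S :=
  hG.chordal.isClique_of_isMinSeparator hS

theorem mem_comp_of_lt (hG : IsUniform G k) (hX : X.ncard < k) (hx : x ∉ X) (hy : y ∉ X) :
    y ∈ comp G X x := by
  by_contra hxy
  obtain ⟨S, hSX, hS⟩ := exists_minimal_isSeparator (isSeparator_iff.2 ⟨hx, hy, hxy⟩)
  have := Set.ncard_le_ncard hSX
  rw [hG.ncard_eq S ⟨x, y, hS⟩] at this
  omega

theorem minimal_isSeparator (hG : IsUniform G k) (hX : X.ncard ≤ k) (h : IsSeparator G x y X) :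
    Minimal (IsSeparator G x y) X := by
  obtain ⟨S, hSX, hS⟩ := exists_minimal_isSeparator h
  have := Set.eq_of_subset_of_ncard_le hSX (by rw [hG.ncard_eq S ⟨x, y, hS⟩]; exact hX)
  exact this ▸ hS

/-- Otherwise the component would be attached to fewer than `k` vertices, and so few vertices cannot
separate it from the rest. -/
theorem exists_adj (hG : IsUniform G k) (hS : IsMinSeparator G S) (hv : v ∉ S) (hs : s ∈ S) :
    ∃ u ∈ comp G S v, G.Adj u s := by
  obtain ⟨w, hw, hwv⟩ := exists_notMem_comp hS v
  by_contra! hcon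
  have hlt : (attachment G S v).ncard < k := by
    rw [← hG.ncard_eq S hS]
    refine Set.ncard_lt_ncard ⟨fun z hz => hz.1, fun hsub => ?_⟩
    obtain ⟨_, u, hu, hus⟩ := hsub hs
    exact hcon u hu hus
  exact hwv (comp_subset_comp_of_attachment_subset subset_rfl (fun h => hv h.1) hv
    (hG.mem_comp_of_lt hlt (fun h => hv h.1) (fun h => hw h.1)))

theorem core_nonempty (hG : IsUniform G k) (hS : IsMinSeparator G S) (hv : v ∉ S) :
    (core G S v).Nonempty := by
  obtain ⟨a, ha, haS⟩ := hG.chordal.exists_complete (hG.isClique hS) (isConnectedSet_comp hv)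
    (disjoint_comp _ _ _) fun s hs => hG.exists_adj hS hv hs
  exact ⟨a, ha, haS⟩

/-- Non-adjacent core vertices would have a minimal separator `Z`. It contains their common
neighbours `S` and has the same size, so it is `S`; but the core lies in one component of `G - S`.
-/
theorem isClique_union_core (hG : IsUniform G k) (hS : IsMinSeparator G S) :
    G.IsClique (S ∪ core G S v) := by
  have key : ∀ a ∈ core G S v, ∀ b ∈ core G S v, a ≠ b → G.Adj a b := by
    intro a ha b hb hab
    by_contra hadj
    obtain ⟨Z, hZ⟩ := exists_minimal_isSeparator_of_not_adj hab hadj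
    have hZ' := isSeparator_iff.1 hZ.1
    have hSZ : S ⊆ Z := by
      intro s hs
      by_contra hsZ
      exact hZ'.2.2 (mem_comp_of_adj (mem_comp_of_adj (mem_comp_self hZ'.1) hsZ (ha.2 s hs)) hZ'.2.1
        (hb.2 s hs).symm)
    have := Set.eq_of_subset_of_ncard_le hSZ
      (by rw [hG.ncard_eq S hS, hG.ncard_eq Z ⟨a, b, hZ⟩])
    subst this
    apply hZ'.2.2
    rw [comp_eq ha.1]
    exact hb.1
  rintro a (ha | ha) b (hb | hb) hab
  · exact hG.isClique hS ha hb hab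
  · exact (hb.2 a ha).symm
  · exact ha.2 b hb
  · exact key a ha b hb hab

theorem isMaxClique_union_core (hG : IsUniform G k) (hS : IsMinSeparator G S) (hv : v ∉ S) :
    IsMaxClique G (S ∪ core G S v) := by
  refine ⟨hG.isClique_union_core hS, fun K hK hle z hz => ?_⟩
  by_cases hzS : z ∈ S
  · exact Or.inl hzS
  have hzc : ∀ s ∈ S, G.Adj z s := fun s hs => hK hz (hle (Or.inl hs)) fun h => hzS (h ▸ hs)
  obtain ⟨a, ha⟩ := hG.core_nonempty hS hv
  by_cases hza : a = z
  · exact Or.inr (hza ▸ ha)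
  · exact Or.inr ⟨mem_comp_of_adj ha.1 hzS (hK (hle (Or.inr ha)) hz hza), hzc⟩

/-- The maximal cliques that contain a minimal separator correspond to its components. -/
theorem eq_union_core (hG : IsUniform G k) (hS : IsMinSeparator G S) (hK : IsMaxClique G K)
    (hSK : S ⊆ K) (hw : w ∈ K) (hwS : w ∉ S) : K = S ∪ core G S w := by
  have hsub : K ⊆ S ∪ core G S w := by
    intro z hz
    by_cases hzS : z ∈ S
    · exact Or.inl hzS
    · refine Or.inr ⟨?_, fun s hs => hK.1 hz (hSK hs) fun h => hzS (h ▸ hs)⟩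
      by_cases hwz : w = z
      · exact hwz ▸ mem_comp_self hwS
      · exact mem_comp_of_adj (mem_comp_self hwS) hzS (hK.1 hw hz hwz)
  exact hsub.antisymm (hK.2 (hG.isClique_union_core hS) hsub)

theorem exists_eq_union_core (hG : IsUniform G k) (hS : IsMinSeparator G S)
    (hK : IsMaxClique G K) (hSK : S ⊆ K) : ∃ w, w ∉ S ∧ w ∈ K ∧ K = S ∪ core G S w := by
  obtain ⟨v, hv⟩ : ∃ v, v ∉ S := by
    obtain ⟨x, y, h⟩ := hS
    exact ⟨x, (isSeparator_iff.1 h.1).1⟩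
  obtain ⟨w, hw, hwS⟩ : ∃ w ∈ K, w ∉ S := by
    by_contra! hcon
    obtain ⟨a, ha⟩ := hG.core_nonempty hS hv
    exact Set.disjoint_left.1 disjoint_core ha (hcon a (hK.2 (hG.isClique_union_core hS)
      (fun z hz => Or.inl (hcon z hz)) (Or.inr ha)))
  exact ⟨w, hwS, hw, hG.eq_union_core hS hK hSK hw hwS⟩

/-- The attachment of a component outside a maximal clique is a minimal separator. -/
theorem attachment_spec (hG : IsUniform G k) (hK : IsMaxClique G K) (hv : v ∉ K) :
    IsMinSeparator G (attachment G K v) ∧ ∃ w ∈ K, w ∉ attachment G K v := by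
  -- A component attached to all of `K` would contain a vertex complete to `K`, against maximality.
  obtain ⟨w, hw, hwN⟩ : ∃ w ∈ K, w ∉ attachment G K v := by
    by_contra! hcon
    obtain ⟨a, ha, haK⟩ := hG.chordal.exists_complete hK.1 (isConnectedSet_comp hv)
      (disjoint_comp _ _ _) fun s hs => (hcon s hs).2
    exact notMem_of_mem_comp ha (hK.mem_of_complete fun z hz _ => haK z hz)
  have hvN : v ∉ attachment G K v := fun h => hv h.1
  have hsub := comp_subset_comp_of_attachment_subset subset_rfl hvN hv
  have hcomp : comp G K v ⊆ comp G (attachment G K v) v := (isConnectedSet_comp hv).subset_comp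
    ((disjoint_comp G K v).mono_right fun z hz => hz.1) (mem_comp_self hv)
  refine ⟨⟨v, w, minimal_isSeparator_of_full (isSeparator_iff.2 ⟨hvN, hwN, fun h =>
    notMem_of_mem_comp (hsub h) hw⟩) ?_ ?_⟩, w, hw, hwN⟩
  · intro z hz
    obtain ⟨u, hu, huz⟩ := hz.2
    exact ⟨u, hcomp hu, huz⟩
  · intro z hz
    exact ⟨w, mem_comp_self hwN, hK.1 hw hz.1 fun h => hwN (h ▸ hz)⟩

/-- Inside the component of `G - S`, the component of `t` is linked to the core, hence attached to a
vertex outside `S`. -/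
theorem attachment_ne (hG : IsUniform G k) (hS : IsMinSeparator G S) (ht : t ∈ comp G S v)
    (htK : t ∉ core G S v) : attachment G (S ∪ core G S v) t ≠ S := by
  intro heq
  have htS : t ∉ S := notMem_of_mem_comp ht
  have hv : v ∉ S := notMem_of_mem_comp' ht
  have htK' : t ∉ S ∪ core G S v := fun h => h.elim htS htK
  obtain ⟨a, ha⟩ := hG.core_nonempty hS hv
  obtain ⟨u, _, huJ, w, hw, hwJ, huw⟩ := (isConnectedSet_comp hv).exists_adj
    (J := comp G (S ∪ core G S v) t) ht (mem_comp_self htK') ha.1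
    (fun h => notMem_of_mem_comp h (Or.inr ha))
  have hwK : w ∈ S ∪ core G S v := by
    by_contra hwK
    exact hwJ (mem_comp_of_adj huJ hwK huw)
  exact notMem_of_mem_comp hw (heq ▸ (⟨hwK, u, huJ, huw⟩ : w ∈ attachment G (S ∪ core G S v) t))

/-- The component belonging to an external maximal clique consists of this clique. -/
theorem comp_eq_core (hG : IsUniform G k) (hS : IsMinSeparator G S)
    (hK : IsExternalClique G (S ∪ core G S v)) : comp G S v = core G S v := by
  refine Set.Subset.antisymm (fun t ht => ?_) core_subset_comp
  by_contra htK
  have h := hG.attachment_spec hK.1 (v := t) (fun h => h.elim (notMem_of_mem_comp ht) htK)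
  refine hG.attachment_ne hS ht htK ?_
  exact (Set.ncard_le_one (Set.toFinite _)).1 hK.2 _ ⟨h.1, fun z hz => hz.1⟩ _
    ⟨hS, Set.subset_union_left⟩

theorem nonempty_diff (hG : IsUniform G k) (hS : IsMinSeparator G S) (hX : X.ncard = k)
    (hne : X ≠ S) : ∃ s ∈ S, s ∉ X := by
  by_contra! hcon
  exact hne (Set.eq_of_subset_of_ncard_le (show S ⊆ X from hcon)
    (by rw [hX, hG.ncard_eq S hS])).symm

/-- Components of `G - S` missed by `T` lie in the component of `G - T` of `S \ T`. -/
theorem comp_subset_comp (hG : IsUniform G k) (hS : IsMinSeparator G S) (hv : v ∉ S) (hs : s ∈ S)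
    (hsT : s ∉ T) (hd : Disjoint (comp G S v) T) : comp G S v ⊆ comp G T s := by
  obtain ⟨u, hu, hus⟩ := hG.exists_adj hS hv hs
  refine (Set.subset_insert s _).trans (((isConnectedSet_comp hv).insert_of_adj hu hus).subset_comp
    ?_ (Set.mem_insert _ _))
  rw [Set.disjoint_insert_left]
  exact ⟨hsT, hd⟩

/-- A criterion for an edge between two components of `G - S` to raise the strict bramble number
above `k`. -/
theorem lt_sbn_sup_edge (hG : IsUniform G k) (hS : IsMinSeparator G S) (hx : x ∉ S) (hy : y ∉ S)
    (hxy : y ∉ comp G S x) (h1 : k < (comp G S x).ncard + (comp G S y).ncard)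
    (h2 : ∀ T, IsMinSeparator G T → T ≠ S → ∀ s ∈ S, s ∉ T → k < (comp G T s).ncard)
    (h3 : ∀ T T', IsMinSeparator G T → IsMinSeparator G T' → T ≠ S → T' ≠ S → ∀ s ∈ S, s ∉ T →
      ∀ s' ∈ S, s' ∉ T' → (comp G T s ∩ comp G T' s').Nonempty) :
    k < sbn (G ⊔ SimpleGraph.edge x y) := by
  classical
  have hdisj := comp_disjoint hxy
  have hcardS := hG.ncard_eq S hS
  have hle : G ≤ G ⊔ SimpleGraph.edge x y := le_sup_left
  -- The haven: `S` is a clique, so the component of `G - X` that contains `S \ X` is well defined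
  -- for `X ≠ S`. The two components assigned to `S` are connected by the new edge.
  let β : Set V → Set V := fun X =>
    if h : ∃ s ∈ S, s ∉ X then comp G X h.choose else comp G S x ∪ comp G S y
  have hβS : β S = comp G S x ∪ comp G S y := dif_neg (by push Not; exact fun s hs => hs)
  have hβ : ∀ X, X.ncard = k → X ≠ S → ∃ s ∈ S, s ∉ X ∧ β X = comp G X s := by
    intro X hX hne
    have h := hG.nonempty_diff hS hX hne
    exact ⟨h.choose, h.choose_spec.1, h.choose_spec.2, dif_pos h⟩
  have hcardS2 : (comp G S x ∪ comp G S y).ncard = (comp G S x).ncard + (comp G S y).ncard :=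
    Set.ncard_union_eq hdisj
  have hcardV : 2 * k < Nat.card V := by
    have : Disjoint (comp G S x ∪ comp G S y) S :=
      Set.disjoint_union_left.2 ⟨disjoint_comp _ _ _, disjoint_comp _ _ _⟩
    have h := Set.ncard_le_card ((comp G S x ∪ comp G S y) ∪ S)
    rw [Set.ncard_union_eq this] at h
    omega
  -- A `k`-set that separates anything is a minimal separator, so all other `k`-sets leave a
  -- connected graph.
  have hnon : ∀ X, X.ncard = k → ¬ IsMinSeparator G X → ∀ s, s ∉ X → comp G X s = Xᶜ := by
    intro X hX hns s hs
    refine Set.Subset.antisymm (fun z hz => notMem_of_mem_comp hz) fun z hz => ?_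
    by_contra hzs
    exact hns ⟨s, z, hG.minimal_isSeparator hX.le (isSeparator_iff.2 ⟨hs, hz, hzs⟩)⟩
  have hsize : ∀ X, X.ncard = k → k < (β X).ncard := by
    intro X hX
    by_cases hXS : X = S
    · rw [hXS, hβS]; omega
    obtain ⟨s, hs, hsX, h⟩ := hβ X hX hXS
    rw [h]
    by_cases hsep : IsMinSeparator G X
    · exact h2 X hsep hXS s hs hsX
    · rw [hnon X hX hsep s hsX]
      have := Set.ncard_add_ncard_compl X
      omega
  have hnonsep : ∀ X Y, X.ncard = k → Y.ncard = k → X ≠ S → ¬ IsMinSeparator G X →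
      (β X ∩ β Y).Nonempty := by
    intro X Y hX hY hne hsep
    obtain ⟨s, hs, hsX, h⟩ := hβ X hX hne
    rw [h, hnon X hX hsep s hsX]
    obtain ⟨z, hz, hzX⟩ := exists_mem_notMem_of_ncard_lt (hX.trans_lt (hsize Y hY))
    exact ⟨z, hzX, hz⟩
  -- The clique `T` meets at most one component of `G - S`, so the component of `x` or that of `y`
  -- survives in `G - T`, linked to `S \ T`.
  have hST : ∀ T, T.ncard = k → T ≠ S → IsMinSeparator G T → (β S ∩ β T).Nonempty := by
    intro T hT hne hsep
    obtain ⟨s, hs, hsT, h⟩ := hβ T hT hne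
    obtain ⟨t, ht, htS⟩ := hG.nonempty_diff hsep hcardS (Ne.symm hne)
    rw [h, hβS]
    have hTcl := hG.isClique hsep
    by_cases htx : t ∈ comp G S x
    · exact ⟨y, Or.inr (mem_comp_self hy), hG.comp_subset_comp hS hy hs hsT
        (disjoint_comp_of_isClique hTcl ht htx hxy) (mem_comp_self hy)⟩
    · refine ⟨x, Or.inl (mem_comp_self hx), hG.comp_subset_comp hS hx hs hsT
        (disjoint_comp_of_isClique hTcl ht (mem_comp_self htS) fun h => htx (comp_symm h))
        (mem_comp_self hx)⟩
  refine lt_sbn_of_haven (by omega) β ?_ ?_ ?_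
  · intro X hX
    by_cases hXS : X = S
    · rw [hXS, hβS]
      refine ((isConnectedSet_comp hx).mono_graph hle).union_of_adj
        ((isConnectedSet_comp hy).mono_graph hle) (mem_comp_self hx) (mem_comp_self hy) ?_
      rw [SimpleGraph.sup_adj, SimpleGraph.edge_adj]
      exact Or.inr ⟨Or.inl ⟨rfl, rfl⟩, fun h => hxy (h ▸ mem_comp_self hx)⟩
    · obtain ⟨s, hs, hsX, h⟩ := hβ X hX hXS
      rw [h]
      exact (isConnectedSet_comp hsX).mono_graph hle
  · intro X hX
    by_cases hXS : X = S
    · rw [hXS, hβS]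
      exact Set.disjoint_union_left.2 ⟨disjoint_comp _ _ _, disjoint_comp _ _ _⟩
    · obtain ⟨s, hs, hsX, h⟩ := hβ X hX hXS
      rw [h]
      exact disjoint_comp _ _ _
  · intro X Y hX hY
    by_cases hXS : X = S
    · by_cases hYS : Y = S
      · rw [hXS, hYS, Set.inter_self, hβS]
        exact ⟨x, Or.inl (mem_comp_self hx)⟩
      · rw [hXS]
        by_cases hsep : IsMinSeparator G Y
        · exact hST Y hY hYS hsep
        · rw [Set.inter_comm]
          exact hnonsep Y S hY hcardS hYS hsep
    by_cases hsX : IsMinSeparator G X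
    · by_cases hYS : Y = S
      · rw [hYS, Set.inter_comm]
        exact hST X hX hXS hsX
      by_cases hsY : IsMinSeparator G Y
      · obtain ⟨s, hs, hsX', h⟩ := hβ X hX hXS
        obtain ⟨s', hs', hsY', h'⟩ := hβ Y hY hYS
        rw [h, h']
        exact h3 X Y hsX hsY hXS hYS s hs hsX' s' hs' hsY'
      · rw [Set.inter_comm]
        exact hnonsep Y X hY hX hYS hsY
    · exact hnonsep X Y hX hY hXS hsX

end IsUniform

end Structure

/-! ### Domino-trees are edge-maximal -/

section DominoTree

variable {V : Type*} [Finite V] {G : SimpleGraph V} {S T T' S' K : Set V} {x y v w s t : V} {k : ℕ}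

omit [Finite V] in
theorem IsProperDominoTree.isUniform (hD : IsProperDominoTree G k) : IsUniform G k :=
  ⟨hD.chordal, hD.separator_size⟩

omit [Finite V] in
theorem union_core_sdiff : (S ∪ core G S v) \ S = core G S v := by
  rw [Set.union_sdiff_left, disjoint_core.sdiff_eq_left]

/-- Two distinct minimal separators in a maximal clique make up this clique. -/
theorem IsProperDominoTree.eq_union_of_ne (hD : IsProperDominoTree G k) (hK : IsMaxClique G K)
    (hS : IsMinSeparator G S) (hSK : S ⊆ K) (hS' : IsMinSeparator G S') (hSK' : S' ⊆ K)
    (hne : S ≠ S') : K = S ∪ S' := by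
  refine hD.eq_union K hK S S' hne (Eq.symm (Set.eq_of_subset_of_ncard_le ?_ ?_))
  · rintro T (rfl | rfl)
    · exact ⟨hS, hSK⟩
    · exact ⟨hS', hSK'⟩
  · rw [Set.ncard_pair hne]
    exact hD.at_most_two K hK

theorem IsProperDominoTree.lt_ncard_core_add_of_external (hD : IsProperDominoTree G k)
    (hS : IsMinSeparator G S) (hw : w ∉ S) (hvw : w ∉ comp G S v)
    (hev : IsExternalClique G (S ∪ core G S v)) (hew : IsExternalClique G (S ∪ core G S w)) :
    k < (core G S v).ncard + (core G S w).ncard := by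
  have hG := hD.isUniform
  have := hD.external_family S ⟨hS, _, hev, Set.subset_union_left⟩ _
    ⟨hev, Set.subset_union_left⟩ _ ⟨hew, Set.subset_union_left⟩ (fun h => by
      obtain ⟨a, ha⟩ := hG.core_nonempty hS hw
      have : a ∈ S ∪ core G S v := h ▸ Or.inr ha
      rcases this with h' | h'
      · exact Set.disjoint_left.1 disjoint_core ha h'
      · exact Set.disjoint_left.1 (comp_disjoint hvw) h'.1 ha.1)
  rwa [valiancy, valiancy, union_core_sdiff, union_core_sdiff] at this

/-- With two components, `S` and the two cores exhaust the maximal cliques containing `S`, so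
`external_two` becomes a bound on the core sizes. -/
theorem IsProperDominoTree.lt_ncard_core_add_of_cdeg (hD : IsProperDominoTree G k)
    (hS : IsMinSeparator G S) (hvw : w ∉ comp G S v)
    (hall : ∀ z, z ∉ S → z ∈ comp G S v ∨ z ∈ comp G S w) (hv : v ∉ S) (hw : w ∉ S)
    (hev : IsExternalClique G (S ∪ core G S v)) :
    k < (core G S v).ncard + (core G S w).ncard := by
  have hG := hD.isUniform
  have h := hD.external_two S ⟨hS, _, hev, Set.subset_union_left⟩
    ((cdeg_eq_two_iff hv hw hvw).2 hall)
  have hsub : ⋃₀ {K | IsMaxClique G K ∧ S ⊆ K} ⊆ S ∪ (core G S v ∪ core G S w) := by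
    refine Set.sUnion_subset ?_
    rintro K ⟨hK, hSK⟩
    obtain ⟨z, hz, _, rfl⟩ := hG.exists_eq_union_core hS hK hSK
    refine Set.union_subset_union_right _ ?_
    rcases hall z hz with hz | hz
    · rw [core_eq hz]; exact Set.subset_union_left
    · rw [core_eq hz]; exact Set.subset_union_right
  have h1 := Set.ncard_le_ncard hsub
  have h2 := Set.ncard_union_le S (core G S v ∪ core G S w)
  have h3 := Set.ncard_union_le (core G S v) (core G S w)
  rw [hG.ncard_eq S hS] at h2
  omega

/-- Components that do not belong to an external maximal clique have more than `k` vertices. -/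
theorem IsProperDominoTree.lt_ncard_comp (hD : IsProperDominoTree G k) (hS : IsMinSeparator G S)
    (hv : v ∉ S) (hn : ¬ IsExternalClique G (S ∪ core G S v)) : k < (comp G S v).ncard := by
  have hG := hD.isUniform
  induction hc : (comp G S v).ncard using Nat.strong_induction_on generalizing S v with
  | _ n ih =>
  subst hc
  have hK := hG.isMaxClique_union_core hS hv
  obtain ⟨S', hS', hSK', hne⟩ := exists_minSeparator_of_not_external hK hn S
  have hKeq := hD.eq_union_of_ne hK hS Set.subset_union_left hS' hSK' hne.symm
  obtain ⟨s, hs, hsS'⟩ := hG.nonempty_diff hS (hG.ncard_eq S' hS') hne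
  obtain ⟨s', hs', hs'S⟩ := hG.nonempty_diff hS' (hG.ncard_eq S hS) hne.symm
  have hdiff : S' \ S ⊆ comp G S v := fun z hz => core_subset_comp
    (((hKeq ▸ Or.inr hz.1 : z ∈ S ∪ core G S v)).resolve_left hz.2)
  -- Every component of `G - S'` on the side away from `S` lies in the component of `v`, together
  -- with the non-empty set `S' \ S`. It is therefore smaller, and the induction hypothesis applies
  -- unless it is external.
  have hcomp : ∀ z, z ∉ S' → z ∉ comp G S' s → comp G S' z ⊆ comp G S v ∧
      Disjoint (comp G S' z) (S' \ S) := by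
    intro z hz hzs
    have hd : Disjoint (comp G S' z) S :=
      disjoint_comp_of_isClique (hG.isClique hS) hs (mem_comp_self hsS') hzs
    obtain ⟨u, hu, hus⟩ := hG.exists_adj hS' hz hs'
    exact ⟨(isConnectedSet_comp hz).subset_comp_of_mem hd hu (mem_comp_of_adj (hdiff ⟨hs', hs'S⟩)
      (Set.disjoint_left.1 hd hu) hus.symm), (disjoint_comp _ _ _).mono_right Set.sdiff_subset⟩
  have hcard : ∀ z, z ∉ S' → z ∉ comp G S' s →
      (S' \ S).ncard + (comp G S' z).ncard ≤ (comp G S v).ncard := by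
    intro z hz hzs
    obtain ⟨h1, h2⟩ := hcomp z hz hzs
    rw [← Set.ncard_union_eq h2.symm]
    exact Set.ncard_le_ncard (Set.union_subset hdiff h1)
  have hpos : 0 < (S' \ S).ncard := (Set.ncard_pos).2 ⟨s', hs', hs'S⟩
  have hbig : ∀ z, z ∉ S' → z ∉ comp G S' s → ¬ IsExternalClique G (S' ∪ core G S' z) →
      k < (comp G S v).ncard := by
    intro z hz hzs hnz
    have h1 := hcard z hz hzs
    have h2 := ih _ (by omega) hS' hz hnz rfl
    omega
  obtain ⟨w, hw, hws⟩ := exists_notMem_comp hS' s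
  by_cases hew : IsExternalClique G (S' ∪ core G S' w)
  swap
  · exact hbig w hw hws hew
  by_cases hthird : ∃ z, z ∉ S' ∧ z ∉ comp G S' s ∧ z ∉ comp G S' w
  · obtain ⟨z, hz, hzs, hzw⟩ := hthird
    by_cases hez : IsExternalClique G (S' ∪ core G S' z)
    swap
    · exact hbig z hz hzs hez
    have h1 := hD.lt_ncard_core_add_of_external hS' hz hzw hew hez
    have h2 := Set.ncard_union_eq (comp_disjoint hzw)
    have h3 := Set.ncard_le_ncard (Set.union_subset (hcomp w hw hws).1 (hcomp z hz hzs).1)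
    have h4 := Set.ncard_le_ncard (core_subset_comp (G := G) (S := S') (v := w))
    have h5 := Set.ncard_le_ncard (core_subset_comp (G := G) (S := S') (v := z))
    omega
  · push Not at hthird
    -- Only two components remain. The core on the side of `S` is `S \ S'`, which has the same size
    -- as `S' \ S`.
    have h1 := hD.lt_ncard_core_add_of_cdeg hS' (v := w) (w := s) (fun h => hws (comp_symm h))
      (fun z hz => by
        by_cases hzs : z ∈ comp G S' s
        · exact Or.inr hzs
        · exact Or.inl (hthird z hz hzs)) hw hsS' hew
    have h2 : core G S' s = S \ S' := by
      rw [← union_core_sdiff (G := G) (S := S') (v := s),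
        ← hG.eq_union_core hS' hK hSK' (Or.inl hs) hsS', hKeq, Set.union_sdiff_right]
    have h3 := hcard w hw hws
    have h4 := Set.ncard_le_ncard (core_subset_comp (G := G) (S := S') (v := w))
    have h5 := Set.ncard_inter_add_ncard_sdiff_eq_ncard S S'
    have h6 := Set.ncard_inter_add_ncard_sdiff_eq_ncard S' S
    rw [Set.inter_comm, hG.ncard_eq S' hS'] at h6
    rw [hG.ncard_eq S hS] at h5
    rw [h2] at h1
    omega

theorem IsProperDominoTree.lt_ncard_comp_add (hD : IsProperDominoTree G k)
    (hS : IsMinSeparator G S) (hv : v ∉ S) (hw : w ∉ S) (hvw : w ∉ comp G S v) :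
    k < (comp G S v).ncard + (comp G S w).ncard := by
  by_cases hev : IsExternalClique G (S ∪ core G S v)
  · by_cases hew : IsExternalClique G (S ∪ core G S w)
    · have h1 := hD.lt_ncard_core_add_of_external hS hw hvw hev hew
      have h4 := Set.ncard_le_ncard (core_subset_comp (G := G) (S := S) (v := v))
      have h5 := Set.ncard_le_ncard (core_subset_comp (G := G) (S := S) (v := w))
      omega
    · have := hD.lt_ncard_comp hS hw hew
      omega
  · have := hD.lt_ncard_comp hS hv hev
    omega

/-- `T` leaves `S` into a single component, and all other components of `G - S` lie in the component
of `s` in `G - T`. Two of them suffice, and so does one that is not external. If the only one is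
external, the vertices of `S ∪ core G S t` outside `T` make up the difference. -/
theorem IsProperDominoTree.lt_ncard_comp_of_ne (hD : IsProperDominoTree G k)
    (hS : IsMinSeparator G S) (hT : IsMinSeparator G T) (hne : T ≠ S) (hs : s ∈ S) (hsT : s ∉ T) :
    k < (comp G T s).ncard := by
  have hG := hD.isUniform
  obtain ⟨t, ht, htS⟩ := hG.nonempty_diff hT (hG.ncard_eq S hS) hne.symm
  obtain ⟨j, hj, hjt⟩ := exists_notMem_comp hS t
  have hdisj : ∀ z, z ∉ comp G S t → Disjoint (comp G S z) T := fun z hz =>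
    disjoint_comp_of_isClique (hG.isClique hT) ht (mem_comp_self htS) hz
  have hsub : ∀ z, z ∉ S → z ∉ comp G S t → comp G S z ⊆ comp G T s := fun z hz hzt =>
    hG.comp_subset_comp hS hz hs hsT (hdisj z hzt)
  by_cases hthird : ∃ z, z ∉ S ∧ z ∉ comp G S t ∧ z ∉ comp G S j
  · obtain ⟨z, hz, hzt, hzj⟩ := hthird
    have h1 := hD.lt_ncard_comp_add hS hj hz hzj
    rw [← Set.ncard_union_eq (comp_disjoint hzj)] at h1
    exact h1.trans_le (Set.ncard_le_ncard (Set.union_subset (hsub j hj hjt) (hsub z hz hzt)))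
  push Not at hthird
  by_cases hej : IsExternalClique G (S ∪ core G S j)
  · have h1 := hD.lt_ncard_core_add_of_cdeg hS (v := j) (w := t) (fun h => hjt (comp_symm h))
      (fun z hz => by
        by_cases hzt : z ∈ comp G S t
        · exact Or.inr hzt
        · exact Or.inl (hthird z hz hzt)) hj htS hej
    have h2 : ((S ∪ core G S t) \ T) ∪ core G S j ⊆ comp G T s :=
      Set.union_subset (diff_subset_comp (hG.isClique_union_core hS) (Or.inl hs) hsT)
        (core_subset_comp.trans (hsub j hj hjt))
    have h3 : Disjoint ((S ∪ core G S t) \ T) (core G S j) := by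
      refine Disjoint.mono_left Set.sdiff_subset (Set.disjoint_union_left.2 ⟨disjoint_core.symm, ?_⟩)
      exact (comp_disjoint hjt).mono core_subset_comp core_subset_comp
    have h4 := Set.ncard_le_ncard h2
    rw [Set.ncard_union_eq h3] at h4
    have h5 := Set.le_ncard_sdiff T (S ∪ core G S t)
    rw [Set.ncard_union_eq disjoint_core.symm, hG.ncard_eq S hS, hG.ncard_eq T hT] at h5
    omega
  · exact (hD.lt_ncard_comp hS hj hej).trans_le (Set.ncard_le_ncard (hsub j hj hjt))

/-- A component of `G - S` met by neither `T` nor `T'` lies in both sets. Otherwise there are two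
components, one met by each separator. Then neither belongs to an external clique, and
`internal_two` leaves a vertex of `S` outside `T ∪ T'`. -/
theorem IsProperDominoTree.inter_comp_nonempty (hD : IsProperDominoTree G k)
    (hS : IsMinSeparator G S) (hT : IsMinSeparator G T) (hT' : IsMinSeparator G T') (hne : T ≠ S)
    (hne' : T' ≠ S) (hs : s ∈ S) (hsT : s ∉ T) (ht : t ∈ S) (htT' : t ∉ T') :
    (comp G T s ∩ comp G T' t).Nonempty := by
  have hG := hD.isUniform
  obtain ⟨a, ha, haS⟩ := hG.nonempty_diff hT (hG.ncard_eq S hS) hne.symm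
  obtain ⟨b, hb, hbS⟩ := hG.nonempty_diff hT' (hG.ncard_eq S hS) hne'.symm
  have hTc := hG.isClique hT
  have hTc' := hG.isClique hT'
  by_cases hthird : ∃ z, z ∉ S ∧ z ∉ comp G S a ∧ z ∉ comp G S b
  · obtain ⟨z, hz, hza, hzb⟩ := hthird
    exact ⟨z, hG.comp_subset_comp hS hz hs hsT
      (disjoint_comp_of_isClique hTc ha (mem_comp_self haS) hza) (mem_comp_self hz),
      hG.comp_subset_comp hS hz ht htT'
      (disjoint_comp_of_isClique hTc' hb (mem_comp_self hbS) hzb) (mem_comp_self hz)⟩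
  push Not at hthird
  have hba : b ∉ comp G S a := by
    intro hba
    obtain ⟨z, hz, hza⟩ := exists_notMem_comp hS a
    exact hza (comp_eq hba ▸ hthird z hz hza)
  have hall : ∀ z, z ∉ S → z ∈ comp G S a ∨ z ∈ comp G S b := fun z hz => by
    by_cases hza : z ∈ comp G S a
    · exact Or.inl hza
    · exact Or.inr (hthird z hz hza)
  by_cases hext : (externalFamily G S).Nonempty
  · exfalso
    have key : ∀ {T : Set V} {a : V}, IsMinSeparator G T → T ≠ S → a ∈ T → a ∉ S →
        ¬ IsExternalClique G (S ∪ core G S a) := by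
      intro T a hT hne ha haS hea
      refine hne ((Set.ncard_le_one (Set.toFinite _)).1 hea.2 _ ⟨hT, fun z hz => ?_⟩ _
        ⟨hS, Set.subset_union_left⟩)
      by_cases hzS : z ∈ S
      · exact Or.inl hzS
      rw [← hG.comp_eq_core hS hea]
      by_cases haz : a = z
      · exact Or.inr (haz ▸ mem_comp_self haS)
      · exact Or.inr (mem_comp_of_adj (mem_comp_self haS) hzS (hG.isClique hT ha hz haz))
    obtain ⟨K, hK, hSK⟩ := hext
    obtain ⟨z, hz, _, rfl⟩ := hG.exists_eq_union_core hS hK.1 hSK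
    rcases hall z hz with hza | hzb
    · rw [core_eq hza] at hK
      exact key hT hne ha haS hK
    · rw [core_eq hzb] at hK
      exact key hT' hne' hb hbS hK
  · have h := hD.internal_two S ⟨hS, Set.not_nonempty_iff_eq_empty.1 hext⟩
      ((cdeg_eq_two_iff haS hbS hba).2 hall) T T' hT hT' hne hne' (by
        rintro rfl
        refine hba (mem_comp_of_adj (mem_comp_self haS) hbS (hTc ha hb ?_))
        rintro rfl
        exact hba (mem_comp_self haS))
    obtain ⟨z, hz, hzT⟩ := Set.not_subset.1 h
    exact ⟨z, diff_subset_comp (hG.isClique hS) hs hsT ⟨hz, fun h => hzT (Or.inl h)⟩,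
      diff_subset_comp (hG.isClique hS) ht htT' ⟨hz, fun h => hzT (Or.inr h)⟩⟩

theorem IsProperDominoTree.lt_sbn_sup_edge (hD : IsProperDominoTree G k) (hxy : x ≠ y)
    (hadj : ¬ G.Adj x y) : k < sbn (G ⊔ SimpleGraph.edge x y) := by
  obtain ⟨S, hmin⟩ := exists_minimal_isSeparator_of_not_adj hxy hadj
  have hS : IsMinSeparator G S := ⟨x, y, hmin⟩
  have hsep := isSeparator_iff.1 hmin.1
  exact hD.isUniform.lt_sbn_sup_edge hS hsep.1 hsep.2.1 hsep.2.2
    (hD.lt_ncard_comp_add hS hsep.1 hsep.2.1 hsep.2.2)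
    (fun T hT hne s hs hsT => hD.lt_ncard_comp_of_ne hS hT hne hs hsT)
    (fun T T' hT hT' hne hne' s hs hsT s' hs' hsT' =>
      hD.inter_comp_nonempty hS hT hT' hne hne' hs hsT hs' hsT')

/-- Domino-trees in the class are edge-maximal. -/
theorem IsDominoTree.isEdgeMaximal (hD : IsDominoTree G k) (hG : sbn G ≤ k) :
    IsEdgeMaximal G k := by
  refine ⟨hG, fun x y hxy hadj => ?_⟩
  rcases hD with ⟨rfl, _⟩ | hD
  · exact absurd hxy hadj
  · exact hD.lt_sbn_sup_edge hxy hadj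

end DominoTree

/-! ### Edge-maximal graphs are domino-trees -/

section EdgeMaximal

variable {V : Type*} {G H : SimpleGraph V} {A₁ A₂ A D E F R S S' T T' K X : Set V}
  {x y v w s t u z a₁ a₂ : V} {k : ℕ}

/-- Connectedness is preserved if all edges that are lost lie in a connected set that is added. -/
theorem IsConnectedSet.union_of_adj_or (hE : IsConnectedSet H E) (hD : IsConnectedSet G D)
    (hx : x ∈ E) (hxD : x ∈ D)
    (h : ∀ u ∈ E, ∀ w ∈ E, H.Adj u w → G.Adj u w ∨ (u ∈ D ∧ w ∈ D)) :
    IsConnectedSet G (E ∪ D) := by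
  refine isConnectedSet_of (x := x) (Or.inl hx) fun J _ hxJ hJ => ?_
  have hDJ : D ⊆ J := hD.subset_of_closed hxD hxJ fun u _ hu w hw huw => hJ u hu w (Or.inr hw) huw
  refine Set.union_subset (hE.subset_of_closed hx hxJ fun u hu huJ w hw huw => ?_) hDJ
  rcases h u hu w hw huw with h | h
  · exact hJ u huJ w (Or.inl hw) h
  · exact hDJ h.2

theorem IsConnectedSet.of_adj (hE : IsConnectedSet H E)
    (h : ∀ u ∈ E, ∀ w ∈ E, H.Adj u w → G.Adj u w) : IsConnectedSet G E := by
  obtain ⟨x, hx⟩ := hE.nonempty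
  exact isConnectedSet_of hx fun J _ hxJ hJ =>
    hE.subset_of_closed hx hxJ fun u hu huJ w hw huw => hJ u huJ w hw (h u hu w hw huw)

/-- The connected sets that contain a member of a strict bramble of a supergraph. -/
theorem isStrictBramble_upper {B : Set (Set V)} (hB : IsStrictBramble H B) :
    IsStrictBramble G {E | IsConnectedSet G E ∧ ∃ E' ∈ B, E' ⊆ E} := by
  refine ⟨fun E hE => hE.1, ?_⟩
  rintro E ⟨_, E₁, h₁, hE₁⟩ F ⟨_, F₁, h₂, hF₁⟩
  exact (hB.2 E₁ h₁ F₁ h₂).mono (Set.inter_subset_inter hE₁ hF₁)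

/-- Take a bramble of large order after the edge is added and close it upwards in `G`. A cover `X`
of at most `k` vertices misses some original member. Unless `X` separates `x` and `y`, that member
can be reconnected in `G` through the component of `x` in `G - X`, still missing `X`. -/
theorem exists_isSeparator_of_lt_sbn_sup_edge (hG : sbn G ≤ k)
    (hxy : k < sbn (G ⊔ SimpleGraph.edge x y)) :
    ∃ X : Set V, X.ncard ≤ k ∧ IsSeparator G x y X := by
  by_contra! hcon
  obtain ⟨B, hB, hcov⟩ := lt_sbn_iff.1 hxy
  obtain ⟨X, hX, hXk⟩ := sbn_le_iff.1 hG _ (isStrictBramble_upper (G := G) hB)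
  obtain ⟨E, hE, hEX⟩ := exists_disjoint_of_not_covers (hcov X hXk)
  have hnot : ∀ F, IsConnectedSet G F → E ⊆ F → ¬ Disjoint F X := by
    intro F hF hEF hd
    exact Set.not_disjoint_iff_nonempty_inter.2 (hX F ⟨hF, E, hE, hEF⟩) hd
  have hadj : ∀ u w, (G ⊔ SimpleGraph.edge x y).Adj u w →
      G.Adj u w ∨ (u = x ∧ w = y) ∨ (u = y ∧ w = x) := by
    intro u w h
    rw [SimpleGraph.sup_adj, SimpleGraph.edge_adj] at h
    tauto
  by_cases h : x ∈ E ∧ y ∈ E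
  · have hx : x ∉ X := Set.disjoint_left.1 hEX h.1
    have hy : y ∉ X := Set.disjoint_left.1 hEX h.2
    have hyx : y ∈ comp G X x := by
      by_contra hyx
      exact hcon X hXk (isSeparator_iff.2 ⟨hx, hy, hyx⟩)
    refine hnot (E ∪ comp G X x) ((hB.1 E hE).union_of_adj_or (isConnectedSet_comp hx) h.1
      (mem_comp_self hx) ?_) Set.subset_union_left
      (Set.disjoint_union_left.2 ⟨hEX, disjoint_comp _ _ _⟩)
    intro u _ w _ huw
    rcases hadj u w huw with h | ⟨rfl, rfl⟩ | ⟨rfl, rfl⟩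
    · exact Or.inl h
    · exact Or.inr ⟨mem_comp_self hx, hyx⟩
    · exact Or.inr ⟨hyx, mem_comp_self hx⟩
  · refine hnot E ((hB.1 E hE).of_adj ?_) subset_rfl hEX
    intro u hu w hw huw
    rcases hadj u w huw with h' | ⟨rfl, rfl⟩ | ⟨rfl, rfl⟩
    · exact h'
    · exact absurd ⟨hu, hw⟩ h
    · exact absurd ⟨hw, hu⟩ h

/-- The graph obtained by making two vertex sets complete to each other. -/
def addJoin (G : SimpleGraph V) (A₁ A₂ : Set V) : SimpleGraph V :=
  G ⊔ SimpleGraph.fromRel fun u v => u ∈ A₁ ∧ v ∈ A₂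

theorem addJoin_adj (h : (addJoin G A₁ A₂).Adj u w) :
    G.Adj u w ∨ (u ∈ A₁ ∧ w ∈ A₂) ∨ (w ∈ A₁ ∧ u ∈ A₂) := by
  rw [addJoin, SimpleGraph.sup_adj, SimpleGraph.fromRel_adj] at h
  tauto

variable [Finite V]

/-- If two sets complete to the `k`-set `S` are joined in an edge-maximal graph, then a strict
bramble of large order arises whose members that avoid `S` meet both sets. -/
theorem IsEdgeMaximal.exists_bramble (hG : IsEdgeMaximal G k) (hS : S.ncard = k)
    (h₁ : ∀ s ∈ S, ∀ a ∈ A₁, G.Adj s a) (h₂ : ∀ s ∈ S, ∀ a ∈ A₂, G.Adj s a)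
    (ha₁ : a₁ ∈ A₁) (ha₂ : a₂ ∈ A₂) (hne : a₁ ≠ a₂) (hadj : ¬ G.Adj a₁ a₂) :
    ∃ B, IsStrictBramble (addJoin G A₁ A₂) B ∧ (∀ X : Set V, X.ncard ≤ k → ∃ E ∈ B, Disjoint E X) ∧
      ∀ E ∈ B, Disjoint E S → (E ∩ A₁).Nonempty ∧ (E ∩ A₂).Nonempty := by
  have hlt : k < sbn (addJoin G A₁ A₂) := by
    refine (hG.2 a₁ a₂ hne hadj).trans_le (sbn_mono (sup_le le_sup_left ?_))
    refine (SimpleGraph.edge_le_iff _).2 (Or.inr (Or.inr ?_))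
    rw [SimpleGraph.fromRel_adj]
    exact ⟨hne, Or.inl ⟨ha₁, ha₂⟩⟩
  obtain ⟨B, hB, hcov⟩ := lt_sbn_iff.1 hlt
  have hcov' : ∀ X : Set V, X.ncard ≤ k → ∃ E ∈ B, Disjoint E X := fun X hX =>
    exists_disjoint_of_not_covers (hcov X hX)
  refine ⟨B, hB, hcov', ?_⟩
  by_contra! hcon
  obtain ⟨E₀, hE₀, hE₀S, hE₀A⟩ := hcon
  have hE₀c : IsConnectedSet G E₀ := by
    refine (hB.1 E₀ hE₀).of_adj fun u hu w hw huw => ?_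
    have hneg : ¬ ((E₀ ∩ A₁).Nonempty ∧ (E₀ ∩ A₂).Nonempty) := fun h =>
      Set.nonempty_iff_ne_empty.1 h.2 (hE₀A h.1)
    rcases addJoin_adj huw with h | h | h
    · exact h
    · exact absurd ⟨⟨u, hu, h.1⟩, ⟨w, hw, h.2⟩⟩ hneg
    · exact absurd ⟨⟨w, hw, h.1⟩, ⟨u, hu, h.2⟩⟩ hneg
  obtain ⟨X, hX, hXk⟩ := sbn_le_iff.1 hG.1 _ (isStrictBramble_upper (G := G) hB)
  have hnot : ∀ E ∈ B, ∀ F, IsConnectedSet G F → E ⊆ F → ¬ Disjoint F X := by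
    intro E hE F hF hEF hd
    exact Set.not_disjoint_iff_nonempty_inter.2 (hX F ⟨hF, E, hE, hEF⟩) hd
  -- If `X = S`, then `E₀` is a connected set missed by the cover. Otherwise a vertex of `S \ X`,
  -- being complete to `A₁ ∪ A₂`, replaces the added edges inside a member that avoids `X`.
  by_cases hSX : S ⊆ X
  · have := Set.eq_of_subset_of_ncard_le hSX (by rw [hS]; exact hXk)
    subst this
    exact hnot E₀ hE₀ E₀ hE₀c subset_rfl hE₀S
  obtain ⟨s, hs, hsX⟩ := Set.not_subset.1 hSX
  obtain ⟨E, hE, hEX⟩ := hcov' X hXk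
  have hsA : ∀ a ∈ A₁ ∪ A₂, G.Adj s a := fun a ha => ha.elim (h₁ s hs a) (h₂ s hs a)
  by_cases hEA : (E ∩ (A₁ ∪ A₂)).Nonempty
  · obtain ⟨a, haE, haA⟩ := hEA
    have hD : IsConnectedSet G ({s} ∪ E ∩ (A₁ ∪ A₂)) :=
      (isConnectedSet_singleton G s).union_of_forall_adj fun y hy _ => ⟨s, rfl, hsA y hy.2⟩
    refine hnot E hE (E ∪ ({s} ∪ E ∩ (A₁ ∪ A₂))) ((hB.1 E hE).union_of_adj_or hD haE
      (Or.inr ⟨haE, haA⟩) ?_) Set.subset_union_left ?_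
    · intro u hu w hw huw
      rcases addJoin_adj huw with h | h | h
      · exact Or.inl h
      · exact Or.inr ⟨Or.inr ⟨hu, Or.inl h.1⟩, Or.inr ⟨hw, Or.inr h.2⟩⟩
      · exact Or.inr ⟨Or.inr ⟨hu, Or.inr h.2⟩, Or.inr ⟨hw, Or.inl h.1⟩⟩
    · rw [Set.disjoint_union_left, Set.disjoint_union_left, Set.disjoint_singleton_left]
      exact ⟨hEX, hsX, hEX.mono_left Set.inter_subset_left⟩
  · refine hnot E hE E ((hB.1 E hE).of_adj fun u hu w hw huw => ?_) subset_rfl hEX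
    rcases addJoin_adj huw with h | h | h
    · exact h
    · exact absurd ⟨u, hu, Or.inl h.1⟩ hEA
    · exact absurd ⟨u, hu, Or.inr h.2⟩ hEA

omit [Finite V] in
theorem IsKConnectedOn.le_ncard_minSeparator (h : IsKConnectedOn G k Set.univ)
    (hS : IsMinSeparator G S) : k ≤ S.ncard := by
  by_contra! hlt
  obtain ⟨x, y, hmin⟩ := hS
  have hsep := isSeparator_iff.1 hmin.1
  exact hsep.2.2 ((h S hlt).subset_comp Set.disjoint_sdiff_left ⟨trivial, hsep.1⟩
    ⟨trivial, hsep.2.1⟩)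

theorem IsKConnectedOn.isUniform (h : IsKConnectedOn G k Set.univ) (hc : IsChordal G)
    (hsep : ∀ x y, x ≠ y → ¬ G.Adj x y → ∃ X : Set V, X.ncard ≤ k ∧ IsSeparator G x y X) :
    IsUniform G k :=
  ⟨hc, fun _ hS => le_antisymm (ncard_minSeparator_le hc hsep hS) (h.le_ncard_minSeparator hS)⟩

namespace IsEdgeMaximal

/-- Size at least `k` comes from the connectivity of the completion, size at most `k` from the
separators that edge-maximality provides. -/
theorem isUniform (hG : IsEdgeMaximal G k) (hk : k ≤ Nat.card V) : IsUniform G k := by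
  obtain ⟨R, hR⟩ := hG.exists_CDec hk
  exact hR.isKConnectedOn.isUniform hR.isChordal fun x y hxy hadj =>
    exists_isSeparator_of_lt_sbn_sup_edge hG.1 (hG.2 x y hxy hadj)

/-- In a clique of more than `2 * k` vertices the sets `K \ X`, for `X` of size `k`, intersect
pairwise and form a haven. -/
theorem ncard_le_of_isClique (hG : sbn G ≤ k) (hK : G.IsClique K) : K.ncard ≤ 2 * k := by
  by_contra! hlt
  have hz : ∀ X Y : Set V, X.ncard = k → Y.ncard = k → ∃ z ∈ K, z ∉ X ∪ Y := by
    intro X Y hX hY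
    refine exists_mem_notMem_of_ncard_lt (lt_of_le_of_lt (Set.ncard_union_le X Y) ?_)
    omega
  refine absurd hG (not_le.2 (lt_sbn_of_haven ?_ (fun X => K \ X) ?_ ?_ ?_))
  · have := Set.ncard_le_card K
    omega
  · intro X hX
    obtain ⟨z, hz, hzX⟩ := hz X X hX hX
    exact isConnectedSet_of_isClique (hK.subset Set.sdiff_subset)
      ⟨z, hz, fun h => hzX (Or.inl h)⟩
  · exact fun X _ => Set.disjoint_sdiff_left
  · intro X Y hX hY
    obtain ⟨z, hz, hzX⟩ := hz X Y hX hY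
    exact ⟨z, ⟨hz, fun h => hzX (Or.inl h)⟩, ⟨hz, fun h => hzX (Or.inr h)⟩⟩

/-- The clique lies in two bags joined to a clique and so equals their union; a separating `k`-set
inside must be one of these bags. -/
theorem exists_eq_union (hG : IsEdgeMaximal G k) (hk : k < Nat.card V) (hK : IsMaxClique G K) :
    ∃ R₁ R₂, K = R₁ ∪ R₂ ∧ ∀ T, IsMinSeparator G T → T ⊆ K → T = R₁ ∨ T = R₂ := by
  have hU := hG.isUniform hk.le
  obtain ⟨R, hR⟩ := hG.exists_CDec hk.le
  rcases hR.exists_split hK.1 (Set.subset_univ K) with h | ⟨U₁, R₁, U₂, R₂, hs, hKs, _⟩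
  · have := hR.root_ncard
    rw [← h, Set.ncard_univ] at this
    omega
  · refine ⟨R₁, R₂, hKs.antisymm (hK.2 hs.clique hKs), fun T hT hTK => ?_⟩
    refine hs.eq_or_eq (hU.ncard_eq T hT) (hTK.trans hKs) fun hc => ?_
    obtain ⟨x, y, hmin⟩ := hT
    have hsep := isSeparator_iff.1 hmin.1
    exact hsep.2.2 (hc.subset_comp Set.disjoint_sdiff_left ⟨trivial, hsep.1⟩
      ⟨trivial, hsep.2.1⟩)

/-- A maximal clique with two minimal separators is their union and contains no others. -/
theorem eq_union_of_ne (hG : IsEdgeMaximal G k) (hk : k < Nat.card V) (hK : IsMaxClique G K)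
    (hS : IsMinSeparator G S) (hSK : S ⊆ K) (hS' : IsMinSeparator G S') (hSK' : S' ⊆ K)
    (hne : S ≠ S') : K = S ∪ S' ∧ ∀ T, IsMinSeparator G T → T ⊆ K → T = S ∨ T = S' := by
  obtain ⟨R₁, R₂, hKR, hR⟩ := hG.exists_eq_union hk hK
  rcases hR S hS hSK with rfl | rfl <;> rcases hR S' hS' hSK' with rfl | rfl
  · exact absurd rfl hne
  · exact ⟨hKR, hR⟩
  · exact ⟨hKR.trans (Set.union_comm _ _), fun T hT hTK => (hR T hT hTK).symm⟩
  · exact absurd rfl hne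

/-- The component of `z` outside the clique is attached along a minimal separator inside the clique.
This is not `S`, hence it is `S'`. So the vertices of `S \ S'` have no neighbours in the component
beyond the core. -/
theorem mem_of_adj (hG : IsEdgeMaximal G k) (hk : k < Nat.card V) (hS : IsMinSeparator G S)
    (hS' : IsMinSeparator G S') (hSK' : S' ⊆ S ∪ core G S v) (hne : S' ≠ S)
    (hz : z ∈ comp G S v) (hzc : z ∉ core G S v) (hu : u ∈ S) (huz : G.Adj u z) : u ∈ S' := by
  have hU := hG.isUniform hk.le
  have hK := hU.isMaxClique_union_core hS (notMem_of_mem_comp' hz)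
  have hzK : z ∉ S ∪ core G S v := fun h => h.elim (notMem_of_mem_comp hz) hzc
  have h := (hG.eq_union_of_ne hk hK hS Set.subset_union_left hS' hSK' hne.symm).2 _
    (hU.attachment_spec hK hzK).1 (fun z hz => hz.1)
  rw [← h.resolve_left (hU.attachment_ne hS hz hzc)]
  exact ⟨Or.inl hu, z, mem_comp_self hzK, huz.symm⟩

omit [Finite V] in
theorem core_subset (hKS : S ∪ core G S v = S ∪ S') : core G S v ⊆ S' := fun _ ha =>
  ((hKS ▸ Or.inr ha : _ ∈ S ∪ S')).resolve_left (Set.disjoint_left.1 disjoint_core ha)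

theorem exists_bramble_core (hG : IsEdgeMaximal G k) (hk : k ≤ Nat.card V)
    (hS : IsMinSeparator G S) (hv : v ∉ S) (hw : w ∉ S) (hvw : w ∉ comp G S v) :
    ∃ B, IsStrictBramble (addJoin G (core G S v) (core G S w)) B ∧
      (∀ X : Set V, X.ncard ≤ k → ∃ E ∈ B, Disjoint E X) ∧
      ∀ E ∈ B, Disjoint E S → (E ∩ core G S v).Nonempty ∧ (E ∩ core G S w).Nonempty := by
  have hU := hG.isUniform hk
  obtain ⟨a, ha⟩ := hU.core_nonempty hS hv
  obtain ⟨b, hb⟩ := hU.core_nonempty hS hw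
  have hba : b ∉ comp G S v := Set.disjoint_right.1 (comp_disjoint hvw) hb.1
  refine hG.exists_bramble (hU.ncard_eq S hS) (fun s hs a ha => (ha.2 s hs).symm)
    (fun s hs a ha => (ha.2 s hs).symm) ha hb (fun h => hba (h ▸ ha.1))
    (fun h => hba (mem_comp_of_adj ha.1 (notMem_of_mem_comp hb.1) h))

/-- If the two cores had at most `k` vertices together, some member would avoid both; but a member
that avoids `S` is confined to them. -/
theorem lt_ncard_core_add_of_comp_eq (hG : IsEdgeMaximal G k) (hk : k ≤ Nat.card V)
    (hS : IsMinSeparator G S) (hv : v ∉ S) (hw : w ∉ S) (hvw : w ∉ comp G S v)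
    (hcv : comp G S v = core G S v) (hcw : comp G S w = core G S w) :
    k < (core G S v).ncard + (core G S w).ncard := by
  by_contra! hle
  obtain ⟨B, hB, hcov, hmeet⟩ := hG.exists_bramble_core hk hS hv hw hvw
  obtain ⟨E, hE, hES⟩ := hcov S (hG.isUniform hk |>.ncard_eq S hS).le
  obtain ⟨F, hF, hFA⟩ := hcov (core G S v ∪ core G S w) ((Set.ncard_union_le _ _).trans hle)
  obtain ⟨⟨z, hzE, hz⟩, _⟩ := hmeet E hE hES
  have hsub := (hB.1 E hE).subset_of_closed (J := core G S v ∪ core G S w) hzE (Or.inl hz) (by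
    intro u _ hu x hx hux
    have hxS : x ∉ S := Set.disjoint_left.1 hES hx
    rcases addJoin_adj hux with h | h | h
    · rcases hu with hu | hu
      · exact Or.inl (hcv ▸ mem_comp_of_adj hu.1 hxS h)
      · exact Or.inr (hcw ▸ mem_comp_of_adj hu.1 hxS h)
    · exact Or.inr h.2
    · exact Or.inl h.1)
  obtain ⟨y, hyE, hyF⟩ := hB.2 E hE F hF
  exact Set.disjoint_left.1 hFA hyF (hsub hyE)

theorem external_family (hG : IsEdgeMaximal G k) (hk : k ≤ Nat.card V) (hS : IsMinSeparator G S)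
    {K K' : Set V} (hK : K ∈ externalFamily G S) (hK' : K' ∈ externalFamily G S) (hne : K ≠ K') :
    k < valiancy S K + valiancy S K' := by
  have hU := hG.isUniform hk
  obtain ⟨hKe, hSK⟩ := hK
  obtain ⟨hKe', hSK'⟩ := hK'
  obtain ⟨v, hv, _, rfl⟩ := hU.exists_eq_union_core hS hKe.1 hSK
  obtain ⟨w, hw, _, rfl⟩ := hU.exists_eq_union_core hS hKe'.1 hSK'
  have hvw : w ∉ comp G S v := fun h => hne (by rw [core_eq h])
  rw [valiancy, valiancy, union_core_sdiff, union_core_sdiff]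
  exact hG.lt_ncard_core_add_of_comp_eq hk hS hv hw hvw (hU.comp_eq_core hS hKe)
    (hU.comp_eq_core hS hKe')

/-- The new case is a second component whose clique contains another separator `S'`. If the cores
were small, a member avoiding `S'` would be confined to `(core G S v ∪ S) \ S'`, a set that some
other member avoids. -/
theorem external_two (hG : IsEdgeMaximal G k) (hk : k < Nat.card V)
    (hS : IsExternalSeparator G S) (hd : cdeg G S = 2) :
    2 * k < (⋃₀ {K | IsMaxClique G K ∧ S ⊆ K}).ncard := by
  have hU := hG.isUniform hk.le
  obtain ⟨hS, K, hKe, hSK⟩ := hS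
  obtain ⟨v, hv, _, rfl⟩ := hU.exists_eq_union_core hS hKe.1 hSK
  obtain ⟨w, hw, hvw⟩ := exists_notMem_comp hS v
  have hall := (cdeg_eq_two_iff hv hw hvw).1 hd
  have hSk := hU.ncard_eq S hS
  have hcv := hU.comp_eq_core hS hKe
  have hKw := hU.isMaxClique_union_core hS hw
  have hdis : Disjoint (core G S v) (core G S w) :=
    (comp_disjoint hvw).mono core_subset_comp core_subset_comp
  suffices h : k < (core G S v).ncard + (core G S w).ncard by
    have hsub : S ∪ (core G S v ∪ core G S w) ⊆ ⋃₀ {K | IsMaxClique G K ∧ S ⊆ K} := by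
      rintro z (hz | hz | hz)
      · exact ⟨_, ⟨hKw, Set.subset_union_left⟩, Or.inl hz⟩
      · exact ⟨_, ⟨hKe.1, Set.subset_union_left⟩, Or.inr hz⟩
      · exact ⟨_, ⟨hKw, Set.subset_union_left⟩, Or.inr hz⟩
    have h1 := Set.ncard_le_ncard hsub
    rw [Set.ncard_union_eq (Set.disjoint_union_right.2 ⟨disjoint_core.symm, disjoint_core.symm⟩),
      Set.ncard_union_eq hdis] at h1
    omega
  by_cases hew : IsExternalClique G (S ∪ core G S w)
  · exact hG.lt_ncard_core_add_of_comp_eq hk.le hS hv hw hvw hcv (hU.comp_eq_core hS hew)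
  obtain ⟨S', hS', hSK', hne⟩ := exists_minSeparator_of_not_external hKw hew S
  have hKeq := (hG.eq_union_of_ne hk hKw hS Set.subset_union_left hS' hSK' hne.symm).1
  have hcS' := core_subset hKeq
  by_contra! hle
  obtain ⟨B, hB, hcov, hmeet⟩ := hG.exists_bramble_core hk.le hS hv hw hvw
  obtain ⟨E, hE, hES⟩ := hcov S' (hU.ncard_eq S' hS').le
  -- The size is at most `k` because `S \ S'` has as many vertices as `S' \ S`, which is the core of
  -- `w`.
  obtain ⟨F, hF, hFL⟩ := hcov ((core G S v ∪ S) \ S') (by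
    have h1 : (core G S w) = S' \ S := by
      rw [← union_core_sdiff (G := G) (S := S) (v := w), hKeq, Set.union_sdiff_left]
    have h2 := Set.ncard_inter_add_ncard_sdiff_eq_ncard S S'
    have h3 := Set.ncard_inter_add_ncard_sdiff_eq_ncard S' S
    have h4 : ((core G S v ∪ S) \ S').ncard ≤ (core G S v).ncard + (S \ S').ncard := by
      rw [Set.union_sdiff_distrib]
      exact (Set.ncard_union_le _ _).trans (add_le_add_left (Set.ncard_le_ncard Set.sdiff_subset) _)
    rw [Set.inter_comm, hU.ncard_eq S' hS'] at h3
    rw [h1] at hle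
    omega)
  have hEw : ∀ z ∈ E, z ∉ core G S w := fun z hz hzc => Set.disjoint_left.1 hES hz (hcS' hzc)
  obtain ⟨s, hsE, hs⟩ : (E ∩ S).Nonempty := by
    by_contra hcon
    obtain ⟨z, hz, hzc⟩ := (hmeet E hE (Set.disjoint_iff_inter_eq_empty.2
      (Set.not_nonempty_iff_eq_empty.1 hcon))).2
    exact hEw z hz hzc
  have hsub := (hB.1 E hE).subset_of_closed (J := core G S v ∪ S) hsE (Or.inr hs) (by
    intro u huE hu x hx hux
    rcases addJoin_adj hux with h | h | h
    · by_cases hxS : x ∈ S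
      · exact Or.inr hxS
      rcases hu with hu | hu
      · exact Or.inl (hcv ▸ mem_comp_of_adj hu.1 hxS h)
      · rcases hall x hxS with hxv | hxw
        · exact Or.inl (hcv ▸ hxv)
        · exact absurd (hG.mem_of_adj hk hS hS' hSK' hne hxw (hEw x hx) hu h)
            (Set.disjoint_left.1 hES huE)
    · exact absurd h.2 (hEw x hx)
    · exact Or.inl h.1)
  obtain ⟨y, hyE, hyF⟩ := hB.2 E hE F hF
  exact Set.disjoint_left.1 hFL hyF ⟨hsub hyE, Set.disjoint_left.1 hES hyE⟩

/-- If `T` lies in the clique, it is `S'`. Otherwise `T` has a vertex beyond the core, adjacent to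
every vertex of `T ∩ S`. -/
theorem inter_subset (hG : IsEdgeMaximal G k) (hk : k < Nat.card V) (hS : IsMinSeparator G S)
    (hS' : IsMinSeparator G S') (hSK' : S' ⊆ S ∪ core G S v) (hne : S' ≠ S)
    (hT : IsMinSeparator G T) (hTS : T ≠ S) (ht : t ∈ T) (htv : t ∈ comp G S v) :
    T ∩ S ⊆ S' := by
  have hU := hG.isUniform hk.le
  have hK := hU.isMaxClique_union_core hS (notMem_of_mem_comp' htv)
  rintro s ⟨hsT, hs⟩
  by_cases hTK : T ⊆ S ∪ core G S v
  · have := (hG.eq_union_of_ne hk hK hS Set.subset_union_left hS' hSK' hne.symm).2 T hT hTK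
    exact this.resolve_left hTS ▸ hsT
  · obtain ⟨z, hz, hzK⟩ := Set.not_subset.1 hTK
    have hzS : z ∉ S := fun h => hzK (Or.inl h)
    have hzv : z ∈ comp G S v := by
      by_cases htz : t = z
      · exact htz ▸ htv
      · exact mem_comp_of_adj htv hzS (hU.isClique hT ht hz htz)
    exact hG.mem_of_adj hk hS hS' hSK' hne hzv (fun h => hzK (Or.inr h)) hs
      (hU.isClique hT hsT hz fun h => hzS (h ▸ hs))

/-- If `T` and `T'` leave `S` into the same component, both traces on `S` lie in one other separator
`S₁`, which cannot contain `S`. If they use different components, with further separators `S₁` and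
`S₂`, a member avoiding `S₁` cannot enter the first component and one avoiding `S₂` cannot enter the
second. They would meet in `S`, which is covered by `S₁ ∪ S₂`. -/
theorem internal_two (hG : IsEdgeMaximal G k) (hk : k < Nat.card V)
    (hS : IsInternalSeparator G S) (hd : cdeg G S = 2) (hT : IsMinSeparator G T)
    (hT' : IsMinSeparator G T') (hTS : T ≠ S) (hTS' : T' ≠ S) : ¬ S ⊆ T ∪ T' := by
  intro hST
  have hU := hG.isUniform hk.le
  obtain ⟨hS, hint⟩ := hS
  have hext : ∀ v, v ∉ S → ∃ S', IsMinSeparator G S' ∧ S' ⊆ S ∪ core G S v ∧ S' ≠ S := by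
    intro v hv
    refine exists_minSeparator_of_not_external (hU.isMaxClique_union_core hS hv) (fun h => ?_) S
    have : S ∪ core G S v ∈ externalFamily G S := ⟨h, Set.subset_union_left⟩
    rw [hint] at this
    exact this
  obtain ⟨v, hvT, hv⟩ := hU.nonempty_diff hT (hU.ncard_eq S hS) hTS.symm
  obtain ⟨w, hwT', hw⟩ := hU.nonempty_diff hT' (hU.ncard_eq S hS) hTS'.symm
  obtain ⟨S₁, hS₁, hSK₁, hne₁⟩ := hext v hv
  have h1 := hG.inter_subset hk hS hS₁ hSK₁ hne₁ hT hTS hvT (mem_comp_self hv)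
  by_cases hvw : w ∈ comp G S v
  · have h2 := hG.inter_subset hk hS hS₁ hSK₁ hne₁ hT' hTS' hwT' hvw
    obtain ⟨s, hs, hs₁⟩ := hU.nonempty_diff hS (hU.ncard_eq S₁ hS₁) hne₁
    exact hs₁ ((hST hs).elim (fun h => h1 ⟨h, hs⟩) fun h => h2 ⟨h, hs⟩)
  obtain ⟨S₂, hS₂, hSK₂, hne₂⟩ := hext w hw
  have h2 := hG.inter_subset hk hS hS₂ hSK₂ hne₂ hT' hTS' hwT' (mem_comp_self hw)
  have hall := (cdeg_eq_two_iff hv hw hvw).1 hd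
  have hK₁ := (hG.eq_union_of_ne hk (hU.isMaxClique_union_core hS hv) hS Set.subset_union_left hS₁
    hSK₁ hne₁.symm).1
  have hK₂ := (hG.eq_union_of_ne hk (hU.isMaxClique_union_core hS hw) hS Set.subset_union_left hS₂
    hSK₂ hne₂.symm).1
  obtain ⟨B, hB, hcov, hmeet⟩ := hG.exists_bramble_core hk.le hS hv hw hvw
  obtain ⟨E, hE, hE₁⟩ := hcov S₁ (hU.ncard_eq S₁ hS₁).le
  obtain ⟨F, hF, hF₂⟩ := hcov S₂ (hU.ncard_eq S₂ hS₂).le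
  have hEv : ∀ z ∈ E, z ∉ core G S v := fun z hz hzc =>
    Set.disjoint_left.1 hE₁ hz (core_subset hK₁ hzc)
  have hFw : ∀ z ∈ F, z ∉ core G S w := fun z hz hzc =>
    Set.disjoint_left.1 hF₂ hz (core_subset hK₂ hzc)
  obtain ⟨s, hsE, hs⟩ : (E ∩ S).Nonempty := by
    by_contra hcon
    obtain ⟨z, hz, hzc⟩ := (hmeet E hE (Set.disjoint_iff_inter_eq_empty.2
      (Set.not_nonempty_iff_eq_empty.1 hcon))).1
    exact hEv z hz hzc
  obtain ⟨t, htF, ht⟩ : (F ∩ S).Nonempty := by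
    by_contra hcon
    obtain ⟨z, hz, hzc⟩ := (hmeet F hF (Set.disjoint_iff_inter_eq_empty.2
      (Set.not_nonempty_iff_eq_empty.1 hcon))).2
    exact hFw z hz hzc
  have hEsub := (hB.1 E hE).subset_of_closed (J := (comp G S v)ᶜ) hsE
    (fun h => notMem_of_mem_comp h hs) (by
    intro u huE hu x hx hux hxv
    rcases addJoin_adj hux with h | h | h
    · have huS : u ∈ S := by
        by_contra huS
        exact hu (mem_comp_of_adj hxv huS h.symm)
      exact Set.disjoint_left.1 hE₁ huE (hG.mem_of_adj hk hS hS₁ hSK₁ hne₁ hxv (hEv x hx) huS h)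
    · exact hu h.1.1
    · exact hEv x hx h.1)
  have hFsub := (hB.1 F hF).subset_of_closed (J := (comp G S w)ᶜ) htF
    (fun h => notMem_of_mem_comp h ht) (by
    intro u huF hu x hx hux hxw
    rcases addJoin_adj hux with h | h | h
    · have huS : u ∈ S := by
        by_contra huS
        exact hu (mem_comp_of_adj hxw huS h.symm)
      exact Set.disjoint_left.1 hF₂ huF (hG.mem_of_adj hk hS hS₂ hSK₂ hne₂ hxw (hFw x hx) huS h)
    · exact hFw x hx h.2
    · exact hu h.2.1)
  obtain ⟨z, hzE, hzF⟩ := hB.2 E hE F hF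
  have hzS : z ∈ S := by
    by_contra hzS
    exact (hall z hzS).elim (hEsub hzE) (hFsub hzF)
  rcases hST hzS with h | h
  · exact Set.disjoint_left.1 hE₁ hzE (h1 ⟨h, hzS⟩)
  · exact Set.disjoint_left.1 hF₂ hzF (h2 ⟨h, hzS⟩)

theorem isProperDominoTree (hG : IsEdgeMaximal G k) (hk : k < Nat.card V) :
    IsProperDominoTree G k where
  chordal := (hG.isUniform hk.le).chordal
  separator_size := (hG.isUniform hk.le).ncard_eq
  clique_size := by
    intro K hK
    have hU := hG.isUniform hk.le
    refine ⟨?_, ncard_le_of_isClique hG.1 hK.1⟩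
    by_cases h : ∃ v, v ∉ K
    · obtain ⟨v, hv⟩ := h
      obtain ⟨hN, w, hw, hwN⟩ := hU.attachment_spec hK hv
      rw [← hU.ncard_eq _ hN]
      exact Set.ncard_lt_ncard ⟨fun z hz => hz.1, fun hsub => hwN (hsub hw)⟩
    · push Not at h
      rw [Set.eq_univ_of_forall h, Set.ncard_univ]
      exact hk
  at_most_two := by
    intro K hK
    obtain ⟨R₁, R₂, _, h⟩ := hG.exists_eq_union hk hK
    refine le_trans (Set.ncard_le_ncard (t := {R₁, R₂}) fun T hT => h T hT.1 hT.2) ?_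
    exact (Set.ncard_insert_le _ _).trans (by rw [Set.ncard_singleton])
  eq_union := by
    intro K hK S S' hne heq
    have hS : S ∈ minSeparatorsIn G K := by rw [heq]; simp
    have hS' : S' ∈ minSeparatorsIn G K := by rw [heq]; simp
    exact (hG.eq_union_of_ne hk hK hS.1 hS.2 hS'.1 hS'.2 hne).1
  internal_two := fun S hS hd T T' hT hT' hTS hTS' _ => hG.internal_two hk hS hd hT hT' hTS hTS'
  external_two := fun S hS hd => hG.external_two hk hS hd
  external_family := fun S hS K hK K' hK' hne => hG.external_family hk.le hS.1 hK hK' hne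

/-- Edge-maximal graphs are domino-trees. -/
theorem isDominoTree (hG : IsEdgeMaximal G k) : IsDominoTree G k := by
  rcases lt_or_ge k (Nat.card V) with hk | hk
  · exact Or.inr (hG.isProperDominoTree hk)
  · refine Or.inl ⟨?_, hk⟩
    rw [hG.eq_of_le le_top ((sbn_le_card _).trans hk)]

end IsEdgeMaximal

end EdgeMaximal

/-! ### Counting edges by earlier neighbours -/

section EdgeCount

variable {n k : ℕ}

/-- The number of edges as a sum of the numbers of earlier neighbours. -/
theorem numEdges_eq_sum (G : SimpleGraph (Fin n)) :
    numEdges G = ∑ v, {u | u < v ∧ G.Adj u v}.ncard := by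
  classical
  have h1 : G.edgeSet = (fun p : Fin n × Fin n => s(p.1, p.2)) ''
      (((Finset.univ ×ˢ Finset.univ).filter fun p : Fin n × Fin n => p.1 < p.2 ∧ G.Adj p.1 p.2 :
        Finset (Fin n × Fin n)) : Set (Fin n × Fin n)) := by
    ext e
    induction e using Sym2.ind with
    | _ u v =>
    simp only [SimpleGraph.mem_edgeSet, Set.mem_image, Finset.mem_coe, Finset.mem_filter,
      Prod.exists]
    constructor
    · intro h
      rcases lt_trichotomy u v with huv | rfl | huv
      · exact ⟨u, v, ⟨by simp, huv, h⟩, rfl⟩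
      · exact (h.ne rfl).elim
      · exact ⟨v, u, ⟨by simp, huv, h.symm⟩, Sym2.eq_swap⟩
    · rintro ⟨a, b, ⟨-, -, h⟩, hab⟩
      rcases Sym2.eq_iff.1 hab with ⟨rfl, rfl⟩ | ⟨rfl, rfl⟩
      exacts [h, h.symm]
  rw [numEdges, h1, Set.InjOn.ncard_image, Set.ncard_coe_finset, Finset.card_filter,
    Finset.sum_product_right]
  · refine Finset.sum_congr rfl fun v _ => ?_
    rw [← Finset.card_filter, ← Set.ncard_coe_finset]
    congr 1
    ext u
    simp
  · rintro ⟨a, b⟩ hab ⟨c, d⟩ hcd h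
    simp only [Finset.mem_coe, Finset.mem_filter] at hab hcd
    rcases Sym2.eq_iff.1 h with ⟨h1, h2⟩ | ⟨h1, h2⟩
    · exact Prod.ext h1 h2
    · have e1 : a = d := h1
      have e2 : b = c := h2
      subst e1 e2
      exact absurd hab.2.1 hcd.2.1.asymm

theorem ncard_fin_Ico {a b : ℕ} (hb : b ≤ n) :
    {x : Fin n | a ≤ (x : ℕ) ∧ (x : ℕ) < b}.ncard = b - a := by
  have h := Set.ncard_image_of_injective {x : Fin n | a ≤ (x : ℕ) ∧ (x : ℕ) < b}
    Fin.val_injective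
  rw [← h, ← Nat.card_Ico, ← Set.ncard_coe_finset]
  congr 1
  ext y
  simp only [Set.mem_image, Set.mem_ofPred_eq, Finset.coe_Ico, Set.mem_Ico]
  constructor
  · rintro ⟨x, hx, rfl⟩
    exact hx
  · intro hy
    exact ⟨⟨y, by omega⟩, hy, rfl⟩

end EdgeCount

/-! ### Graphs attaining the bound -/

section Extremal

variable {n k : ℕ}

/-- The graph on `n` vertices in which the first `k` vertices are joined to everything and the
other vertices form disjoint cliques of `k` consecutive vertices, up to the last one. -/
def blockGraph (n k : ℕ) : SimpleGraph (Fin n) where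
  Adj x y := x ≠ y ∧ ((x : ℕ) < k ∨ (y : ℕ) < k ∨ (x : ℕ) / k = (y : ℕ) / k)
  symm := ⟨fun x y h => ⟨h.1.symm, by tauto⟩⟩
  loopless := ⟨fun x h => h.1 rfl⟩

/-- A member that avoids the first `k` vertices lies in one block, so it has at most `k` vertices;
as members intersect, it is itself a cover. -/
theorem sbn_blockGraph_le (hk : 1 ≤ k) (hn : k ≤ n) : sbn (blockGraph n k) ≤ k := by
  rw [sbn_le_iff]
  intro B hB
  by_contra! hcon
  have key : ∀ X : Set (Fin n), X.ncard ≤ k → ∃ A ∈ B, Disjoint A X := fun X hX =>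
    exists_disjoint_of_not_covers fun hc => absurd (hcon X hc) (not_lt.2 hX)
  obtain ⟨E, hE, hES⟩ := key {x | 0 ≤ (x : ℕ) ∧ (x : ℕ) < k} (by rw [ncard_fin_Ico hn]; omega)
  have hEk : ∀ x ∈ E, k ≤ (x : ℕ) := fun x hx => by
    by_contra h
    exact Set.disjoint_left.1 hES hx ⟨Nat.zero_le _, not_le.1 h⟩
  obtain ⟨e, he⟩ := (hB.1 E hE).nonempty
  have hsub : E ⊆ {x | (x : ℕ) / k = (e : ℕ) / k} := by
    refine (hB.1 E hE).subset_of_closed he rfl ?_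
    rintro u hu hue w hw ⟨-, h⟩
    have h1 := hEk u hu
    have h2 := hEk w hw
    have h3 : (u : ℕ) / k = (w : ℕ) / k := by omega
    exact h3.symm.trans hue
  obtain ⟨E', hE', hd⟩ := key E (by
    refine (Set.ncard_le_ncard hsub).trans ?_
    rw [← Set.ncard_image_of_injective _ Fin.val_injective]
    refine (Set.ncard_le_ncard (t := (Finset.Ico ((e : ℕ) / k * k) ((e : ℕ) / k * k + k) :
      Finset ℕ)) ?_).trans (by rw [Set.ncard_coe_finset]; simp)
    rintro _ ⟨x, hx, rfl⟩
    rw [Finset.coe_Ico, Set.mem_Ico, ← show (x : ℕ) / k = (e : ℕ) / k from hx]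
    have := Nat.div_add_mod' (x : ℕ) k
    have := Nat.mod_lt (x : ℕ) hk
    omega)
  exact Set.not_disjoint_iff_nonempty_inter.2 (hB.2 E' hE' E hE) hd

/-- A vertex `x ≥ k` has `k` universal vertices and `x % k` vertices of its own block before it. -/
theorem le_numEdges_blockGraph (hk : 1 ≤ k) (hn : k ≤ n) :
    k.choose 2 + k * (n - k) + blockPairs k (n - k) ≤ numEdges (blockGraph n k) := by
  have h1 : ∀ x : Fin n, (if (x : ℕ) < k then (x : ℕ) else k + (x : ℕ) % k) ≤
      {u | u < x ∧ (blockGraph n k).Adj u x}.ncard := by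
    intro x
    have hx := x.isLt
    split_ifs with h
    · have h2 := ncard_fin_Ico (a := 0) hx.le
      rw [Nat.sub_zero] at h2
      rw [← h2]
      refine Set.ncard_le_ncard fun u hu => ?_
      exact ⟨hu.2, (ne_of_lt hu.2 : u ≠ x), Or.inr (Or.inl h)⟩
    · have h3 := Nat.div_add_mod' (x : ℕ) k
      have h4 : 1 ≤ (x : ℕ) / k := Nat.div_pos (not_lt.1 h) hk
      have h5 : k ≤ (x : ℕ) / k * k := Nat.le_mul_of_pos_left k h4
      have hd : Disjoint {u : Fin n | 0 ≤ (u : ℕ) ∧ (u : ℕ) < k}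
          {u : Fin n | (x : ℕ) / k * k ≤ (u : ℕ) ∧ (u : ℕ) < (x : ℕ)} :=
        Set.disjoint_left.2 fun u hu hu' => absurd hu.2 (not_lt.2 (h5.trans hu'.1))
      have h6 := Set.ncard_union_eq hd
      rw [ncard_fin_Ico hn, ncard_fin_Ico hx.le] at h6
      rw [show k + (x : ℕ) % k = k - 0 + ((x : ℕ) - (x : ℕ) / k * k) by omega, ← h6]
      refine Set.ncard_le_ncard fun u hu => ?_
      rcases hu with hu | hu
      · have : u < x := Fin.lt_def.2 (by have := hu.2; omega)
        exact ⟨this, this.ne, Or.inl hu.2⟩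
      · refine ⟨hu.2, (ne_of_lt hu.2 : u ≠ x), Or.inr (Or.inr ?_)⟩
        exact le_antisymm (Nat.div_le_div_right hu.2.le) ((Nat.le_div_iff_mul_le hk).2 hu.1)
  rw [numEdges_eq_sum]
  refine le_trans ?_ (Finset.sum_le_sum fun x _ => h1 x)
  rw [Fin.sum_univ_eq_sum_range (fun x => if x < k then x else k + x % k) n]
  clear h1
  induction n, hn using Nat.le_induction with
  | base =>
    rw [Finset.sum_congr rfl fun x hx => if_pos (Finset.mem_range.1 hx), Finset.sum_range_id,
      ← Nat.choose_two_right]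
    simp [blockPairs]
  | succ n hn ih =>
    rw [Finset.sum_range_succ, if_neg (not_lt.2 hn)]
    obtain ⟨m, rfl⟩ := Nat.exists_eq_add_of_le hn
    rw [show k + m + 1 - k = m + 1 by omega, mul_add]
    rw [Nat.add_sub_cancel_left] at ih
    rw [Nat.add_mod_left]
    have : blockPairs k (m + 1) = blockPairs k m + m % k := by
      have hm := Nat.mod_lt m hk
      have e1 := Nat.div_add_mod m k
      have e2 : (m % k + 1).choose 2 = m % k + (m % k).choose 2 := by
        rw [Nat.choose_succ_succ' _ 1, Nat.choose_one_right]
      unfold blockPairs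
      rcases (Nat.succ_le_of_lt hm).lt_or_eq with h | h
      · have e3 : (m + 1) / k = m / k := by
          rw [Nat.div_eq_iff (by omega), mul_comm]
          omega
        have e4 : (m + 1) % k = m % k + 1 := by
          have := Nat.div_add_mod (m + 1) k
          rw [e3] at this
          omega
        rw [e3, e4, e2]
        omega
      · have e3 : m + 1 = k * (m / k + 1) := by rw [mul_add]; omega
        have e4 : (m + 1) / k = m / k + 1 := by rw [e3, Nat.mul_div_cancel_left _ hk]
        have e5 : (m + 1) % k = 0 := by rw [e3, Nat.mul_mod_right]
        have e6 : k.choose 2 = m % k + (m % k).choose 2 := by rw [← e2]; congr 1; omega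
        rw [e4, e5, add_mul, one_mul, Nat.choose_zero_succ]
        omega
    omega

/-- There is an edge-maximal graph that attains the bound on the number of edges. -/
theorem blockGraph_spec (hk : 1 ≤ k) (hn : k ≤ n) : IsEdgeMaximal (blockGraph n k) k ∧
    (numEdges (blockGraph n k) : ℚ) = edgeBound n k := by
  have h1 := sbn_blockGraph_le hk hn
  have h2 : k ≤ Nat.card (Fin n) := by simpa using hn
  have h3 := le_numEdges_blockGraph hk hn
  have h4 : edgeBound n k ≤ numEdges (blockGraph n k) := by
    rw [edgeBound_eq hn]
    exact_mod_cast h3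
  refine ⟨isEdgeMaximal_of_edgeBound_le h1 hk h2 (by simpa using h4), le_antisymm ?_ h4⟩
  simpa using numEdges_le_edgeBound h1 hk h2

end Extremal

/-! ### Simplicial vertices and the edge criterion -/

namespace IsUniform

variable {V : Type*} [Finite V] {G : SimpleGraph V} {S T : Set V} {x y z a b : V} {k : ℕ}

/-- A vertex of a minimal separator has neighbours in two different components, and these are not
adjacent. -/
theorem notMem_of_simplicial (hG : IsUniform G k) (hT : IsMinSeparator G T)
    (hz : ∀ u w, G.Adj z u → G.Adj z w → u ≠ w → G.Adj u w) : z ∉ T := by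
  intro hzT
  obtain ⟨x, y, h⟩ := id hT
  obtain ⟨hx, hy, hxy⟩ := isSeparator_iff.1 h.1
  obtain ⟨u, hu, huz⟩ := hG.exists_adj hT hx hzT
  obtain ⟨w, hw, hwz⟩ := hG.exists_adj hT hy hzT
  have hwx : w ∉ comp G T x := Set.disjoint_right.1 (comp_disjoint hxy) hw
  exact hwx (mem_comp_of_adj hu (notMem_of_mem_comp hw)
    (hz u w huz.symm hwz.symm fun h => hwx (h ▸ hu)))

/-- The criterion `lt_sbn_sup_edge` in the case that two components of `G - S` are large and some
simplicial vertex is complete to `S`. -/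
theorem lt_sbn_sup_edge_of_simplicial (hG : IsUniform G k) (hS : IsMinSeparator G S) (hx : x ∉ S)
    (hy : y ∉ S) (hxy : y ∉ comp G S x) (h1 : k < (comp G S x).ncard + (comp G S y).ncard)
    (ha : a ∉ S) (hb : b ∉ S) (hab : b ∉ comp G S a) (hka : k ≤ (comp G S a).ncard)
    (hkb : k ≤ (comp G S b).ncard) (hzS : ∀ s ∈ S, G.Adj z s)
    (hz : ∀ u w, G.Adj z u → G.Adj z w → u ≠ w → G.Adj u w) :
    k < sbn (G ⊔ SimpleGraph.edge x y) := by
  have hzT : ∀ T, IsMinSeparator G T → ∀ s ∈ S, s ∉ T → z ∈ comp G T s := fun T hT s hs hsT =>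
    mem_comp_of_adj (mem_comp_self hsT) (hG.notMem_of_simplicial hT hz) (hzS s hs).symm
  refine hG.lt_sbn_sup_edge hS hx hy hxy h1 ?_ fun T T' hT hT' _ _ s hs hsT s' hs' hsT' =>
    ⟨z, hzT T hT s hs hsT, hzT T' hT' s' hs' hsT'⟩
  intro T hT hTS s hs hsT
  obtain ⟨t, ht, htS⟩ := hG.nonempty_diff hT (hG.ncard_eq S hS) hTS.symm
  -- `T` leaves `S` into one component only, so one of the two large components survives in `G - T`;
  -- together with `s` it has more than `k` vertices.
  obtain ⟨c, hc, hkc, htc⟩ : ∃ c, c ∉ S ∧ k ≤ (comp G S c).ncard ∧ c ∉ comp G S t := by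
    by_cases h : a ∈ comp G S t
    · refine ⟨b, hb, hkb, fun h' => hab ?_⟩
      rwa [comp_eq h]
    · exact ⟨a, ha, hka, h⟩
  have hd := disjoint_comp_of_isClique (hG.isClique hT) ht (mem_comp_self htS) htc
  have hsub := hG.comp_subset_comp hS hc hs hsT hd
  refine lt_of_le_of_lt hkc (Set.ncard_lt_ncard ⟨hsub, fun h => ?_⟩)
  exact notMem_of_mem_comp (h (mem_comp_self hsT)) hs

end IsUniform

/-! ### Sparse interval graphs and their separators -/

section Interval

/-- The left ends of the intervals that represent `intervalGraph`. -/
def leftEnd (k p l x : ℕ) : ℕ :=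
  if x < k + p then 2 * (x + 1 - k) else if x < k + p + l then 2 * (x - (k + p)) + 1
  else if x < 2 * k + p + l then 0 else 2 * p + 2

/-- The right ends of the intervals that represent `intervalGraph`. -/
def rightEnd (k p l x : ℕ) : ℕ :=
  if x < k + p then 2 * x + 2 else if x < k + p + l then 2 * (x - (k + p)) + 1
  else if x < 2 * k + p + l then 0 else 2 * p + 2

/-- The four kinds of vertices: the first `k + p` form the `k`-th power of a path; the next `l` are
single points `2 * j + 1`, each adjacent precisely to the `j`-th window; two end cliques sit at the
points `0` and `2 * p + 2`, complete to the first and the last window. -/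
theorem ends_spec (k p l x : ℕ) :
    (x < k + p ∧ leftEnd k p l x = 2 * (x + 1 - k) ∧ rightEnd k p l x = 2 * x + 2) ∨
    (k + p ≤ x ∧ x < k + p + l ∧ leftEnd k p l x = 2 * (x - (k + p)) + 1 ∧
      rightEnd k p l x = 2 * (x - (k + p)) + 1) ∨
    (k + p + l ≤ x ∧ x < 2 * k + p + l ∧ leftEnd k p l x = 0 ∧ rightEnd k p l x = 0) ∨
    (2 * k + p + l ≤ x ∧ leftEnd k p l x = 2 * p + 2 ∧ rightEnd k p l x = 2 * p + 2) := by
  unfold leftEnd rightEnd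
  split_ifs <;> omega

/-- An interval graph in which all but `2 * k` vertices of an elimination order have at most `k`
earlier neighbours. -/
def intervalGraph (n k p l : ℕ) : SimpleGraph (Fin n) where
  Adj x y := (x : ℕ) ≠ (y : ℕ) ∧ leftEnd k p l x ≤ rightEnd k p l y ∧
    leftEnd k p l y ≤ rightEnd k p l x
  symm := ⟨fun _ _ h => ⟨h.1.symm, h.2.2, h.2.1⟩⟩
  loopless := ⟨fun _ h => h.1 rfl⟩

theorem intervalGraph_adj {n k p l : ℕ} {x y : Fin n} : (intervalGraph n k p l).Adj x y ↔
    (x : ℕ) ≠ (y : ℕ) ∧ leftEnd k p l x ≤ rightEnd k p l y ∧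
      leftEnd k p l y ≤ rightEnd k p l x := Iff.rfl

/-- A separator of `intervalGraph`. -/
def window (n k i : ℕ) : Set (Fin n) := {x | i ≤ (x : ℕ) ∧ (x : ℕ) < i + k}

theorem mem_window {n k i : ℕ} {x : Fin n} :
    x ∈ window n k i ↔ i ≤ (x : ℕ) ∧ (x : ℕ) < i + k := Iff.rfl

variable {n k p l i : ℕ}

theorem ncard_window (h : i + k ≤ n) : (window n k i).ncard = k := by
  rw [window, ncard_fin_Ico h]
  omega

/-- A vertex of `W` whose interval ends first is simplicial, since all its neighbours in `W` contain
its right end. -/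
theorem isChordal_intervalGraph : IsChordal (intervalGraph n k p l) := by
  refine isChordal_of_exists_simplicial fun W hW hne => ?_
  obtain ⟨v, hv, hmin⟩ := Set.exists_min_image W (fun x : Fin n => rightEnd k p l x) hW hne
  refine ⟨v, hv, fun a ha b hb hab hva hvb => ?_⟩
  rw [intervalGraph_adj] at *
  have h1 := hmin a ha
  have h2 := hmin b hb
  have h3 := Fin.val_ne_of_ne hab
  omega

/-- The position of a vertex relative to the `i`-th separator. -/
def side (k p l i x : ℕ) : ℕ :=
  if rightEnd k p l x < 2 * i + 1 then 0 else if 2 * i + 1 < leftEnd k p l x then 2 else 1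

theorem side_spec (k p l i x : ℕ) : (side k p l i x = 0 ∧ rightEnd k p l x < 2 * i + 1) ∨
    (side k p l i x = 2 ∧ 2 * i + 1 < leftEnd k p l x ∧ 2 * i + 1 ≤ rightEnd k p l x) ∨
    (side k p l i x = 1 ∧ leftEnd k p l x ≤ 2 * i + 1 ∧ 2 * i + 1 ≤ rightEnd k p l x) := by
  unfold side
  split_ifs <;> omega

/-- Outside the window only a single-point interval can contain `2 * i + 1`, so intervals in
different positions are disjoint. -/
theorem side_eq_of_adj {x y : Fin n} (hi : i ≤ p) (hx : x ∉ window n k i) (hy : y ∉ window n k i)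
    (h : (intervalGraph n k p l).Adj x y) : side k p l i x = side k p l i y := by
  rw [mem_window] at hx hy
  rw [intervalGraph_adj] at h
  have h1 := side_spec k p l i x
  have h2 := side_spec k p l i y
  have h3 := ends_spec k p l x
  have h4 := ends_spec k p l y
  omega

theorem side_eq_of_isConnectedSet {x y : Fin n} {A : Set (Fin n)} (hi : i ≤ p)
    (hA : IsConnectedSet (intervalGraph n k p l) A) (hd : Disjoint A (window n k i)) (hx : x ∈ A)
    (hy : y ∈ A) : side k p l i y = side k p l i x :=
  hA.subset_of_closed (J := {y : Fin n | side k p l i y = side k p l i x}) hx rfl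
    (fun _ hu hux _ hw huw => (side_eq_of_adj hi (Set.disjoint_left.1 hd hu)
      (Set.disjoint_left.1 hd hw) huw).symm.trans hux) hy

theorem notMem_comp_of_side_ne {x y : Fin n} (hi : i ≤ p) (hx : x ∉ window n k i)
    (h : side k p l i x ≠ side k p l i y) :
    y ∉ comp (intervalGraph n k p l) (window n k i) x := fun hy =>
  h (side_eq_of_isConnectedSet hi (isConnectedSet_comp hx) (disjoint_comp _ _ _) hy
    (mem_comp_self hx))

theorem exists_side_ne {x y : Fin n} (hk : 1 ≤ k) (hl : l ≤ p + 1) (hxy : x ≠ y) (h : ¬ (intervalGraph n k p l).Adj x y) :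
    ∃ i ≤ p, x ∉ window n k i ∧ y ∉ window n k i ∧ side k p l i x ≠ side k p l i y := by
  wlog hlt : rightEnd k p l x < leftEnd k p l y generalizing x y
  · obtain ⟨i, hi, h1, h2, h3⟩ := this hxy.symm (fun h' => h h'.symm) (by
      rw [intervalGraph_adj] at h
      have := Fin.val_ne_of_ne hxy
      omega)
    exact ⟨i, hi, h2, h1, h3.symm⟩
  have h3 := ends_spec k p l x
  have h4 := ends_spec k p l y
  have h1 := side_spec k p l (rightEnd k p l x / 2) x
  have h2 := side_spec k p l (rightEnd k p l x / 2) y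
  -- For this index, `2 * i + 1` is the first odd point not before the right end of `x`.
  refine ⟨rightEnd k p l x / 2, ?_⟩
  simp only [mem_window]
  clear h hxy
  rcases h3 with h3 | h3 | h3 | h3 <;> rcases h4 with h4 | h4 | h4 | h4 <;> omega

end Interval

/-! ### Edge-maximality of the interval graphs -/

section Interval

variable {n k p l i : ℕ}

/-- In a bramble of larger order every member has more than `k` vertices, so a member avoiding a
window lies strictly to its left or to its right. Left of the first window there are only `k`
vertices. No interval fits strictly between consecutive odd points up to `2 * p + 1`, so the members
stay on the right, and to the right of the last window there are again only `k` vertices. -/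
theorem sbn_intervalGraph_le (hk : 1 ≤ k) (hl : l ≤ p + 1) (hn : n = 3 * k + p + l) :
    sbn (intervalGraph n k p l) ≤ k := by
  rw [sbn_le_iff]
  intro B hB
  by_contra! hcon
  have key : ∀ X : Set (Fin n), X.ncard ≤ k → ∃ A ∈ B, Disjoint A X := fun X hX =>
    exists_disjoint_of_not_covers fun hc => absurd (hcon X hc) (not_lt.2 hX)
  have hno : ∀ E ∈ B, k < E.ncard := by
    intro E hE
    by_contra! h
    obtain ⟨E', hE', hd⟩ := key E h
    exact Set.not_disjoint_iff_nonempty_inter.2 (hB.2 E' hE' E hE) hd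
  have hside : ∀ i ≤ p, ∃ E ∈ B, ∃ c, c ≠ 1 ∧ ∀ x ∈ E, side k p l i x = c := by
    intro i hi
    obtain ⟨E, hE, hd⟩ := key (window n k i) (ncard_window (by omega)).le
    obtain ⟨e, he⟩ := (hB.1 E hE).nonempty
    have h1 : ∀ x ∈ E, side k p l i x = side k p l i e := fun x hx =>
      side_eq_of_isConnectedSet hi (hB.1 E hE) hd he hx
    refine ⟨E, hE, _, fun h => ?_, h1⟩
    refine absurd (hno E hE) (not_lt.2 (le_trans ?_ hk))
    refine (Set.ncard_le_one_iff E.toFinite).2 fun {a b} ha hb => Fin.ext ?_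
    have ha1 := h1 a ha
    have hb1 := h1 b hb
    have ha2 := Set.disjoint_left.1 hd ha
    have hb2 := Set.disjoint_left.1 hd hb
    rw [mem_window] at ha2 hb2
    have h2 := side_spec k p l i a
    have h3 := side_spec k p l i b
    have h4 := ends_spec k p l a
    have h5 := ends_spec k p l b
    omega
  have hright : ∀ i ≤ p, ∃ E ∈ B, ∀ x ∈ E, 2 * i + 1 < leftEnd k p l x := by
    intro i hi
    induction i with
    | zero =>
      obtain ⟨E, hE, c, hc, h⟩ := hside 0 hi
      refine ⟨E, hE, fun x hx => ?_⟩
      by_contra! hx0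
      refine absurd (hno E hE) (not_lt.2 ?_)
      have h1 := ncard_fin_Ico (n := n) (a := k + p + l) (b := 2 * k + p + l) (by omega)
      refine (Set.ncard_le_ncard fun y hy => ?_).trans (h1.trans_le (by omega))
      have h2 := h x hx
      have h3 := h y hy
      have h4 := side_spec k p l 0 x
      have h5 := side_spec k p l 0 y
      have h6 := ends_spec k p l y
      show k + p + l ≤ (y : ℕ) ∧ (y : ℕ) < 2 * k + p + l
      omega
    | succ i ih =>
      obtain ⟨E, hE, h⟩ := ih (by omega)
      obtain ⟨E', hE', c, hc, h'⟩ := hside (i + 1) hi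
      refine ⟨E', hE', fun x hx => ?_⟩
      by_contra! hx0
      obtain ⟨y, hy, hy'⟩ := hB.2 E hE E' hE'
      have h1 := h y hy
      have h2 := h' x hx
      have h3 := h' y hy'
      have h4 := side_spec k p l (i + 1) x
      have h5 := side_spec k p l (i + 1) y
      have h6 := ends_spec k p l y
      omega
  obtain ⟨E, hE, h⟩ := hright p le_rfl
  refine absurd (hno E hE) (not_lt.2 ?_)
  have h1 := ncard_fin_Ico (n := n) (a := 2 * k + p + l) (b := n) le_rfl
  refine (Set.ncard_le_ncard fun y hy => ?_).trans (h1.trans_le (by omega))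
  have h2 := h y hy
  have h3 := ends_spec k p l y
  have h4 := y.isLt
  show 2 * k + p + l ≤ (y : ℕ) ∧ (y : ℕ) < n
  omega

/-- Each window keeps a vertex, survivors of consecutive windows are equal or adjacent, and every
vertex lies in a window or is complete to one. -/
theorem isKConnectedOn_intervalGraph (hk : 1 ≤ k) (hl : l ≤ p + 1) (hn : n = 3 * k + p + l) :
    IsKConnectedOn (intervalGraph n k p l) k Set.univ := by
  intro X hX
  have hr : ∀ i ≤ p, ∃ x ∈ window n k i, x ∉ X := fun i hi =>
    exists_mem_notMem_of_ncard_lt (by rwa [ncard_window (by omega)])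
  obtain ⟨x₀, hx₀, hx₀X⟩ := hr 0 (Nat.zero_le _)
  refine isConnectedSet_of ⟨trivial, hx₀X⟩ fun J _ hx₀J hJ => ?_
  have hstep : ∀ x ∈ J, ∀ y, y ∉ X → (intervalGraph n k p l).Adj x y → y ∈ J :=
    fun x hxJ y hyX hxy => hJ x hxJ y ⟨trivial, hyX⟩ hxy
  have hw : ∀ i ≤ p, ∀ x ∈ window n k i, x ∉ X → x ∈ J := by
    intro i hi
    induction i with
    | zero =>
      intro x hx hxX
      by_cases h : x = x₀
      · exact h ▸ hx₀J
      · refine hstep x₀ hx₀J x hxX ?_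
        have h1 := Fin.val_ne_of_ne h
        have h2 := ends_spec k p l x
        have h3 := ends_spec k p l x₀
        rw [mem_window] at hx hx₀
        rw [intervalGraph_adj]
        omega
    | succ i ih =>
      intro x hx hxX
      obtain ⟨y, hy, hyX⟩ := hr i (by omega)
      have hyJ := ih (by omega) y hy hyX
      by_cases h : x = y
      · exact h ▸ hyJ
      · refine hstep y hyJ x hxX ?_
        have h1 := Fin.val_ne_of_ne h
        have h2 := ends_spec k p l x
        have h3 := ends_spec k p l y
        rw [mem_window] at hx hy
        rw [intervalGraph_adj]
        omega
  rintro x ⟨-, hxX⟩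
  obtain ⟨i, hi, h⟩ : ∃ i ≤ p, x ∈ window n k i ∨
      ∀ y ∈ window n k i, (intervalGraph n k p l).Adj y x := by
    have h2 := ends_spec k p l x
    simp only [mem_window, intervalGraph_adj]
    rcases h2 with h2 | h2 | h2 | h2
    · exact ⟨min x p, by omega, Or.inl (by omega)⟩
    · refine ⟨x - (k + p), by omega, Or.inr fun y hy => ?_⟩
      have h3 := ends_spec k p l y
      omega
    · refine ⟨0, by omega, Or.inr fun y hy => ?_⟩
      have h3 := ends_spec k p l y
      omega
    · refine ⟨p, by omega, Or.inr fun y hy => ?_⟩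
      have h3 := ends_spec k p l y
      omega
  rcases h with h | h
  · exact hw i hi x h hxX
  · obtain ⟨y, hy, hyX⟩ := hr i hi
    exact hstep y (hw i hi y hy hyX) x hxX (h y hy)

theorem isUniform_intervalGraph (hk : 1 ≤ k) (hl : l ≤ p + 1) (hn : n = 3 * k + p + l) :
    IsUniform (intervalGraph n k p l) k := by
  refine (isKConnectedOn_intervalGraph hk hl hn).isUniform isChordal_intervalGraph
    fun x y hxy hadj => ?_
  obtain ⟨i, hi, hx, hy, h⟩ := exists_side_ne hk hl hxy hadj
  exact ⟨_, (ncard_window (by omega)).le,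
    isSeparator_iff.2 ⟨hx, hy, notMem_comp_of_side_ne hi hx h⟩⟩

/-- From any vertex left of the cut, walk down the path to the vertex `0`, or start in the end
clique at the point `0`; either way the component contains all `k` vertices of that clique. -/
theorem le_ncard_comp_left {x : Fin n} (hk : 1 ≤ k) (hl : l ≤ p + 1) (hn : n = 3 * k + p + l)
    (hi : i ≤ p) (hx : side k p l i x = 0) :
    k ≤ (comp (intervalGraph n k p l) (window n k i) x).ncard := by
  set C := comp (intervalGraph n k p l) (window n k i) x with hC
  have hxw : x ∉ window n k i := by
    have h1 := side_spec k p l i x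
    have h2 := ends_spec k p l x
    rw [mem_window]
    omega
  have hxC : x ∈ C := mem_comp_self hxw
  have hstep : ∀ u ∈ C, ∀ w : Fin n, side k p l i w = 0 → (intervalGraph n k p l).Adj u w → w ∈ C := by
    intro u hu w hw huw
    refine mem_comp_of_adj hu ?_ huw
    have h1 := side_spec k p l i w
    have h2 := ends_spec k p l w
    rw [mem_window]
    omega
  have hdown : ∀ j, ∀ y ∈ C, (y : ℕ) = j → j < k + p → j < i → ∃ y ∈ C, (y : ℕ) = 0 := by
    intro j
    induction j with
    | zero => exact fun y hy hy0 _ _ => ⟨y, hy, hy0⟩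
    | succ j ih =>
      intro y hy hyj hjk hji
      refine ih ⟨j, by omega⟩ (hstep y hy _ ?_ ?_) rfl (by omega) (by omega)
      · have h1 := side_spec k p l i j
        have h2 := ends_spec k p l j
        dsimp only
        omega
      · have h1 := ends_spec k p l j
        have h2 := ends_spec k p l y
        rw [intervalGraph_adj]
        dsimp only
        omega
  obtain ⟨a, haC, ha⟩ : ∃ a ∈ C, (a : ℕ) = 0 ∧ 0 < i ∨ k + p + l ≤ (a : ℕ) ∧
      (a : ℕ) < 2 * k + p + l := by
    have h1 := side_spec k p l i x
    have h2 := ends_spec k p l x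
    by_cases h : (x : ℕ) < k + p
    · obtain ⟨y, hy, hy0⟩ := hdown x x hxC rfl h (by omega)
      exact ⟨y, hy, Or.inl ⟨hy0, by omega⟩⟩
    by_cases h' : (x : ℕ) < k + p + l
    · have hlt : (x : ℕ) - (k + p) < n := by omega
      have hmem : (⟨(x : ℕ) - (k + p), hlt⟩ : Fin n) ∈ C := by
        refine hstep x hxC _ ?_ ?_
        · have h1 := side_spec k p l i ((x : ℕ) - (k + p))
          have h2 := ends_spec k p l ((x : ℕ) - (k + p))
          dsimp only
          omega
        · have h1 := ends_spec k p l ((x : ℕ) - (k + p))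
          rw [intervalGraph_adj]
          dsimp only
          omega
      obtain ⟨y, hy, hy0⟩ := hdown (x - (k + p)) _ hmem rfl (by omega) (by omega)
      exact ⟨y, hy, Or.inl ⟨hy0, by omega⟩⟩
    · exact ⟨x, hxC, Or.inr (by omega)⟩
  have h1 := ncard_fin_Ico (n := n) (a := k + p + l) (b := 2 * k + p + l) (by omega)
  refine le_trans (by omega) (h1.symm.trans_le (Set.ncard_le_ncard fun y hy => ?_))
  have hy' : k + p + l ≤ (y : ℕ) ∧ (y : ℕ) < 2 * k + p + l := hy
  by_cases hay : (a : ℕ) = y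
  · exact Fin.ext hay ▸ haC
  · have h3 := ends_spec k p l a
    have h4 := ends_spec k p l y
    have h5 := side_spec k p l i y
    refine hstep a haC y (by omega) ?_
    rw [intervalGraph_adj]
    omega

theorem le_ncard_comp_right {x : Fin n} (hk : 1 ≤ k) (hl : l ≤ p + 1) (hn : n = 3 * k + p + l)
    (hi : i ≤ p) (hx : side k p l i x = 2) :
    k ≤ (comp (intervalGraph n k p l) (window n k i) x).ncard := by
  set C := comp (intervalGraph n k p l) (window n k i) x with hC
  have hxw : x ∉ window n k i := by
    have h1 := side_spec k p l i x
    have h2 := ends_spec k p l x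
    rw [mem_window]
    omega
  have hxC : x ∈ C := mem_comp_self hxw
  have hstep : ∀ u ∈ C, ∀ w : Fin n, side k p l i w = 2 → (intervalGraph n k p l).Adj u w → w ∈ C := by
    intro u hu w hw huw
    refine mem_comp_of_adj hu ?_ huw
    have h1 := side_spec k p l i w
    have h2 := ends_spec k p l w
    rw [mem_window]
    omega
  have hup : ∀ j, ∀ y ∈ C, (y : ℕ) + j + 1 = k + p → i + k ≤ (y : ℕ) →
      ∃ y ∈ C, (y : ℕ) + 1 = k + p := by
    intro j
    induction j with
    | zero => exact fun y hy hy0 _ => ⟨y, hy, hy0⟩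
    | succ j ih =>
      intro y hy hyj hiy
      refine ih ⟨y + 1, by omega⟩ (hstep y hy _ ?_ ?_) (by dsimp only; omega) (by dsimp only; omega)
      · have h1 := side_spec k p l i (y + 1)
        have h2 := ends_spec k p l (y + 1)
        dsimp only
        omega
      · have h1 := ends_spec k p l (y + 1)
        have h2 := ends_spec k p l y
        rw [intervalGraph_adj]
        dsimp only
        omega
  obtain ⟨a, haC, ha⟩ : ∃ a ∈ C, (a : ℕ) + 1 = k + p ∧ i < p ∨ 2 * k + p + l ≤ (a : ℕ) := by
    have h1 := side_spec k p l i x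
    have h2 := ends_spec k p l x
    by_cases h : (x : ℕ) < k + p
    · obtain ⟨y, hy, hy0⟩ := hup (k + p - 1 - x) x hxC (by omega) (by omega)
      exact ⟨y, hy, Or.inl ⟨hy0, by omega⟩⟩
    by_cases h' : (x : ℕ) < k + p + l
    · have hlt : (x : ℕ) - p - 1 < n := by omega
      have hmem : (⟨(x : ℕ) - p - 1, hlt⟩ : Fin n) ∈ C := by
        refine hstep x hxC _ ?_ ?_
        · have h1 := side_spec k p l i ((x : ℕ) - p - 1)
          have h2 := ends_spec k p l ((x : ℕ) - p - 1)
          dsimp only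
          omega
        · have h1 := ends_spec k p l ((x : ℕ) - p - 1)
          rw [intervalGraph_adj]
          dsimp only
          omega
      obtain ⟨y, hy, hy0⟩ := hup (k + p - 1 - (x - p - 1)) _ hmem (by dsimp only; omega)
        (by dsimp only; omega)
      exact ⟨y, hy, Or.inl ⟨hy0, by omega⟩⟩
    · exact ⟨x, hxC, Or.inr (by omega)⟩
  have h1 := ncard_fin_Ico (n := n) (a := 2 * k + p + l) (b := n) le_rfl
  refine le_trans (by omega) (h1.symm.trans_le (Set.ncard_le_ncard fun y hy => ?_))
  have hy' : 2 * k + p + l ≤ (y : ℕ) ∧ (y : ℕ) < n := hy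
  by_cases hay : (a : ℕ) = y
  · exact Fin.ext hay ▸ haC
  · have h3 := ends_spec k p l a
    have h4 := ends_spec k p l y
    have h5 := side_spec k p l i y
    refine hstep a haC y (by omega) ?_
    rw [intervalGraph_adj]
    omega

/-- The two end cliques supply a large component on either side of every window. A simplicial vertex
complete to the `i`-th window is its single-point vertex if `i < l`, and a vertex of the last end
clique if `i = p`; this is where `p ≤ l` is needed. -/
theorem isEdgeMaximal_intervalGraph (hk : 1 ≤ k) (hpl : p ≤ l) (hl : l ≤ p + 1)
    (hn : n = 3 * k + p + l) : IsEdgeMaximal (intervalGraph n k p l) k := by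
  refine ⟨sbn_intervalGraph_le hk hl hn, fun x y hxy hadj => ?_⟩
  have hU := isUniform_intervalGraph hk hl hn
  obtain ⟨i, hi, hx, hy, h⟩ := exists_side_ne hk hl hxy hadj
  have hc := notMem_comp_of_side_ne hi hx h
  have hS : IsMinSeparator (intervalGraph n k p l) (window n k i) :=
    ⟨x, y, hU.minimal_isSeparator (ncard_window (by omega)).le (isSeparator_iff.2 ⟨hx, hy, hc⟩)⟩
  have hpos : ∀ z, z ∉ window n k i →
      1 ≤ (comp (intervalGraph n k p l) (window n k i) z).ncard := fun z hz =>
    (Set.ncard_pos).2 ⟨z, mem_comp_self hz⟩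
  have h1 : k < (comp (intervalGraph n k p l) (window n k i) x).ncard +
      (comp (intervalGraph n k p l) (window n k i) y).ncard := by
    have hx1 := hpos x hx
    have hy1 := hpos y hy
    have hx2 := le_ncard_comp_left (x := x) hk hl hn hi
    have hy2 := le_ncard_comp_left (x := y) hk hl hn hi
    have hx3 := le_ncard_comp_right (x := x) hk hl hn hi
    have hy3 := le_ncard_comp_right (x := y) hk hl hn hi
    have hx4 := side_spec k p l i x
    have hy4 := side_spec k p l i y
    omega
  have haside : side k p l i (k + p + l) = 0 := by
    have h1 := side_spec k p l i (k + p + l)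
    have h2 := ends_spec k p l (k + p + l)
    omega
  have hbside : side k p l i (2 * k + p + l) = 2 := by
    have h1 := side_spec k p l i (2 * k + p + l)
    have h2 := ends_spec k p l (2 * k + p + l)
    omega
  have ha : (⟨k + p + l, by omega⟩ : Fin n) ∉ window n k i := by
    rw [mem_window]
    dsimp only
    omega
  have hb : (⟨2 * k + p + l, by omega⟩ : Fin n) ∉ window n k i := by
    rw [mem_window]
    dsimp only
    omega
  have hab := notMem_comp_of_side_ne (y := (⟨2 * k + p + l, by omega⟩ : Fin n)) hi ha
    (by rw [haside, hbside]; omega)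
  obtain ⟨z, hz⟩ : ∃ z : Fin n, ((z : ℕ) = k + p + i ∧ i < l) ∨
      ((z : ℕ) = 2 * k + p + l ∧ i = p) := by
    by_cases h : i < l
    · exact ⟨⟨k + p + i, by omega⟩, Or.inl ⟨rfl, h⟩⟩
    · exact ⟨⟨2 * k + p + l, by omega⟩, Or.inr ⟨rfl, by omega⟩⟩
  have hz1 := ends_spec k p l z
  refine hU.lt_sbn_sup_edge_of_simplicial (z := z) hS hx hy hc h1 ha hb hab
    (le_ncard_comp_left hk hl hn hi haside) (le_ncard_comp_right hk hl hn hi hbside)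
    (fun s hs => ?_) fun u w hu hw huw => ?_
  · have h2 := ends_spec k p l s
    rw [mem_window] at hs
    rw [intervalGraph_adj]
    omega
  · have h3 := Fin.val_ne_of_ne huw
    rw [intervalGraph_adj] at *
    omega

end Interval

/-! ### Edge numbers of the interval graphs and the gap -/

section IntervalEdges

variable {n k p l : ℕ}

/-- The first `k` vertices and the two end cliques contribute `k.choose 2` each, and every vertex
from `k` on has at most `k` further earlier neighbours. -/
theorem numEdges_intervalGraph_le (hn : n = 3 * k + p + l) :
    numEdges (intervalGraph n k p l) ≤ 3 * k.choose 2 + k * (n - k) := by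
  have hsub : ∀ (x : Fin n) (c d e : ℕ), d ≤ n →
      (∀ u : Fin n, u < x → (intervalGraph n k p l).Adj u x →
        c ≤ (u : ℕ) ∧ (u : ℕ) < d ∨ e ≤ (u : ℕ)) →
      {u | u < x ∧ (intervalGraph n k p l).Adj u x}.ncard ≤ (d - c) + (x - e) := by
    intro x c d e hd h
    have h1 : {u | u < x ∧ (intervalGraph n k p l).Adj u x} ⊆
        {u : Fin n | c ≤ (u : ℕ) ∧ (u : ℕ) < d} ∪ {u : Fin n | e ≤ (u : ℕ) ∧ (u : ℕ) < (x : ℕ)} :=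
      fun u hu => (h u hu.1 hu.2).imp id fun hu' => ⟨hu', hu.1⟩
    refine (Set.ncard_le_ncard h1).trans ((Set.ncard_union_le _ _).trans ?_)
    rw [ncard_fin_Ico hd, ncard_fin_Ico x.isLt.le]
  have hdeg : ∀ x : Fin n, {u | u < x ∧ (intervalGraph n k p l).Adj u x}.ncard ≤
      if (x : ℕ) < k then (x : ℕ) else if (x : ℕ) < k + p + l then k
      else if (x : ℕ) < k + p + l + k then k + (x - (k + p + l))
      else k + (x - (k + p + l + k)) := by
    intro x
    have hx := ends_spec k p l x
    have hxn := x.isLt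
    split_ifs with h1 h2 h3
    · refine (hsub x 0 0 0 (by omega) fun u _ _ => by omega).trans (by omega)
    · by_cases h : (x : ℕ) < k + p
      · refine (hsub x 0 0 (x - k) (by omega) fun u hu hux => ?_).trans (by omega)
        have hu := ends_spec k p l u
        rw [intervalGraph_adj] at hux
        omega
      · refine (hsub x (x - (k + p)) (x - (k + p) + k) x (by omega) fun u hu hux => ?_).trans
          (by omega)
        have hu' := ends_spec k p l u
        rw [intervalGraph_adj] at hux
        rw [Fin.lt_def] at hu
        omega
    · refine (hsub x 0 k (k + p + l) (by omega) fun u hu hux => ?_).trans (by omega)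
      have hu' := ends_spec k p l u
      rw [intervalGraph_adj] at hux
      rw [Fin.lt_def] at hu
      omega
    · refine (hsub x p (p + k) (k + p + l + k) (by omega) fun u hu hux => ?_).trans (by omega)
      have hu' := ends_spec k p l u
      rw [intervalGraph_adj] at hux
      rw [Fin.lt_def] at hu
      omega
  rw [numEdges_eq_sum]
  refine (Finset.sum_le_sum fun x _ => hdeg x).trans ?_
  rw [Fin.sum_univ_eq_sum_range (fun x => if x < k then x else if x < k + p + l then k
    else if x < k + p + l + k then k + (x - (k + p + l)) else k + (x - (k + p + l + k))) n]
  have hs : ∑ x ∈ Finset.range k, x = k.choose 2 := by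
    rw [Finset.sum_range_id, Nat.choose_two_right]
  obtain rfl : n = k + (p + l) + k + k := by omega
  rw [Finset.sum_range_add, Finset.sum_range_add, Finset.sum_range_add]
  have h1 : ∑ x ∈ Finset.range k, (k + x) = k * k + k.choose 2 := by
    rw [Finset.sum_add_distrib, hs, Finset.sum_const, Finset.card_range, smul_eq_mul]
  have h2 : ∑ _x ∈ Finset.range (p + l), k = (p + l) * k := by
    rw [Finset.sum_const, Finset.card_range, smul_eq_mul]
  refine le_of_eq (Eq.trans (congrArg₂ (· + ·) (congrArg₂ (· + ·) (congrArg₂ (· + ·)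
    ((Finset.sum_congr rfl fun x hx => ?_).trans hs)
    ((Finset.sum_congr rfl fun x hx => ?_).trans h2))
    ((Finset.sum_congr rfl fun x hx => ?_).trans h1))
    ((Finset.sum_congr rfl fun x hx => ?_).trans h1)) ?_)
  iterate 4
    rw [Finset.mem_range] at hx
    split_ifs <;> omega
  rw [show k + (p + l) + k + k - k = (p + l) + k + k by omega]
  ring

/-- Edge-maximal graphs on the same vertex set whose numbers of edges differ by the given gap. -/
theorem exists_gapBound_le {n k : ℕ} (hk : 1 ≤ k) (hn : 3 * k ≤ n) :
    ∃ G G' : SimpleGraph (Fin n), IsEdgeMaximal G k ∧ IsEdgeMaximal G' k ∧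
      gapBound n k ≤ (numEdges G : ℚ) - (numEdges G' : ℚ) := by
  obtain ⟨h1, h2⟩ := blockGraph_spec hk (show k ≤ n by omega)
  obtain ⟨m, hm⟩ := Nat.exists_eq_add_of_le hn
  -- Halving the surplus over `3 * k` ensures `p ≤ l ≤ p + 1`.
  have hn' : n = 3 * k + m / 2 + (m - m / 2) := by omega
  refine ⟨_, _, h1, isEdgeMaximal_intervalGraph hk (by omega) (by omega) hn', ?_⟩
  have h3 : (numEdges (intervalGraph n k (m / 2) (m - m / 2)) : ℚ) ≤
      ((3 * k.choose 2 + k * (n - k) : ℕ) : ℚ) := by exact_mod_cast numEdges_intervalGraph_le hn'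
  push_cast [show k ≤ n by omega] at h3
  rw [h2, edgeBound, gapBound]
  rw [Nat.cast_choose_two] at *
  linarith

end IntervalEdges

end StrictBramble

theorem mainTheorem2 :
    -- edge-maximal graphs are exactly the domino-trees
    (∀ (k : ℕ) (V : Type*) [Finite V] (G : SimpleGraph V), StrictBramble.sbn G ≤ k →
      (StrictBramble.IsEdgeMaximal G k ↔ StrictBramble.IsDominoTree G k)) ∧
    -- the upper bound on the number of edges
    (∀ (k : ℕ) (V : Type*) [Finite V] (G : SimpleGraph V), 1 ≤ k → k ≤ Nat.card V →
      StrictBramble.sbn G ≤ k →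
      (StrictBramble.numEdges G : ℚ) ≤ StrictBramble.edgeBound (Nat.card V) k) ∧
    -- the bound is tight
    (∀ k n : ℕ, 1 ≤ k → k ≤ n → ∃ G : SimpleGraph (Fin n),
      StrictBramble.IsEdgeMaximal G k ∧
      (StrictBramble.numEdges G : ℚ) = StrictBramble.edgeBound n k) ∧
    -- edge-maximal graphs on the same vertex set with different numbers of edges
    (∀ k n : ℕ, 1 ≤ k → 3 * k ≤ n → ∃ G G' : SimpleGraph (Fin n),
      StrictBramble.IsEdgeMaximal G k ∧ StrictBramble.IsEdgeMaximal G' k ∧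
      StrictBramble.gapBound n k ≤
        (StrictBramble.numEdges G : ℚ) - (StrictBramble.numEdges G' : ℚ)) ∧
    (∃ G G' : SimpleGraph (Fin 8),
      StrictBramble.IsEdgeMaximal G 2 ∧ StrictBramble.IsEdgeMaximal G' 2 ∧
      StrictBramble.numEdges G ≠ StrictBramble.numEdges G') := by
  refine ⟨fun k V _ G hG => ⟨fun h => h.isDominoTree, fun h => h.isEdgeMaximal hG⟩,
    fun k V _ G hk hn hG => StrictBramble.numEdges_le_edgeBound hG hk hn,
    fun k n hk hn => ⟨_, StrictBramble.blockGraph_spec hk hn⟩,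
    fun k n hk hn => StrictBramble.exists_gapBound_le hk hn, ?_⟩
  obtain ⟨G, G', hG, hG', h⟩ :=
    StrictBramble.exists_gapBound_le (n := 8) (k := 2) (by omega) (by omega)
  refine ⟨G, G', hG, hG', fun he => ?_⟩
  -- For `k = 2` and `n = 8` the gap is `4 - 3 = 1`, which is positive.
  rw [he, sub_self, StrictBramble.gapBound] at h
  norm_num at h
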